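/- **Setting.** Let $(\Gamma,d)$ be a metric space (the set of sites, finite or infinite), with a complex Hilbert space $\mathcal H_x$ (of any dimension) and a self-adjoint, possibly unbounded, operator $H_x$ on $\mathcal H_x$ for each $x\in\Gamma$. For finite $X\subset\Gamma$ put $\mathcal H_X=\bigotimes_{x\in X}\mathcal H_x$ and let $\mathcal A_X$ be the bounded operators on $\mathcal H_X$; for $X\subset Y$ identify $A\in\mathcal A_X$ with $A\otimes 1\in\mathcal A_Y$. An interaction $\Phi$ assigns to each finite $X\subset\Gamma$ a self-adjoint $\Phi(X)\in\mathcal A_X$. For finite $\Lambda\subset\Gamma$ let $$H_\Lambda=\sum_{x\in\Lambda}H_x+\sum_{X\subset\Lambda}\Phi(X),\qquad \tau^\Lambda_t(A)=e^{itH_\Lambda}Ae^{-itH_\Lambda}.$$ The $\Phi$-boundary $\partial_\Phi X$ of a finite set $X$ is the set of $x\in X$ that lie in some finite $Z\subset\Gamma$ with $Z\cap X\neq\emptyset$, $Z\setminus X\ne\emptyset$ and $\Phi(Z)\neq0$. Let $d(X,Y)=\min_{x\in X,y\in Y}d(x,y)$. Let $F:[0,\infty)\to(0,\infty)$ be non-increasing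 with $$\|F\|=\sup_{x}\sum_{y}F(d(x,y))<\infty\quad\text{and}\quad \sup_{x,y}\sum_{z}\frac{F(d(x,z))F(d(z,y))}{F(d(x,y))}<\infty .$$ For $a>0$ put $F_a(r)=e^{-ar}F(r)$ and $$C_a=\sup_{x,y}\sum_{z}\frac{F_a(d(x,z))F_a(d(z,y))}{F_a(d(x,y))},\qquad \|\Phi\|_a=\sup_{x,y}\sum_{Z\ni x,y}\frac{\|\Phi(Z)\|}{F_a(d(x,y))},$$ all sums and suprema being over $\Gamma$ (respectively over finite $Z\subset\Gamma$). A self-adjoint operator $H$ has a unit vector $\Omega$ as unique ground state with a spectral gap (of at least) $\gamma>0$ if, for some $E_0\in\mathbb R$, $H\Omega=E_0\Omega$ and $\langle\psi,H\psi\rangle\ge(E_0+\gamma)\|\psi\|^2$ for all $\psi\in D(H)$ orthogonal to $\Omega$. Write $\langle A\rangle=\langle\Omega,A\Omega\rangle$. **Theorem (exponential clustering).** For every $F$ and $\gamma>0$ there is a constant $c$, depending only on $F$, $\|F\|$ and $\gamma$, with the following property. Let $\|\Phi\|_a<\infty$ for some $a>0$. Let $H$ have a unique ground state $\Omega$ with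 a spectral gap $\gamma>0$, where $H$ is either * (finite volume) $H_\Lambda$ for some finite $\Lambda\subset\Gamma$, or * (infinite volume) a self-adjoint operator on a Hilbert space carrying a unital $*$-representation $\pi$ of the algebra of local observables $\bigcup_X\mathcal A_X$ (union over finite $X\subset\Gamma$), such that $e^{itH}\pi(A)e^{-itH}=\lim_{\Lambda\uparrow\Gamma}\pi(\tau_t^\Lambda(A))$ in norm for all $t\in\mathbb R$ and all local $A$; in this case $\langle A\rangle=\langle\Omega,\pi(A)\Omega\rangle$. Then, with $$\mu=\frac{a\gamma}{\gamma+4\,C_a\,\|\Phi\|_a}>0,$$ for all disjoint finite sets $X,Y$ (contained in $\Lambda$ in the finite-volume case) and all $A\in\mathcal A_X$, $B\in\mathcal A_Y$, $$\bigl|\langle AB\rangle-\langle A\rangle\langle B\rangle\bigr|\le c\,\|A\|\,\|B\|\,\min\bigl(|\partial_\Phi X|,|\partial_\Phi Y|\bigr)\,e^{-\mu\, d(X,Y)} .$$ (If $F$ is normalized so that $C_a\le1$, this gives the bound with $\mu=a\gamma/(\gamma+4\|\Phi\|_a)$.) -/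

import Mathlib

open scoped ENNReal NNReal InnerProductSpace Topology

universe u v w

noncomputable section

namespace QuantumLattice

/-! ## Tensor products of Hilbert spaces -/

section Tensor

/-- An orthonormal basis (index set) of a Hilbert space. -/
def onbIndex (E : Type v) [NormedAddCommGroup E] [InnerProductSpace ℂ E] [CompleteSpace E] :
    Set E :=
  Classical.choose (exists_hilbertBasis ℂ E)

/-- An orthonormal basis of a Hilbert space. -/
def onb (E : Type v) [NormedAddCommGroup E] [InnerProductSpace ℂ E] [CompleteSpace E] :
    HilbertBasis (onbIndex E) ℂ E :=
  Classical.choose (Classical.choose_spec (exists_hilbertBasis ℂ E))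

lemma memℓp_prod {ι : Type u} [Fintype ι] {κ : ι → Type v}
    (f : (x : ι) → lp (fun _ : κ x => ℂ) 2) :
    Memℓp (fun i : (x : ι) → κ x => ∏ x : ι, f x (i x)) 2 := by
  classical
  refine memℓp_gen' (C := ∏ x : ι, ‖f x‖ ^ (2 : ℝ)) fun s => ?_
  have hsub : s ⊆ Fintype.piFinset (fun x : ι => s.image (fun i => i x)) := by
    intro i hi
    rw [Fintype.mem_piFinset]
    exact fun x => Finset.mem_image_of_mem _ hi
  have h1 : ∀ i : (x : ι) → κ x, ‖∏ x : ι, f x (i x)‖ ^ (2 : ℝ≥0∞).toReal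
      = ∏ x : ι, ‖f x (i x)‖ ^ (2 : ℝ) := fun i => by
    rw [norm_prod, ENNReal.toReal_ofNat, Real.finsetProd_rpow _ _ (fun _ _ => norm_nonneg _)]
  rw [Finset.sum_congr rfl fun i _ => h1 i]
  refine (Finset.sum_le_sum_of_subset_of_nonneg hsub fun _ _ _ =>
    Finset.prod_nonneg fun _ _ => by positivity).trans ?_
  rw [← Finset.prod_univ_sum (fun x : ι => s.image (fun i => i x))
    (fun x j => ‖f x j‖ ^ (2 : ℝ))]
  refine Finset.prod_le_prod (fun _ _ => Finset.sum_nonneg fun _ _ => by positivity) fun x _ => ?_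
  have := lp.sum_rpow_le_norm_rpow (p := 2) (by norm_num) (f x) (s.image (fun i => i x))
  rwa [ENNReal.toReal_ofNat] at this

variable {Γ : Type u} (𝓗 : Γ → Type v) [∀ x, NormedAddCommGroup (𝓗 x)]
  [∀ x, InnerProductSpace ℂ (𝓗 x)] [∀ x, CompleteSpace (𝓗 x)]

/-- A choice of one basis vector at each site of `X`: these label the product basis of
`⨂_{x ∈ X} 𝓗 x`. -/
abbrev Config (X : Finset Γ) : Type (max u v) := (x : X) → onbIndex (𝓗 x)

/-- The Hilbert space tensor product `𝓗_X = ⨂_{x ∈ X} 𝓗 x` of the (possibly infinite dimensional)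
Hilbert spaces at the sites of the finite set `X`, in the coordinates given by the product basis.
That it is the Hilbert tensor product (with the product vectors `pureTensor`) is the content of
`inner_pureTensor` and `span_pureTensor_dense` below. -/
abbrev HilbertTensor (X : Finset Γ) : Type (max u v) := lp (fun _ : Config 𝓗 X => ℂ) 2

/-- The bounded operators on `𝓗_X`: the algebra `𝓐_X` of observables over `X`. -/
abbrev LocalAlgebra (X : Finset Γ) : Type (max u v) :=
  HilbertTensor 𝓗 X →L[ℂ] HilbertTensor 𝓗 X

variable {𝓗}

/-- The product vector `⨂_{x ∈ X} u x`. -/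
def pureTensor {X : Finset Γ} (u : (x : X) → 𝓗 x) : HilbertTensor 𝓗 X :=
  ⟨fun i => ∏ x : X, (onb (𝓗 x)).repr (u x) (i x), memℓp_prod fun x : X => (onb (𝓗 x)).repr (u x)⟩

lemma inner_pureTensor {X : Finset Γ} (u v : (x : X) → 𝓗 x) :
    ⟪pureTensor u, pureTensor v⟫_ℂ = ∏ x : X, ⟪u x, v x⟫_ℂ := by
  classical
  have h1 := lp.hasSum_inner (𝕜 := ℂ) (pureTensor u) (pureTensor v)
  have h2 : ∀ x : X, HasSum (fun j => ⟪(onb (𝓗 x)).repr (u x) j, (onb (𝓗 x)).repr (v x) j⟫_ℂ)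
      ⟪u x, v x⟫_ℂ := fun x => by
    have := lp.hasSum_inner (𝕜 := ℂ) ((onb (𝓗 x)).repr (u x)) ((onb (𝓗 x)).repr (v x))
    rwa [LinearIsometryEquiv.inner_map_map] at this
  have h3 : Filter.Tendsto
      (fun t : (x : X) → Finset (onbIndex (𝓗 x)) => Fintype.piFinset t)
      Filter.atTop Filter.atTop := by
    refine Filter.tendsto_atTop.2 fun s => ?_
    filter_upwards [Filter.eventually_ge_atTop (fun x : X => s.image (fun i => i x))] with t ht
    intro i hi
    rw [Fintype.mem_piFinset]
    exact fun x => ht x (Finset.mem_image_of_mem _ hi)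
  have h4 := h1.comp h3
  have h5 : Filter.Tendsto (fun t : (x : X) → Finset (onbIndex (𝓗 x)) =>
      ∏ x : X, ∑ j ∈ t x, ⟪(onb (𝓗 x)).repr (u x) j, (onb (𝓗 x)).repr (v x) j⟫_ℂ)
      Filter.atTop (𝓝 (∏ x : X, ⟪u x, v x⟫_ℂ)) := by
    refine tendsto_finsetProd _ fun x _ => (h2 x).comp ?_
    refine Filter.tendsto_atTop.2 fun s => ?_
    filter_upwards [Filter.eventually_ge_atTop
      (Function.update (fun _ => ∅) x s : (x : X) → Finset (onbIndex (𝓗 x)))] with t ht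
    have := ht x
    rwa [Function.update_self] at this
  refine tendsto_nhds_unique h4 (h5.congr fun t => ?_)
  rw [Finset.prod_univ_sum]
  refine Finset.sum_congr rfl fun i _ => ?_
  simp [pureTensor, Finset.prod_mul_distrib]

lemma span_pureTensor_dense (X : Finset Γ) :
    (Submodule.span ℂ (Set.range (pureTensor (𝓗 := 𝓗) (X := X)))).topologicalClosure = ⊤ := by
  classical
  rw [eq_top_iff]
  intro ψ _
  have hs := lp.hasSum_single (p := 2) (by norm_num) ψ
  refine mem_closure_of_tendsto hs (Filter.Eventually.of_forall fun s => ?_)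
  refine Submodule.sum_mem _ fun i _ => ?_
  have : lp.single 2 i (ψ i) = ψ i • pureTensor (𝓗 := 𝓗) (fun x => onb (𝓗 x) (i x)) := by
    ext j
    simp only [lp.single_apply, lp.coeFn_smul, Pi.smul_apply, pureTensor, smul_eq_mul,
      HilbertBasis.repr_self]
    by_cases h : j = i
    · subst h
      simp
    · obtain ⟨x, hx⟩ := Function.ne_iff.1 h
      rw [Pi.single_eq_of_ne h, Finset.prod_eq_zero (Finset.mem_univ x), mul_zero]
      exact Pi.single_eq_of_ne hx _
  rw [this]
  exact Submodule.smul_mem _ _ (Submodule.subset_span ⟨_, rfl⟩)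

/-! ### Embedding `𝓐_X ⊆ 𝓐_Y`, `A ↦ A ⊗ 1` -/

open Classical in
/-- Splitting a configuration over `Y` into its parts over `X` and over `Y \ X`. -/
def splitConfig {X Y : Finset Γ} (h : X ⊆ Y) :
    Config 𝓗 Y ≃ Config 𝓗 X × ((y : {y : Y // y.1 ∉ X}) → onbIndex (𝓗 y.1.1)) where
  toFun j := (fun x => j ⟨x.1, h x.2⟩, fun y => j y.1)
  invFun p y := if hy : y.1 ∈ X then p.1 ⟨y.1, hy⟩ else p.2 ⟨y, hy⟩
  left_inv j := by
    funext y
    by_cases hy : y.1 ∈ X <;> simp [hy]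
  right_inv p := by
    ext x
    · simp
    · simp [x.2]

/-- The partial vector `i ↦ ψ (i, k)` in `𝓗_X`, for a configuration `k` over `Y \ X`. -/
def slice {X Y : Finset Γ} (h : X ⊆ Y)
    (k : (y : {y : Y // y.1 ∉ X}) → onbIndex (𝓗 y.1.1)) :
    HilbertTensor 𝓗 Y →ₗ[ℂ] HilbertTensor 𝓗 X where
  toFun ψ := ⟨fun i => ψ ((splitConfig h).symm (i, k)), by
    refine memℓp_gen ?_
    have := (memℓp_gen_iff (p := 2) (by norm_num)).1 (lp.memℓp ψ)
    exact this.comp_injective (i := fun i => (splitConfig h).symm (i, k))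
      ((splitConfig h).symm.injective.comp (Prod.mk_left_injective k))⟩
  map_add' _ _ := rfl
  map_smul' _ _ := rfl

lemma slice_apply {X Y : Finset Γ} (h : X ⊆ Y) (k) (ψ : HilbertTensor 𝓗 Y) (i : Config 𝓗 X) :
    slice h k ψ i = ψ ((splitConfig h).symm (i, k)) := rfl

lemma hasSum_norm_sq {X : Finset Γ} (ψ : HilbertTensor 𝓗 X) :
    HasSum (fun i => ‖ψ i‖ ^ 2) (‖ψ‖ ^ 2) := by
  have := lp.hasSum_norm (p := 2) (by norm_num) ψ
  simpa using this

lemma hasSum_norm_slice {X Y : Finset Γ} (h : X ⊆ Y) (ψ : HilbertTensor 𝓗 Y) :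
    HasSum (fun k => ‖slice h k ψ‖ ^ 2) (‖ψ‖ ^ 2) := by
  have h1 := hasSum_norm_sq ψ
  rw [← ((Equiv.prodComm _ _).trans (splitConfig h).symm).hasSum_iff] at h1
  exact h1.prod_fiberwise fun k => hasSum_norm_sq (slice h k ψ)

/-- The coordinates of `(A ⊗ 1) ψ`: the operator `A` acts on the `X`-part of `ψ`. -/
def ampFun {X Y : Finset Γ} (h : X ⊆ Y) (A : LocalAlgebra 𝓗 X) (ψ : HilbertTensor 𝓗 Y)
    (j : Config 𝓗 Y) : ℂ :=
  A (slice h (splitConfig h j).2 ψ) (splitConfig h j).1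

lemma ampFun_add {X Y : Finset Γ} (h : X ⊆ Y) (A : LocalAlgebra 𝓗 X) (ψ φ : HilbertTensor 𝓗 Y)
    (j : Config 𝓗 Y) : ampFun h A (ψ + φ) j = ampFun h A ψ j + ampFun h A φ j := by
  unfold ampFun
  rw [map_add, map_add]
  rfl

lemma ampFun_smul {X Y : Finset Γ} (h : X ⊆ Y) (A : LocalAlgebra 𝓗 X) (z : ℂ)
    (ψ : HilbertTensor 𝓗 Y) (j : Config 𝓗 Y) : ampFun h A (z • ψ) j = z * ampFun h A ψ j := by
  unfold ampFun
  rw [map_smul, map_smul]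
  rfl

lemma ampFun_summable {X Y : Finset Γ} (h : X ⊆ Y) (A : LocalAlgebra 𝓗 X)
    (ψ : HilbertTensor 𝓗 Y) :
    ∃ S ≤ ‖A‖ ^ 2 * ‖ψ‖ ^ 2, HasSum (fun j => ‖ampFun h A ψ j‖ ^ 2) S := by
  have hb : ∀ k, ‖A (slice h k ψ)‖ ^ 2 ≤ ‖A‖ ^ 2 * ‖slice h k ψ‖ ^ 2 := fun k => by
    rw [← mul_pow]
    exact pow_le_pow_left₀ (norm_nonneg _) (A.le_opNorm _) 2
  have hs := (hasSum_norm_slice h ψ).mul_left (‖A‖ ^ 2)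
  have hsum : Summable (fun k => ‖A (slice h k ψ)‖ ^ 2) :=
    Summable.of_nonneg_of_le (fun _ => by positivity) hb hs.summable
  have hfib : ∀ k, HasSum (fun i => ‖A (slice h k ψ) i‖ ^ 2) (‖A (slice h k ψ)‖ ^ 2) :=
    fun k => hasSum_norm_sq _
  have hprod : Summable (fun p : ((y : {y : Y // y.1 ∉ X}) → onbIndex (𝓗 y.1.1)) × Config 𝓗 X =>
      ‖A (slice h p.1 ψ) p.2‖ ^ 2) := by
    rw [summable_prod_of_nonneg (fun _ => by positivity)]
    refine ⟨fun k => (hfib k).summable, ?_⟩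
    simpa only [(hfib _).tsum_eq] using hsum
  have hS : (∑' p : ((y : {y : Y // y.1 ∉ X}) → onbIndex (𝓗 y.1.1)) × Config 𝓗 X,
      ‖A (slice h p.1 ψ) p.2‖ ^ 2) = ∑' k, ‖A (slice h k ψ)‖ ^ 2 :=
    (hprod.hasSum.prod_fiberwise hfib).tsum_eq.symm
  refine ⟨∑' k, ‖A (slice h k ψ)‖ ^ 2, ?_, ?_⟩
  · exact hasSum_le hb hsum.hasSum hs
  · rw [← hS]
    exact ((splitConfig h).trans (Equiv.prodComm _ _)).hasSum_iff.2 hprod.hasSum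

/-- The linear map `A ⊗ 1_{Y \ X}`. -/
def ampLinear {X Y : Finset Γ} (h : X ⊆ Y) (A : LocalAlgebra 𝓗 X) :
    HilbertTensor 𝓗 Y →ₗ[ℂ] HilbertTensor 𝓗 Y where
  toFun ψ := ⟨ampFun h A ψ, by
    obtain ⟨S, _, hS⟩ := ampFun_summable h A ψ
    refine memℓp_gen ?_
    simpa using hS.summable⟩
  map_add' ψ φ := by
    ext j
    exact ampFun_add h A ψ φ j
  map_smul' z ψ := by
    ext j
    exact ampFun_smul h A z ψ j

lemma norm_ampLinear_le {X Y : Finset Γ} (h : X ⊆ Y) (A : LocalAlgebra 𝓗 X)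
    (ψ : HilbertTensor 𝓗 Y) : ‖ampLinear h A ψ‖ ≤ ‖A‖ * ‖ψ‖ := by
  obtain ⟨S, hle, hS⟩ := ampFun_summable h A ψ
  have h1 : ‖ampLinear h A ψ‖ ^ 2 = S := (hasSum_norm_sq (ampLinear h A ψ)).unique hS
  have h2 : 0 ≤ ‖A‖ * ‖ψ‖ := mul_nonneg (norm_nonneg _) (norm_nonneg _)
  refine (sq_le_sq₀ (norm_nonneg _) h2).1 ?_
  rw [mul_pow, h1]
  exact hle

/-- The operator `A ⊗ 1_{Y \ X}` on `𝓗_Y`, for `A` in `𝓐_X` and `X ⊆ Y`. -/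
def amplify {X Y : Finset Γ} (h : X ⊆ Y) (A : LocalAlgebra 𝓗 X) : LocalAlgebra 𝓗 Y :=
  (ampLinear h A).mkContinuous ‖A‖ (norm_ampLinear_le h A)

lemma amplify_apply {X Y : Finset Γ} (h : X ⊆ Y) (A : LocalAlgebra 𝓗 X) (ψ : HilbertTensor 𝓗 Y)
    (j : Config 𝓗 Y) :
    amplify h A ψ j = A (slice h (splitConfig h j).2 ψ) (splitConfig h j).1 := rfl

end Tensor

/-! ## Self-adjoint operators, unitary groups, gapped ground states -/

section Operators

variable {E : Type v} [NormedAddCommGroup E] [InnerProductSpace ℂ E] [CompleteSpace E]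

/-- `U t = exp (i t H)`: `U` is the strongly continuous one-parameter unitary group whose generator
extends `i H`. For a self-adjoint `H` there is exactly one such `U`. -/
structure IsUnitaryGroupOf (H : E →ₗ.[ℂ] E) (U : ℝ → E →L[ℂ] E) : Prop where
  zero : U 0 = 1
  add : ∀ s t, U (s + t) = U s * U t
  norm_map : ∀ t ψ, ‖U t ψ‖ = ‖ψ‖
  continuous : ∀ ψ, Continuous fun t => U t ψ
  hasDerivAt : ∀ ψ : H.domain, HasDerivAt (fun t => U t (ψ : E)) (Complex.I • H ψ) 0

open Classical in
/-- The unitary group `exp (i t H)` of a self-adjoint operator `H`. -/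
def unitaryGroup (H : E →ₗ.[ℂ] E) : ℝ → E →L[ℂ] E :=
  if h : ∃ U, IsUnitaryGroupOf H U then h.choose else fun _ => 1

/-- The Heisenberg evolution `τ_t (A) = exp (i t H) A exp (-i t H)`. -/
def heisenberg (H : E →ₗ.[ℂ] E) (t : ℝ) (A : E →L[ℂ] E) : E →L[ℂ] E :=
  unitaryGroup H t * A * unitaryGroup H (-t)

/-- `H` has the unit vector `Ω` as its unique ground state (up to a phase), with a spectral gap of
at least `γ` above it: `H Ω = E₀ Ω`, and `H ≥ E₀ + γ` on the orthogonal complement of `Ω`. -/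
def IsGappedGroundState (H : E →ₗ.[ℂ] E) (γ : ℝ) (Ω : E) : Prop :=
  ‖Ω‖ = 1 ∧ ∃ E₀ : ℝ, (∃ Ω' : H.domain, (Ω' : E) = Ω ∧ H Ω' = (E₀ : ℂ) • Ω) ∧
    ∀ ψ : H.domain, ⟪Ω, (ψ : E)⟫_ℂ = 0 →
      (E₀ + γ) * ‖(ψ : E)‖ ^ 2 ≤ (⟪(ψ : E), H ψ⟫_ℂ).re

/-- The truncated correlation `⟨A B⟩ - ⟨A⟩ ⟨B⟩` in the vector state of `Ω`. -/
def correlation (Ω : E) (A B : E →L[ℂ] E) : ℂ :=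
  ⟪Ω, (A * B) Ω⟫_ℂ - ⟪Ω, A Ω⟫_ℂ * ⟪Ω, B Ω⟫_ℂ

end Operators

/-! ## Decay functions on a metric space -/

section Decay

/-- A non-increasing function `F : [0, ∞) → (0, ∞)` (its values at negative reals play no role). -/
def IsDecayFunction (F : ℝ → ℝ) : Prop :=
  AntitoneOn F (Set.Ici 0) ∧ ∀ r, 0 ≤ r → 0 < F r

/-- `F_a (r) = exp (-a r) F (r)`. -/
def expWeight (a : ℝ) (F : ℝ → ℝ) (r : ℝ) : ℝ := Real.exp (-a * r) * F r

/-- `‖F‖ = sup_x ∑_y F (d (x, y))`. -/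
def unifNorm (Γ : Type u) [MetricSpace Γ] (F : ℝ → ℝ) : ℝ≥0∞ :=
  ⨆ x : Γ, ∑' y : Γ, ENNReal.ofReal (F (dist x y))

/-- The convolution constant `C = sup_{x, y} ∑_z F (d (x, z)) F (d (z, y)) / F (d (x, y))`. -/
def convConst (Γ : Type u) [MetricSpace Γ] (F : ℝ → ℝ) : ℝ≥0∞ :=
  ⨆ (x : Γ) (y : Γ), ∑' z : Γ, ENNReal.ofReal (F (dist x z) * F (dist z y) / F (dist x y))

/-- The distance `d (X, Y) = min_{x ∈ X, y ∈ Y} d (x, y)` of two finite sets. -/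
def setDist {Γ : Type u} [MetricSpace Γ] (X Y : Finset Γ) : ℝ :=
  sInf {r | ∃ x ∈ X, ∃ y ∈ Y, r = dist x y}

end Decay

/-! ## Lattice systems -/

section System

variable {Γ : Type u} (𝓗 : Γ → Type v) [∀ x, NormedAddCommGroup (𝓗 x)]
  [∀ x, InnerProductSpace ℂ (𝓗 x)] [∀ x, CompleteSpace (𝓗 x)]

/-- An interaction: a self-adjoint `Φ X` in `𝓐_X` for each finite set `X` of sites. -/
structure Interaction where
  term : (X : Finset Γ) → LocalAlgebra 𝓗 X
  selfAdjoint : ∀ X, IsSelfAdjoint (term X)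

variable {𝓗}

/-- `‖Φ‖ = sup_{x, y} ∑_{Z ∋ x, y} ‖Φ (Z)‖ / F (d (x, y))`. -/
def Interaction.norm [MetricSpace Γ] (Φ : Interaction 𝓗) (F : ℝ → ℝ) : ℝ≥0∞ :=
  ⨆ (x : Γ) (y : Γ), ∑' Z : {Z : Finset Γ // x ∈ Z ∧ y ∈ Z},
    ENNReal.ofReal (‖Φ.term Z‖ / F (dist x y))

/-- The surface of `X`: the finite sets of sites that meet both `X` and its complement. -/
def surface (X : Finset Γ) : Set (Finset Γ) :=
  {Z | (∃ z ∈ Z, z ∈ X) ∧ ∃ z ∈ Z, z ∉ X}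

open Classical in
/-- The `Φ`-boundary `∂_Φ X`. -/
def Interaction.boundary (Φ : Interaction 𝓗) (X : Finset Γ) : Finset Γ :=
  {x ∈ X | ∃ Z ∈ surface X, x ∈ Z ∧ Φ.term Z ≠ 0}

open Classical in
/-- The self-adjoint operator `H^loc_Λ = ∑_{x ∈ Λ} H_x` on `𝓗_Λ`: the closure of the operator
`⨂ u_x ↦ ∑_x H_x u_x ⊗ ⨂_{y ≠ x} u_y` on the linear span of the product vectors with
`u_x ∈ D(H_x)`. -/
def freeHamiltonian (h : (x : Γ) → 𝓗 x →ₗ.[ℂ] 𝓗 x) (Λ : Finset Γ) :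
    HilbertTensor 𝓗 Λ →ₗ.[ℂ] HilbertTensor 𝓗 Λ :=
  (Submodule.span ℂ (Set.range fun u : (x : Λ) → (h x).domain =>
    (pureTensor (fun x => (u x : 𝓗 x)),
      ∑ x : Λ, pureTensor (Function.update (fun y : Λ => (u y : 𝓗 y)) x (h x (u x))))
    )).topologicalClosure.toLinearPMap

/-- `H^Φ_Λ = ∑_{Z ⊆ Λ} Φ (Z)` on `𝓗_Λ`. -/
def Interaction.potential (Φ : Interaction 𝓗) (Λ : Finset Γ) : LocalAlgebra 𝓗 Λ :=
  ∑ Z : {Z // Z ∈ Λ.powerset}, amplify (Finset.mem_powerset.1 Z.2) (Φ.term Z)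

/-- The Hamiltonian `H_Λ = ∑_{x ∈ Λ} H_x + ∑_{Z ⊆ Λ} Φ (Z)`. -/
def hamiltonian (h : (x : Γ) → 𝓗 x →ₗ.[ℂ] 𝓗 x) (Φ : Interaction 𝓗) (Λ : Finset Γ) :
    HilbertTensor 𝓗 Λ →ₗ.[ℂ] HilbertTensor 𝓗 Λ :=
  freeHamiltonian h Λ + (Φ.potential Λ).toLinearMap.toPMap ⊤

/-- A representation, on a Hilbert space `K`, of the algebra of local observables
`⋃_X 𝓐_X` (the inductive limit over the finite sets `X`, along the embeddings `A ↦ A ⊗ 1`). -/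
structure LocalRepresentation (𝓗 : Γ → Type v) [∀ x, NormedAddCommGroup (𝓗 x)]
    [∀ x, InnerProductSpace ℂ (𝓗 x)] [∀ x, CompleteSpace (𝓗 x)]
    (K : Type w) [NormedAddCommGroup K] [InnerProductSpace ℂ K] [CompleteSpace K] where
  π : (X : Finset Γ) → LocalAlgebra 𝓗 X →⋆ₐ[ℂ] (K →L[ℂ] K)
  compatible : ∀ {X Y : Finset Γ} (h : X ⊆ Y) (A : LocalAlgebra 𝓗 X), π Y (amplify h A) = π X A

/-- `H` generates, in the representation `π`, the infinite-volume dynamics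
`τ_t (A) = lim_Λ τ^Λ_t (A)` (norm limit along the finite sets `Λ` increasing to `Γ`). -/
def GeneratesDynamics {K : Type w} [NormedAddCommGroup K] [InnerProductSpace ℂ K] [CompleteSpace K]
    (h : (x : Γ) → 𝓗 x →ₗ.[ℂ] 𝓗 x) (Φ : Interaction 𝓗) (ρ : LocalRepresentation 𝓗 K)
    (H : K →ₗ.[ℂ] K) : Prop :=
  ∀ (t : ℝ) (X : Finset Γ) (A : LocalAlgebra 𝓗 X) (ε : ℝ), 0 < ε →
    ∃ Λ₀ : Finset Γ, ∀ (Λ : Finset Γ) (hX : X ⊆ Λ), Λ₀ ⊆ Λ →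
      ‖ρ.π Λ (heisenberg (hamiltonian h Φ Λ) t (amplify hX A)) - heisenberg H t (ρ.π X A)‖ < ε

end System

end QuantumLattice

end

noncomputable section

namespace QuantumLattice

/-! ## Unitary groups and their generators -/

section UnitaryGroups

variable {E : Type v} [NormedAddCommGroup E] [InnerProductSpace ℂ E]

/-! The proof combines a Lieb-Robinson bound with a spectral filter. Let `φ = BΩ - ⟨B⟩Ω`, `φ' = B*Ω
- ⟨B*⟩Ω` and `K = H - E₀ + γ|Ω⟩⟨Ω|`, with unitary group `W`. The ground state expectation `c(t)` of
the commutator of `A` with `τ_t(B)` equals `⟨A*Ω, W_t φ⟩ - ⟨W_t φ', AΩ⟩`. The gap says exactly that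
`K ≥ γ`, so the first term contains only frequencies at least `γ` and the second only frequencies at
most `-γ`. Integration against `1/t` multiplies positive and negative frequencies by `iπ` and `-iπ`.
Since `A` and `B` commute at time zero, both terms then yield the same number, and the integral of
`c(t)/t` is `2πi` times the truncated correlation.

To make this quantitative, `1/t` is replaced by `gaussKernel α N`, which is integrable and
continuous. On frequencies above `γ` the first Gaussian costs an error of order `exp(-γ²/(4α))`, and
the second one disappears as `N → ∞` (`norm_filter_le`). For `|t| ≤ T` the function `c` is small by
the Lieb-Robinson bound; for `|t| > T` the kernel has a Gaussian tail. With `α = γ/(2T)` both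
Gaussian errors become `exp(-γT/2)`, which is `norm_correlation_le`. Choosing `T` proportional to
the distance so that the remaining terms decay at the same rate gives `μ`
(`norm_correlation_le_of_commutator_le`).

The Lieb-Robinson bound compares the dynamics on `Λ` with the one in which the terms across the
surface of `Z` are deleted. The decoupled dynamics keeps observables over `Z` there, so they go on
commuting with `B`; a Duhamel estimate bounds the difference by the commutators of the evolved
surface terms with `B` (`norm_commutator_le_surface`). Iterating this inequality and summing with
the convolution property of `F_a` gives `norm_commutator_heisenberg_le`, uniformly in `Λ`, hence
also in infinite volume.

Because the on-site operators are unbounded, the operator theory is done through graphs: Stone's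
theorem, self-adjointness of bounded perturbations, and the criterion
`IsUnitaryGroup.closure_eq_generator` that an invariant dense subspace is a core. The last one shows
that the sum of the on-site operators is self-adjoint and that the decoupled dynamics factorizes. -/

/-- A strongly continuous one-parameter unitary group. -/
structure IsUnitaryGroup (U : ℝ → E →L[ℂ] E) : Prop where
  zero : U 0 = 1
  add : ∀ s t, U (s + t) = U s * U t
  norm_map : ∀ t ψ, ‖U t ψ‖ = ‖ψ‖
  continuous : ∀ ψ, Continuous fun t => U t ψ

/-- The graph of the generator: all `(ψ, χ)` with `d/dt U t ψ = i χ` at `t = 0`. -/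
def generator (U : ℝ → E →L[ℂ] E) : Submodule ℂ (E × E) where
  carrier := {p | HasDerivAt (fun t => U t p.1) (Complex.I • p.2) 0}
  zero_mem' := by simpa using hasDerivAt_const (0 : ℝ) (0 : E)
  add_mem' {p q} hp hq := by
    have := HasDerivAt.add (show HasDerivAt _ _ _ from hp) (show HasDerivAt _ _ _ from hq)
    rw [← smul_add] at this
    change HasDerivAt _ _ _
    convert! this using 1
    funext t
    exact map_add _ _ _
  smul_mem' z p hp := by
    have := HasDerivAt.const_smul z (show HasDerivAt _ _ _ from hp)
    rw [smul_comm] at this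
    change HasDerivAt _ _ _
    convert! this using 1
    funext t
    exact map_smul _ _ _

lemma mem_generator {U : ℝ → E →L[ℂ] E} {p : E × E} :
    p ∈ generator U ↔ HasDerivAt (fun t => U t p.1) (Complex.I • p.2) 0 := Iff.rfl

/-- Single-valuedness of the generator; it guarantees that the closed graph defining
`freeHamiltonian` really is the graph of an operator. -/
lemma eq_zero_of_mem_generator {U : ℝ → E →L[ℂ] E} {y : E} (h : ((0 : E), y) ∈ generator U) :
    y = 0 := by
  have h1 := mem_generator.1 h
  simp only [map_zero] at h1
  have := h1.unique (hasDerivAt_const _ _)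
  simpa using this

namespace IsUnitaryGroup

variable {U : ℝ → E →L[ℂ] E}

lemma apply_add (hU : IsUnitaryGroup U) (s t : ℝ) (ψ : E) : U (s + t) ψ = U s (U t ψ) := by
  rw [hU.add]; rfl

lemma apply_zero (hU : IsUnitaryGroup U) (ψ : E) : U 0 ψ = ψ := by
  rw [hU.zero]; rfl

lemma apply_neg_apply (hU : IsUnitaryGroup U) (t : ℝ) (ψ : E) : U t (U (-t) ψ) = ψ := by
  rw [← hU.apply_add, add_neg_cancel, hU.apply_zero]

lemma neg_apply_apply (hU : IsUnitaryGroup U) (t : ℝ) (ψ : E) : U (-t) (U t ψ) = ψ := by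
  rw [← hU.apply_add, neg_add_cancel, hU.apply_zero]

lemma mul_neg (hU : IsUnitaryGroup U) (t : ℝ) : U t * U (-t) = 1 := by
  rw [← hU.add, add_neg_cancel, hU.zero]

lemma neg_mul (hU : IsUnitaryGroup U) (t : ℝ) : U (-t) * U t = 1 := by
  rw [← hU.add, neg_add_cancel, hU.zero]

lemma norm_le_one (hU : IsUnitaryGroup U) (t : ℝ) : ‖U t‖ ≤ 1 :=
  ContinuousLinearMap.opNorm_le_bound _ zero_le_one fun ψ => by rw [hU.norm_map, one_mul]

lemma inner_map_map (hU : IsUnitaryGroup U) (t : ℝ) (φ ψ : E) :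
    ⟪U t φ, U t ψ⟫_ℂ = ⟪φ, ψ⟫_ℂ :=
  (LinearMap.norm_map_iff_inner_map_map (U t)).1 (hU.norm_map t) φ ψ

lemma inner_map_left (hU : IsUnitaryGroup U) (t : ℝ) (φ ψ : E) :
    ⟪U t φ, ψ⟫_ℂ = ⟪φ, U (-t) ψ⟫_ℂ := by
  rw [← hU.inner_map_map (-t), hU.neg_apply_apply]

lemma inner_map_right (hU : IsUnitaryGroup U) (t : ℝ) (φ ψ : E) :
    ⟪φ, U t ψ⟫_ℂ = ⟪U (-t) φ, ψ⟫_ℂ := by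
  rw [hU.inner_map_left, neg_neg]

lemma map_mem_generator (hU : IsUnitaryGroup U) {p : E × E} (hp : p ∈ generator U) (s : ℝ) :
    (U s p.1, U s p.2) ∈ generator U := by
  have h := (U s).restrictScalars ℝ |>.hasFDerivAt.comp_hasDerivAt (0 : ℝ) (mem_generator.1 hp)
  rw [mem_generator]
  convert! h using 1
  · funext t
    change U t (U s p.1) = U s (U t p.1)
    rw [← hU.apply_add, ← hU.apply_add, add_comm]
  · simp

lemma hasDerivAt (hU : IsUnitaryGroup U) {p : E × E} (hp : p ∈ generator U) (s : ℝ) :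
    HasDerivAt (fun t => U t p.1) (Complex.I • U s p.2) s := by
  have h := mem_generator.1 (hU.map_mem_generator hp s)
  have h1 : HasDerivAt (fun t : ℝ => t - s) 1 s := (hasDerivAt_id s).sub_const s
  have h2 := HasDerivAt.scomp (h := fun t : ℝ => t - s) s (by simpa using h) h1
  rw [one_smul] at h2
  convert! h2 using 1
  funext t
  change U t p.1 = U (t - s) (U s p.1)
  rw [← hU.apply_add, sub_add_cancel]

lemma hasDerivAt_neg (hU : IsUnitaryGroup U) {p : E × E} (hp : p ∈ generator U) (s : ℝ) :
    HasDerivAt (fun t => U (-t) p.1) (-(Complex.I • U (-s) p.2)) s := by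
  have h2 := HasDerivAt.scomp (h := fun t : ℝ => -t) s (hU.hasDerivAt hp (-s))
    (_root_.hasDerivAt_neg s)
  rw [neg_one_smul] at h2
  exact h2

/-- Differentiate the constant function `t ↦ ⟪U t p.1, U t q.1⟫` at zero. -/
lemma generator_symm (hU : IsUnitaryGroup U) {p q : E × E} (hp : p ∈ generator U)
    (hq : q ∈ generator U) : ⟪p.2, q.1⟫_ℂ = ⟪p.1, q.2⟫_ℂ := by
  have h := (mem_generator.1 hp).inner ℂ (mem_generator.1 hq)
  have h1 : (fun t => ⟪U t p.1, U t q.1⟫_ℂ) = fun _ => ⟪p.1, q.1⟫_ℂ :=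
    funext fun t => hU.inner_map_map t _ _
  rw [h1] at h
  have h2 := h.unique (hasDerivAt_const _ _)
  rw [hU.apply_zero, hU.apply_zero, inner_smul_left, inner_smul_right, Complex.conj_I] at h2
  have h3 : Complex.I * (⟪p.1, q.2⟫_ℂ - ⟪p.2, q.1⟫_ℂ) = 0 := by linear_combination h2
  rcases mul_eq_zero.1 h3 with h4 | h4
  · exact absurd h4 Complex.I_ne_zero
  · exact (sub_eq_zero.1 h4).symm

variable [CompleteSpace E]

/-- The adjoint of the restriction of the generator to an invariant, densely defined subspace is
contained in the generator. -/
lemma mem_generator_of_adjoint (hU : IsUnitaryGroup U) {G : Set (E × E)} (hG : G ⊆ generator U)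
    (hinv : ∀ p ∈ G, ∀ t, (U t p.1, U t p.2) ∈ G)
    (hd : Dense (Submodule.span ℂ (Prod.fst '' G) : Set E)) {x y : E}
    (hxy : ∀ p ∈ G, ⟪p.2, x⟫_ℂ = ⟪p.1, y⟫_ℂ) : (x, y) ∈ generator U := by
  -- Membership of `(x, y)` in the generator amounts to `f = x` identically. Testing against `p.1`
  -- moves `U s` onto `p`, and invariance of `G` lets the adjoint relation be used at the
  -- transported pair, so the derivative vanishes.
  set f : ℝ → E := fun s => U s x - ∫ r in (0 : ℝ)..s, Complex.I • U r y with hf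
  have hc : Continuous fun r => Complex.I • U r y := (hU.continuous y).const_smul _
  have hint : ∀ s, HasDerivAt (fun s => ∫ r in (0 : ℝ)..s, Complex.I • U r y)
      (Complex.I • U s y) s := fun s =>
    intervalIntegral.integral_hasDerivAt_right (hc.intervalIntegrable _ _)
      hc.stronglyMeasurable.stronglyMeasurableAtFilter hc.continuousAt
  have h1 : ∀ p ∈ G, ∀ t, ⟪p.1, f t⟫_ℂ = ⟪p.1, x⟫_ℂ := by
    intro p hp t
    have hd : ∀ s, HasDerivAt (fun s => ⟪p.1, f s⟫_ℂ) 0 s := fun s => by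
      have e1 : HasDerivAt (fun s => ⟪p.1, U s x⟫_ℂ) (⟪p.1, Complex.I • U s y⟫_ℂ) s := by
        have := (hU.hasDerivAt_neg (hG hp) s).inner ℂ (hasDerivAt_const s x)
        convert! this using 1
        · funext r
          exact hU.inner_map_right r _ _
        · rw [inner_zero_right, zero_add, inner_neg_left, inner_smul_left, inner_smul_right,
            hxy _ (hinv p hp (-s)), hU.inner_map_right, Complex.conj_I]
          ring
      have e2 : HasDerivAt (fun s => ⟪p.1, ∫ r in (0 : ℝ)..s, Complex.I • U r y⟫_ℂ)
          (⟪p.1, Complex.I • U s y⟫_ℂ) s := by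
        have := (hasDerivAt_const s p.1).inner ℂ (hint s)
        rw [inner_zero_left, add_zero] at this
        exact this
      have := e1.sub e2
      rw [sub_self] at this
      convert! this using 1
      funext r
      exact inner_sub_right _ _ _
    have := is_const_of_deriv_eq_zero (fun s => (hd s).differentiableAt) (fun s => (hd s).deriv) t 0
    rw [this]
    simp [hf, hU.apply_zero]
  have h2 : ∀ t, f t = x := fun t => by
    refine hd.eq_of_inner_right ℂ fun v hv => ?_
    induction hv using Submodule.span_induction with
    | mem v hv =>
      obtain ⟨p, hp, rfl⟩ := hv
      exact h1 p hp t
    | zero => simp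
    | add a b _ _ ha hb => rw [inner_add_left, inner_add_left, ha, hb]
    | smul z a _ ha => rw [inner_smul_left, inner_smul_left, ha]
  rw [mem_generator]
  have h3 := (hint 0).const_add x
  rw [hU.apply_zero] at h3
  convert! h3 using 1
  funext s
  have h4 := h2 s
  rw [hf] at h4
  exact sub_eq_iff_eq_add.1 h4

lemma mem_generator_iff_adjoint (hU : IsUnitaryGroup U)
    (hd : Dense ((generator U).map (LinearMap.fst ℂ E E) : Set E)) (x y : E) :
    (x, y) ∈ generator U ↔ ∀ p ∈ generator U, ⟪p.2, x⟫_ℂ = ⟪p.1, y⟫_ℂ := by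
  refine ⟨fun h p hp => hU.generator_symm hp h, fun h => ?_⟩
  refine hU.mem_generator_of_adjoint subset_rfl (fun p hp t => hU.map_mem_generator hp t) ?_ h
  refine hd.mono fun v hv => Submodule.subset_span ?_
  obtain ⟨p, hp, rfl⟩ := hv
  exact ⟨p, hp, rfl⟩

lemma isClosed_generator (hU : IsUnitaryGroup U)
    (hd : Dense ((generator U).map (LinearMap.fst ℂ E E) : Set E)) :
    IsClosed (generator U : Set (E × E)) := by
  have : (generator U : Set (E × E)) = ⋂ p ∈ generator U, {z | ⟪p.2, z.1⟫_ℂ = ⟪p.1, z.2⟫_ℂ} := by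
    ext z
    simp only [Set.mem_iInter, Set.mem_ofPred_eq]
    exact hU.mem_generator_iff_adjoint hd z.1 z.2
  rw [this]
  refine isClosed_biInter fun p _ => isClosed_eq ?_ ?_ <;> fun_prop

/-- An invariant, densely defined subspace of the graph of the generator is a core. -/
lemma closure_eq_generator (hU : IsUnitaryGroup U) {G : Set (E × E)} (hG : G ⊆ generator U)
    (hinv : ∀ p ∈ G, ∀ t, (U t p.1, U t p.2) ∈ G)
    (hd : Dense (Submodule.span ℂ (Prod.fst '' G) : Set E)) :
    (Submodule.span ℂ G).topologicalClosure = generator U := by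
  have hle : Submodule.span ℂ G ≤ generator U := Submodule.span_le.2 hG
  have hd' : Dense ((generator U).map (LinearMap.fst ℂ E E) : Set E) := by
    refine hd.mono ?_
    rw [SetLike.coe_subset_coe, Submodule.span_le]
    rintro _ ⟨p, hp, rfl⟩
    exact ⟨p, hG hp, rfl⟩
  refine le_antisymm (Submodule.topologicalClosure_minimal _ hle (hU.isClosed_generator hd')) ?_
  intro p hp
  -- The product norm on `E × E` is not Hilbertian; the `L²` version supplies orthogonal complements
  -- of graphs.
  let e := WithLp.prodContinuousLinearEquiv 2 ℂ E E
  let K : Submodule ℂ (WithLp 2 (E × E)) := ((Submodule.span ℂ G).topologicalClosure).comap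
    (e : WithLp 2 (E × E) →ₗ[ℂ] E × E)
  have hK : IsClosed (K : Set (WithLp 2 (E × E))) :=
    (Submodule.isClosed_topologicalClosure _).preimage e.continuous
  have : CompleteSpace K := hK.completeSpace_coe
  obtain ⟨q, hq, r, hr, hqr⟩ := K.exists_add_mem_mem_orthogonal (e.symm p)
  have hp' : p = e q + e r := by rw [← map_add, ← hqr]; simp
  have hq' : e q ∈ (Submodule.span ℂ G).topologicalClosure := hq
  have hrg : e r ∈ generator U := by
    have : e r = p - e q := by rw [hp']; simp
    rw [this]
    exact Submodule.sub_mem _ hp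
      (Submodule.topologicalClosure_minimal _ hle (hU.isClosed_generator hd') hq')
  -- Orthogonality of `(r₁, r₂)` to `G` is the adjoint relation for the rotated pair `(r₂, -r₁)`,
  -- which therefore lies in the generator. Symmetry of the generator on these two pairs gives
  -- `‖r₂‖² = -‖r₁‖²`.
  have hrs : ((e r).2, -(e r).1) ∈ generator U := by
    refine hU.mem_generator_of_adjoint hG hinv hd fun g hg => ?_
    have h1 : e.symm g ∈ K := by
      change e (e.symm g) ∈ (Submodule.span ℂ G).topologicalClosure
      rw [ContinuousLinearEquiv.apply_symm_apply]
      exact Submodule.le_topologicalClosure _ (Submodule.subset_span hg)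
    have h2 := (Submodule.mem_orthogonal _ _).1 hr _ h1
    rw [WithLp.prod_inner_apply] at h2
    change ⟪g.1, (e r).1⟫_ℂ + ⟪g.2, (e r).2⟫_ℂ = 0 at h2
    rw [inner_neg_right]
    linear_combination h2
  have h3 := hU.generator_symm hrg hrs
  simp only [inner_neg_right] at h3
  have h4 : (‖(e r).2‖ : ℂ) ^ 2 + (‖(e r).1‖ : ℂ) ^ 2 = 0 := by
    have e1 := inner_self_eq_norm_sq_to_K (𝕜 := ℂ) (e r).1
    have e2 := inner_self_eq_norm_sq_to_K (𝕜 := ℂ) (e r).2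
    simp only [Complex.coe_algebraMap] at e1 e2
    rw [← e1, ← e2]
    linear_combination h3
  have h5 : ‖(e r).2‖ ^ 2 + ‖(e r).1‖ ^ 2 = 0 := by exact_mod_cast h4
  have h6 : (e r).1 = 0 := by
    rw [← norm_eq_zero]; nlinarith [sq_nonneg ‖(e r).2‖, sq_nonneg ‖(e r).1‖]
  have h7 : (e r).2 = 0 := by
    rw [← norm_eq_zero]; nlinarith [sq_nonneg ‖(e r).2‖, sq_nonneg ‖(e r).1‖]
  have h8 : e r = 0 := Prod.ext h6 h7
  rw [hp', h8, add_zero]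
  exact hq'

end IsUnitaryGroup

end UnitaryGroups

/-! ## Self-adjoint operators through their graphs -/

section SelfAdjoint

variable {E : Type v} [NormedAddCommGroup E] [InnerProductSpace ℂ E]

lemma dense_map_fst_graph {H : E →ₗ.[ℂ] E} (hd : Dense (H.domain : Set E)) :
    Dense (H.graph.map (LinearMap.fst ℂ E E) : Set E) := by
  rwa [LinearPMap.graph_map_fst_eq_domain]

lemma isUnitaryGroupOf_iff {H : E →ₗ.[ℂ] E} {U : ℝ → E →L[ℂ] E} :
    IsUnitaryGroupOf H U ↔ IsUnitaryGroup U ∧ H.graph ≤ generator U := by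
  constructor
  · intro h
    refine ⟨⟨h.zero, h.add, h.norm_map, h.continuous⟩, ?_⟩
    rintro ⟨x, y⟩ hp
    obtain ⟨z, hz1, hz2⟩ := (LinearPMap.mem_graph_iff _).1 hp
    have := h.hasDerivAt z
    rw [hz1, hz2] at this
    exact this
  · rintro ⟨h, hg⟩
    exact ⟨h.zero, h.add, h.norm_map, h.continuous, fun ψ => hg (H.mem_graph ψ)⟩

lemma mem_graph_add_toPMap (H : E →ₗ.[ℂ] E) (P : E →L[ℂ] E) (x y : E) :
    (x, y) ∈ (H + P.toLinearMap.toPMap ⊤).graph ↔ (x, y - P x) ∈ H.graph := by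
  simp only [LinearPMap.mem_graph_iff, Subtype.exists, LinearPMap.add_domain]
  constructor
  · rintro ⟨a, ha, rfl, h2⟩
    refine ⟨a, ha.1, rfl, ?_⟩
    rw [LinearPMap.add_apply] at h2
    rw [← h2]
    simp
  · rintro ⟨a, ha, rfl, h2⟩
    refine ⟨a, ⟨ha, trivial⟩, rfl, ?_⟩
    rw [LinearPMap.add_apply]
    change H ⟨a, _⟩ + P a = y
    rw [h2, sub_add_cancel]

/-! ## Resolvents -/

/-- `R = (H + z)⁻¹`. -/
structure IsResolvent (H : E →ₗ.[ℂ] E) (z : ℂ) (R : E →L[ℂ] E) : Prop where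
  mem_graph : ∀ ψ, (R ψ, ψ - z • R ψ) ∈ H.graph
  apply_graph : ∀ p ∈ H.graph, R (p.2 + z • p.1) = p.1

/-- This is the first resolvent identity in the form `Sψ = Rψ + (z - w) S R ψ`, read off from the
graph; applying `R` to it returns `S R ψ`. -/
lemma IsResolvent.commute {H : E →ₗ.[ℂ] E} {z w : ℂ} {R S : E →L[ℂ] E} (hR : IsResolvent H z R)
    (hS : IsResolvent H w S) : Commute R S := by
  ext ψ
  change R (S ψ) = S (R ψ)
  set x' := R ψ
  set x := S x'
  have h1 := hR.mem_graph ψ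
  have h2 := hS.mem_graph x'
  have h3 := H.graph.add_mem h1 (H.graph.smul_mem (z - w) h2)
  have h4 := hS.apply_graph _ h3
  simp only [Prod.mk_add_mk, Prod.smul_mk] at h4
  change S ((ψ - z • x' + (z - w) • (x' - w • x)) + w • (x' + (z - w) • x)) = x' + (z - w) • x at h4
  have h5 : (ψ - z • x' + (z - w) • (x' - w • x)) + w • (x' + (z - w) • x) = ψ := by module
  rw [h5] at h4
  have h6 := hR.apply_graph _ h2
  change R ((x' - w • x) + z • x) = x at h6
  rw [h4, show x' + (z - w) • x = x' - w • x + z • x by module, h6]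

variable [CompleteSpace E]

lemma mem_graph_iff_of_isSelfAdjoint {H : E →ₗ.[ℂ] E} (hH : IsSelfAdjoint H) (x y : E) :
    (x, y) ∈ H.graph ↔ ∀ p ∈ H.graph, ⟪p.2, x⟫_ℂ = ⟪p.1, y⟫_ℂ := by
  have h := LinearPMap.adjoint_graph_eq_graph_adjoint hH.dense_domain
  rw [LinearPMap.isSelfAdjoint_def.1 hH] at h
  conv_lhs => rw [h, Submodule.mem_adjoint_iff]
  simp only [sub_eq_zero, Prod.forall]

lemma inner_graph_of_isSelfAdjoint {H : E →ₗ.[ℂ] E} (hH : IsSelfAdjoint H) {p q : E × E}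
    (hp : p ∈ H.graph) (hq : q ∈ H.graph) : ⟪p.2, q.1⟫_ℂ = ⟪p.1, q.2⟫_ℂ :=
  (mem_graph_iff_of_isSelfAdjoint hH q.1 q.2).1 hq p hp

lemma isSelfAdjoint_of_mem_graph_iff {H : E →ₗ.[ℂ] E} (hd : Dense (H.domain : Set E))
    (h : ∀ x y, (x, y) ∈ H.graph ↔ ∀ p ∈ H.graph, ⟪p.2, x⟫_ℂ = ⟪p.1, y⟫_ℂ) :
    IsSelfAdjoint H := by
  rw [LinearPMap.isSelfAdjoint_def]
  apply LinearPMap.eq_of_eq_graph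
  rw [LinearPMap.adjoint_graph_eq_graph_adjoint hd]
  ext ⟨x, y⟩
  rw [h, Submodule.mem_adjoint_iff]
  simp only [sub_eq_zero, Prod.forall]

/-- A self-adjoint graph has no proper symmetric extension, and the generator is a symmetric
extension. -/
lemma IsUnitaryGroupOf.generator_eq {H : E →ₗ.[ℂ] E} {U : ℝ → E →L[ℂ] E} (hH : IsSelfAdjoint H)
    (h : IsUnitaryGroupOf H U) : generator U = H.graph := by
  obtain ⟨hU, hg⟩ := isUnitaryGroupOf_iff.1 h
  refine le_antisymm ?_ hg
  rintro ⟨x, y⟩ hp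
  exact (mem_graph_iff_of_isSelfAdjoint hH x y).2 fun q hq => hU.generator_symm (hg hq) hp

/-- The generator of a strongly continuous unitary group is self-adjoint. -/
lemma isSelfAdjoint_of_graph_eq_generator {H : E →ₗ.[ℂ] E} {U : ℝ → E →L[ℂ] E}
    (hU : IsUnitaryGroup U) (hd : Dense (H.domain : Set E)) (h : H.graph = generator U) :
    IsSelfAdjoint H := by
  refine isSelfAdjoint_of_mem_graph_iff hd fun x y => ?_
  rw [h]
  exact hU.mem_generator_iff_adjoint (h ▸ dense_map_fst_graph hd) x y

/-- A self-adjoint operator generates at most one unitary group. -/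
lemma IsUnitaryGroupOf.unique {H : E →ₗ.[ℂ] E} (hH : IsSelfAdjoint H) {U V : ℝ → E →L[ℂ] E}
    (hU : IsUnitaryGroupOf H U) (hV : IsUnitaryGroupOf H V) : U = V := by
  have gU := hU.generator_eq hH
  have gV := hV.generator_eq hH
  obtain ⟨hU, -⟩ := isUnitaryGroupOf_iff.1 hU
  obtain ⟨hV, -⟩ := isUnitaryGroupOf_iff.1 hV
  -- The two derivative contributions cancel because both orbits stay in the graph of the symmetric
  -- operator `H`.
  have key : ∀ p ∈ H.graph, ∀ q ∈ H.graph, ∀ t, ⟪V t p.1, U t q.1⟫_ℂ = ⟪p.1, q.1⟫_ℂ := by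
    intro p hp q hq t
    have hd : ∀ s, HasDerivAt (fun s => ⟪V s p.1, U s q.1⟫_ℂ) 0 s := fun s => by
      have h1 := (hV.hasDerivAt (gV ▸ hp) s).inner ℂ (hU.hasDerivAt (gU ▸ hq) s)
      have h2 := inner_graph_of_isSelfAdjoint hH
        (p := (V s p.1, V s p.2)) (gV ▸ hV.map_mem_generator (gV ▸ hp) s)
        (q := (U s q.1, U s q.2)) (gU ▸ hU.map_mem_generator (gU ▸ hq) s)
      simp only at h2
      rw [inner_smul_left, inner_smul_right, h2, Complex.conj_I] at h1
      simpa using h1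
    have := is_const_of_deriv_eq_zero (fun s => (hd s).differentiableAt) (fun s => (hd s).deriv) t 0
    rw [this, hU.apply_zero, hV.apply_zero]
  have hd := hH.dense_domain
  funext t
  refine DFunLike.ext' (Continuous.ext_on hd (U t).continuous (V t).continuous fun x hx => ?_)
  refine hd.eq_of_inner_right ℂ fun v hv => ?_
  have hv' : (V (-t) v, V (-t) (H ⟨v, hv⟩)) ∈ H.graph := by
    have : (v, H ⟨v, hv⟩) ∈ H.graph := H.mem_graph ⟨v, hv⟩
    rw [← gV] at this ⊢
    exact hV.map_mem_generator this (-t)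
  have h1 := key _ hv' _ (H.mem_graph ⟨x, hx⟩) t
  simp only [hV.apply_neg_apply] at h1
  rw [h1, hV.inner_map_right]

/-- A bounded self-adjoint perturbation of a self-adjoint operator is self-adjoint. -/
lemma isSelfAdjoint_add_toPMap {H : E →ₗ.[ℂ] E} (hH : IsSelfAdjoint H) {P : E →L[ℂ] E}
    (hP : IsSelfAdjoint P) : IsSelfAdjoint (H + P.toLinearMap.toPMap ⊤) := by
  have hP' : ∀ x y, ⟪P x, y⟫_ℂ = ⟪x, P y⟫_ℂ :=
    (ContinuousLinearMap.isSelfAdjoint_iff_isSymmetric.1 hP)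
  refine isSelfAdjoint_of_mem_graph_iff ?_ fun x y => ?_
  · have : (H + P.toLinearMap.toPMap ⊤).domain = H.domain := by
      rw [LinearPMap.add_domain]
      exact inf_top_eq _
    rw [this]
    exact hH.dense_domain
  · rw [mem_graph_add_toPMap, mem_graph_iff_of_isSelfAdjoint hH]
    constructor
    · rintro h ⟨a, b⟩ hp
      have := h _ ((mem_graph_add_toPMap H P a b).1 hp)
      simp only [inner_sub_left, inner_sub_right] at this
      rw [hP'] at this
      exact sub_left_injective this
    · rintro h ⟨a, b⟩ hp
      have := h (a, b + P a) ((mem_graph_add_toPMap H P _ _).2 (by simpa using hp))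
      simp only [inner_add_left, hP'] at this
      simp only [inner_sub_right]
      rw [← this, add_sub_cancel_right]

/-- The bound at `z` makes `H + z` injective with closed range; the bound at the conjugate point
makes the range dense. No spectral theory is needed. -/
lemma exists_isResolvent {H : E →ₗ.[ℂ] E} (hH : IsSelfAdjoint H) (z : ℂ) {δ : ℝ} (hδ : 0 < δ)
    (h1 : ∀ p ∈ H.graph, δ * ‖p.1‖ ≤ ‖p.2 + z • p.1‖)
    (h2 : ∀ p ∈ H.graph, δ * ‖p.1‖ ≤ ‖p.2 + (starRingEnd ℂ z) • p.1‖) :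
    ∃ R, IsResolvent H z R ∧ ‖R‖ ≤ δ⁻¹ := by
  have hcl : IsClosed (H.graph : Set (E × E)) := hH.isClosed
  let L : H.graph →L[ℂ] E := ((ContinuousLinearMap.snd ℂ E E) + z • ContinuousLinearMap.fst ℂ E E)
    ∘L H.graph.subtypeL
  have hL : ∀ p : H.graph, L p = p.1.2 + z • p.1.1 := fun p => rfl
  have : CompleteSpace H.graph := hcl.completeSpace_coe
  have hanti : AntilipschitzWith (Real.toNNReal (1 + δ⁻¹ * (1 + ‖z‖))) L := by
    refine AddMonoidHomClass.antilipschitz_of_bound L fun p => ?_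
    have a1 := h1 p.1 p.2
    rw [← hL] at a1
    have a2 : ‖p.1.1‖ ≤ δ⁻¹ * ‖L p‖ := by
      rw [inv_mul_eq_div, le_div_iff₀ hδ]; linarith
    have a3 : ‖p.1.2‖ ≤ ‖L p‖ + ‖z‖ * ‖p.1.1‖ := by
      have : p.1.2 = L p - z • p.1.1 := by rw [hL]; abel
      calc ‖p.1.2‖ = ‖L p - z • p.1.1‖ := by rw [← this]
        _ ≤ _ := (norm_sub_le _ _).trans (by rw [norm_smul])
    rw [Real.coe_toNNReal _ (by positivity)]
    change max ‖p.1.1‖ ‖p.1.2‖ ≤ _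
    have hz := norm_nonneg z
    have hLp := norm_nonneg (L p)
    have hi : 0 < δ⁻¹ := by positivity
    have a4 : ‖z‖ * ‖p.1.1‖ ≤ ‖z‖ * (δ⁻¹ * ‖L p‖) := mul_le_mul_of_nonneg_left a2 hz
    refine max_le ?_ ?_
    · nlinarith [mul_nonneg hi.le (mul_nonneg hz hLp)]
    · nlinarith [mul_nonneg hi.le hLp]
  have hrc : IsClosed (Set.range L) := hanti.isClosed_range L.uniformContinuous
  have hsurj : LinearMap.range L.toLinearMap = ⊤ := by
    have : CompleteSpace (LinearMap.range L.toLinearMap) := IsClosed.completeSpace_coe (hs := hrc)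
    rw [← Submodule.orthogonal_eq_bot_iff, eq_bot_iff]
    intro φ hφ
    -- A vector orthogonal to the range of `H + z` lies in the domain of the adjoint, which is `H`,
    -- as an eigenvector for minus the conjugate of `z`. The second lower bound excludes it.
    have g1 : (φ, -(starRingEnd ℂ z) • φ) ∈ H.graph := by
      rw [mem_graph_iff_of_isSelfAdjoint hH]
      intro p hp
      have := (Submodule.mem_orthogonal _ _).1 hφ (L ⟨p, hp⟩) ⟨⟨p, hp⟩, rfl⟩
      rw [hL, inner_add_left, inner_smul_left] at this
      rw [inner_smul_right]
      linear_combination this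
    have g2 := h2 _ g1
    simp only [neg_smul, neg_add_cancel, norm_zero] at g2
    rw [Submodule.mem_bot, ← norm_eq_zero]
    nlinarith [norm_nonneg φ]
  have hinj : Function.Injective L := hanti.injective
  let e : H.graph ≃ₗ[ℂ] E := LinearEquiv.ofBijective L.toLinearMap
    ⟨hinj, LinearMap.range_eq_top.1 hsurj⟩
  have he : ∀ p, e p = L p := fun p => rfl
  have hb : ∀ ψ, ‖((LinearMap.fst ℂ E E) ∘ₗ H.graph.subtype ∘ₗ e.symm.toLinearMap) ψ‖
      ≤ δ⁻¹ * ‖ψ‖ := fun ψ => by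
    have a1 := h1 _ (e.symm ψ).2
    rw [← hL, ← he, e.apply_symm_apply] at a1
    change ‖(e.symm ψ).1.1‖ ≤ _
    rw [inv_mul_eq_div, le_div_iff₀ hδ]; linarith
  refine ⟨LinearMap.mkContinuous _ δ⁻¹ hb, ⟨fun ψ => ?_, fun p hp => ?_⟩,
    LinearMap.mkContinuous_norm_le _ (by positivity) _⟩
  · change ((e.symm ψ).1.1, ψ - z • (e.symm ψ).1.1) ∈ H.graph
    have : ψ - z • (e.symm ψ).1.1 = (e.symm ψ).1.2 := by
      have h3 := e.apply_symm_apply ψ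
      rw [he, hL] at h3
      exact sub_eq_of_eq_add h3.symm
    rw [this]
    exact (e.symm ψ).2
  · change (e.symm (p.2 + z • p.1)).1.1 = p.1
    have : p.2 + z • p.1 = e ⟨p, hp⟩ := rfl
    rw [this, e.symm_apply_apply]

lemma IsResolvent.inner {H : E →ₗ.[ℂ] E} (hH : IsSelfAdjoint H) {z : ℂ} {R S : E →L[ℂ] E}
    (hR : IsResolvent H z R) (hS : IsResolvent H (starRingEnd ℂ z) S) (φ ψ : E) :
    ⟪R φ, ψ⟫_ℂ = ⟪φ, S ψ⟫_ℂ := by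
  have := inner_graph_of_isSelfAdjoint hH (hR.mem_graph φ) (hS.mem_graph ψ)
  simp only [inner_sub_left, inner_sub_right, inner_smul_left, inner_smul_right] at this
  exact (sub_left_injective this).symm

/-- The cross term in the square is the real part of `i r ⟪Hx, x⟫`, which vanishes by symmetry. -/
lemma norm_add_I_smul_sq {H : E →ₗ.[ℂ] E} (hH : IsSelfAdjoint H) (r : ℝ) {p : E × E}
    (hp : p ∈ H.graph) : |r| * ‖p.1‖ ≤ ‖p.2 + (Complex.I * r) • p.1‖ := by
  have h1 := inner_graph_of_isSelfAdjoint hH hp hp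
  have h2 : ‖p.2 + (Complex.I * r) • p.1‖ ^ 2 = ‖p.2‖ ^ 2 + (|r| * ‖p.1‖) ^ 2 := by
    rw [norm_add_sq (𝕜 := ℂ), inner_smul_right, norm_smul]
    have him : (⟪p.2, p.1⟫_ℂ).im = 0 :=
      Complex.conj_eq_iff_im.1 ((inner_conj_symm p.1 p.2).trans h1.symm)
    simp [him]
  have h3 : (|r| * ‖p.1‖) ^ 2 ≤ ‖p.2 + (Complex.I * r) • p.1‖ ^ 2 := by
    rw [h2]; nlinarith [sq_nonneg ‖p.2‖]
  exact (sq_le_sq₀ (by positivity) (norm_nonneg _)).1 h3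

end SelfAdjoint

/-! ## Stone's theorem -/

section Stone

open Filter

variable {E : Type v} [NormedAddCommGroup E] [InnerProductSpace ℂ E]

lemma IsUnitaryGroup.norm_sub_le {U : ℝ → E →L[ℂ] E} (hU : IsUnitaryGroup U) {p : E × E}
    (hp : p ∈ generator U) (s t : ℝ) : ‖U t p.1 - U s p.1‖ ≤ |t - s| * ‖p.2‖ := by
  have := Convex.norm_image_sub_le_of_norm_hasDerivWithin_le (f := fun r => U r p.1)
    (s := Set.univ) (x := s) (y := t) (C := ‖p.2‖)
    (fun r _ => (hU.hasDerivAt hp r).hasDerivWithinAt)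
    (fun r _ => by rw [norm_smul, Complex.norm_I, one_mul, hU.norm_map])
    convex_univ trivial trivial
  rw [Real.norm_eq_abs] at this
  linarith

/-- The convergence set of a sequence of contractions is closed. -/
lemma isClosed_cauchySeq {V : ℕ → E →L[ℂ] E} (hV : ∀ n, ‖V n‖ ≤ 1) :
    IsClosed {x | CauchySeq fun n => V n x} := by
  refine isClosed_of_closure_subset fun x hx => ?_
  rw [Set.mem_ofPred_eq, Metric.cauchySeq_iff']
  intro ε hε
  obtain ⟨y, hy, hxy⟩ := Metric.mem_closure_iff.1 hx (ε / 3) (by positivity)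
  obtain ⟨N, hN⟩ := Metric.cauchySeq_iff'.1 hy (ε / 3) (by positivity)
  refine ⟨N, fun n hn => ?_⟩
  have h1 : ∀ n, dist (V n x) (V n y) ≤ dist x y := fun n => by
    rw [dist_eq_norm, dist_eq_norm, ← map_sub]
    exact ((V n).le_opNorm _).trans (mul_le_of_le_one_left (norm_nonneg _) (hV n))
  calc dist (V n x) (V N x) ≤ dist (V n x) (V n y) + dist (V n y) (V N y) + dist (V N y) (V N x) :=
        dist_triangle4 _ _ _ _
    _ < ε / 3 + ε / 3 + ε / 3 := by
        have h2 := h1 n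
        have h3 := h1 N
        rw [dist_comm] at h3
        have := hN n hn
        linarith
    _ = ε := by ring

/-- The set of vectors with a continuous orbit is closed. -/
lemma isClosed_continuous_orbit {U : ℝ → E →L[ℂ] E} (hU : ∀ t, ‖U t‖ ≤ 1) :
    IsClosed {x | Continuous fun t => U t x} := by
  refine isClosed_of_closure_subset fun x hx => ?_
  obtain ⟨y, hy, hyx⟩ := mem_closure_iff_seq_limit.1 hx
  have h1 : TendstoUniformly (fun n t => U t (y n)) (fun t => U t x) atTop := by
    rw [Metric.tendstoUniformly_iff]
    intro ε hε
    filter_upwards [(Metric.tendsto_nhds.1 hyx) ε hε] with n hn t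
    rw [dist_comm] at hn
    refine lt_of_le_of_lt ?_ hn
    rw [dist_eq_norm, dist_eq_norm, ← map_sub]
    exact ((U t).le_opNorm _).trans (mul_le_of_le_one_left (norm_nonneg _) (hU t))
  exact h1.continuous (Frequently.of_forall hy)

variable [CompleteSpace E]

/-- The unitary group `exp (i t T)` of a bounded operator. -/
def expGroup (T : E →L[ℂ] E) (t : ℝ) : E →L[ℂ] E := NormedSpace.exp (t • (Complex.I • T))

lemma hasDerivAt_expGroup (T : E →L[ℂ] E) (t : ℝ) :
    HasDerivAt (expGroup T) (expGroup T t * (Complex.I • T)) t :=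
  hasDerivAt_exp_smul_const (𝕂 := ℝ) (Complex.I • T) t

lemma isUnitaryGroup_expGroup {T : E →L[ℂ] E} (hT : IsSelfAdjoint T) :
    IsUnitaryGroup (expGroup T) := by
  let _ : NormedAlgebra ℚ (E →L[ℂ] E) := NormedAlgebra.restrictScalars ℚ ℂ _
  have hz : expGroup T 0 = 1 := by simp [expGroup]
  have hadd : ∀ s t, expGroup T (s + t) = expGroup T s * expGroup T t := fun s t => by
    rw [expGroup, add_smul, NormedSpace.exp_add_of_commute]
    · rfl
    · exact ((Commute.refl _).smul_left _).smul_right _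
  have hstar : ∀ t, star (expGroup T t) = expGroup T (-t) := fun t => by
    rw [expGroup, NormedSpace.star_exp, expGroup]
    congr 1
    rw [star_smul, star_smul, hT.star_eq]
    simp
  refine ⟨hz, hadd, fun t ψ => ?_, fun ψ => ?_⟩
  · have h1 : ⟪expGroup T t ψ, expGroup T t ψ⟫_ℂ = ⟪ψ, ψ⟫_ℂ := by
      rw [← ContinuousLinearMap.adjoint_inner_right, ← ContinuousLinearMap.star_eq_adjoint, hstar,
        ← mul_apply_eq_comp, ← hadd, neg_add_cancel, hz]
      rfl
    rw [inner_self_eq_norm_sq_to_K, inner_self_eq_norm_sq_to_K] at h1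
    have h2 : ‖expGroup T t ψ‖ ^ 2 = ‖ψ‖ ^ 2 := by exact_mod_cast h1
    exact (sq_eq_sq₀ (norm_nonneg _) (norm_nonneg _)).1 h2
  · have : Continuous (expGroup T) :=
      continuous_iff_continuousAt.2 fun t => (hasDerivAt_expGroup T t).continuousAt
    fun_prop

lemma mem_generator_expGroup (T : E →L[ℂ] E) (ψ : E) : (ψ, T ψ) ∈ generator (expGroup T) := by
  rw [mem_generator]
  have h := ((ContinuousLinearMap.apply ℂ E ψ).restrictScalars ℝ).hasFDerivAt.comp_hasDerivAt
    (0 : ℝ) (hasDerivAt_expGroup T 0)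
  have hz : expGroup T 0 = 1 := by simp [expGroup]
  rw [hz, one_mul] at h
  exact h

/-- For commuting operators `exp(itS) = exp(itT) exp(it(S - T))`, so the difference is that of one
orbit from its starting point. The bound involves only `Sψ - Tψ`, never the operator norms, which
blow up in the application. -/
lemma norm_expGroup_sub_le {S T : E →L[ℂ] E} (hS : IsSelfAdjoint S) (hT : IsSelfAdjoint T)
    (hST : Commute S T) (t : ℝ) (ψ : E) :
    ‖expGroup S t ψ - expGroup T t ψ‖ ≤ |t| * ‖S ψ - T ψ‖ := by
  let _ : NormedAlgebra ℚ (E →L[ℂ] E) := NormedAlgebra.restrictScalars ℚ ℂ _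
  have hU := isUnitaryGroup_expGroup hT
  have hW := isUnitaryGroup_expGroup (hS.sub hT)
  have h1 : expGroup S t = expGroup T t * expGroup (S - T) t := by
    rw [expGroup, expGroup, expGroup, ← NormedSpace.exp_add_of_commute]
    · congr 1
      module
    · have : Commute T (S - T) := hST.symm.sub_right (Commute.refl T)
      exact (((this.smul_left _).smul_left _).smul_right _).smul_right _
  have h2 := hW.norm_sub_le (mem_generator_expGroup (S - T) ψ) 0 t
  rw [hW.apply_zero, sub_zero] at h2
  rw [h1, mul_apply_eq_comp, ← map_sub, hU.norm_map]
  exact h2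

/-- If commuting bounded self-adjoint operators `T n` converge strongly to the self-adjoint
operator `H` on its domain, then the groups `exp (i t T n)` converge strongly to a unitary
group generated by `H`. -/
theorem exists_unitaryGroup_tendsto {H : E →ₗ.[ℂ] E} (hH : IsSelfAdjoint H)
    {T : ℕ → E →L[ℂ] E} (hT : ∀ n, IsSelfAdjoint (T n)) (hcomm : ∀ m n, Commute (T m) (T n))
    (hlim : ∀ p ∈ H.graph, Tendsto (fun n => T n p.1) atTop (𝓝 p.2)) :
    ∃ U, IsUnitaryGroupOf H U ∧
      ∀ t ψ, Tendsto (fun n => expGroup (T n) t ψ) atTop (𝓝 (U t ψ)) := by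
  have hV := fun n => isUnitaryGroup_expGroup (hT n)
  have hd := hH.dense_domain
  have hc : ∀ t ψ, CauchySeq fun n => expGroup (T n) t ψ := fun t ψ => by
    have hcl := isClosed_cauchySeq (V := fun n => expGroup (T n) t) fun n => (hV n).norm_le_one t
    refine (hcl.closure_subset_iff.2 fun x hx => ?_) (hd ψ)
    have h1 := (hlim _ (H.mem_graph ⟨x, hx⟩)).cauchySeq
    rw [Set.mem_ofPred_eq]
    rw [Metric.cauchySeq_iff'] at h1 ⊢
    intro ε hε
    obtain ⟨N, hN⟩ := h1 (ε / (|t| + 1)) (by positivity)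
    refine ⟨N, fun n hn => ?_⟩
    have h2 := hN n hn
    rw [dist_eq_norm] at h2 ⊢
    refine (norm_expGroup_sub_le (hT n) (hT N) (hcomm _ _) t x).trans_lt ?_
    rw [lt_div_iff₀ (by positivity)] at h2
    have := norm_nonneg (T n x - T N x)
    nlinarith
  choose f hf using fun t ψ => cauchySeq_tendsto_of_complete (hc t ψ)
  let U : ℝ → E →L[ℂ] E := fun t => continuousLinearMapOfTendsto (fun n => expGroup (T n) t)
    (tendsto_pi_nhds.2 (hf t))
  have hUf : ∀ t ψ, Tendsto (fun n => expGroup (T n) t ψ) atTop (𝓝 (U t ψ)) := hf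
  have hnorm : ∀ t ψ, ‖U t ψ‖ = ‖ψ‖ := fun t ψ => by
    have := (hUf t ψ).norm
    simp only [(hV _).norm_map] at this
    exact tendsto_nhds_unique this tendsto_const_nhds |>.symm ▸ rfl
  have hU1 : ∀ t, ‖U t‖ ≤ 1 := fun t =>
    ContinuousLinearMap.opNorm_le_bound _ zero_le_one fun ψ => by rw [hnorm, one_mul]
  -- The linear factor `|t|` survives the limit in `m`; it is what allows differentiation of the
  -- limit group at zero below.
  have hdiff : ∀ p ∈ H.graph, ∀ n t, ‖U t p.1 - expGroup (T n) t p.1‖ ≤ |t| * ‖p.2 - T n p.1‖ := by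
    intro p hp n t
    refine le_of_tendsto_of_tendsto ((hUf t p.1).sub_const _).norm
      (((hlim p hp).sub_const (T n p.1)).norm.const_mul |t|) (Eventually.of_forall fun m => ?_)
    exact norm_expGroup_sub_le (hT m) (hT n) (hcomm _ _) t p.1
  have hzero : U 0 = 1 := by
    ext ψ
    have := hUf 0 ψ
    simp only [(hV _).apply_zero] at this
    exact tendsto_nhds_unique this tendsto_const_nhds
  refine ⟨U, ⟨hzero, fun s t => ?_, hnorm, fun ψ => ?_, fun x => ?_⟩, hUf⟩
  · ext ψ
    have h1 := hUf (s + t) ψ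
    simp only [(hV _).apply_add] at h1
    have h2 : Tendsto (fun n => expGroup (T n) s (expGroup (T n) t ψ)) atTop
        (𝓝 (U s (U t ψ))) := by
      have h3 : Tendsto (fun n => expGroup (T n) s (expGroup (T n) t ψ - U t ψ)) atTop (𝓝 0) := by
        rw [tendsto_zero_iff_norm_tendsto_zero]
        simp only [(hV _).norm_map]
        exact (tendsto_iff_norm_sub_tendsto_zero.1 (hUf t ψ))
      have h4 := h3.add (hUf s (U t ψ))
      simpa using h4
    exact tendsto_nhds_unique h1 h2
  · refine ((isClosed_continuous_orbit hU1).closure_subset_iff.2 fun x hx => ?_) (hd ψ)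
    have hcl : LipschitzWith (Real.toNNReal ‖H ⟨x, hx⟩‖) fun t => U t x := by
      refine LipschitzWith.of_dist_le_mul fun s t => ?_
      rw [Real.coe_toNNReal _ (norm_nonneg _), dist_eq_norm, Real.dist_eq]
      refine le_of_tendsto_of_tendsto ((hUf s x).sub (hUf t x)).norm
        ((hlim _ (H.mem_graph ⟨x, hx⟩)).norm.mul_const |s - t|) (Eventually.of_forall fun m => ?_)
      have := (hV m).norm_sub_le (mem_generator_expGroup (T m) x) t s
      linarith
    exact hcl.continuous
  · rw [hasDerivAt_iff_isLittleO, Asymptotics.isLittleO_iff]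
    intro ε hε
    obtain ⟨N, hN⟩ := Metric.tendsto_atTop.1 (hlim _ (H.mem_graph x)) (ε / 3) (by positivity)
    have hN' := hN N le_rfl
    have h1 := hasDerivAt_iff_isLittleO.1 (mem_generator.1 (mem_generator_expGroup (T N) (x : E)))
    filter_upwards [Asymptotics.isLittleO_iff.1 h1 (show 0 < ε / 3 by positivity)] with t ht
    have h2 := hdiff _ (H.mem_graph x) N t
    simp only [sub_zero] at ht ⊢
    rw [hzero]
    rw [(hV N).apply_zero] at ht
    rw [Real.norm_eq_abs] at ht ⊢
    rw [dist_eq_norm, norm_sub_rev] at hN'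
    simp only at h2 hN'
    have h3 : U t x - (1 : E →L[ℂ] E) x - t • Complex.I • H x
        = (U t x - expGroup (T N) t x) + (expGroup (T N) t x - x - t • Complex.I • T N x)
          - t • Complex.I • (H x - T N x) := by
      rw [one_apply_eq_self]; module
    rw [h3]
    have h4 : ‖t • Complex.I • (H x - T N x)‖ = |t| * ‖H x - T N x‖ := by
      rw [norm_smul, norm_smul, Complex.norm_I, one_mul, Real.norm_eq_abs]
    have h5 := norm_sub_le ((U t x - expGroup (T N) t x)
      + (expGroup (T N) t x - x - t • Complex.I • T N x)) (t • Complex.I • (H x - T N x))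
    have h6 := norm_add_le (U t x - expGroup (T N) t x)
      (expGroup (T N) t x - x - t • Complex.I • T N x)
    have h7 : |t| * ‖H x - T N x‖ ≤ |t| * (ε / 3) :=
      mul_le_mul_of_nonneg_left hN'.le (abs_nonneg t)
    linarith

/-- If `R n` are resolvents with `z n • R n` contractions and `‖R n‖ → 0`, then
`z n • R n → 1` strongly. -/
lemma tendsto_smul_resolvent {H : E →ₗ.[ℂ] E} (hH : IsSelfAdjoint H) {z : ℕ → ℂ}
    {R : ℕ → E →L[ℂ] E} (hR : ∀ n, IsResolvent H (z n) (R n)) (h1 : ∀ n, ‖z n • R n‖ ≤ 1)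
    (h0 : Tendsto (fun n => ‖R n‖) atTop (𝓝 0)) (ψ : E) :
    Tendsto (fun n => z n • R n ψ) atTop (𝓝 ψ) := by
  have hdom : ∀ p ∈ H.graph, Tendsto (fun n => z n • R n p.1) atTop (𝓝 p.1) := fun p hp => by
    rw [tendsto_iff_norm_sub_tendsto_zero]
    refine squeeze_zero (fun _ => norm_nonneg _) (fun n => ?_)
      (by simpa using h0.mul_const ‖p.2‖)
    have h2 := (hR n).apply_graph p hp
    rw [map_add, map_smul] at h2
    rw [show z n • R n p.1 - p.1 = - R n p.2 from sub_eq_iff_eq_add'.2 (by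
      rw [← sub_eq_add_neg]; exact eq_sub_of_add_eq' h2), norm_neg]
    exact (R n).le_opNorm _
  rw [Metric.tendsto_atTop]
  intro ε hε
  obtain ⟨y, hy, hxy⟩ := Metric.mem_closure_iff.1 (hH.dense_domain ψ) (ε / 3) (by positivity)
  obtain ⟨N, hN⟩ := Metric.tendsto_atTop.1 (hdom _ (H.mem_graph ⟨y, hy⟩)) (ε / 3) (by positivity)
  refine ⟨N, fun n hn => ?_⟩
  have h2 : dist (z n • R n ψ) (z n • R n y) ≤ dist ψ y := by
    rw [dist_eq_norm, dist_eq_norm, ← smul_sub, ← map_sub]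
    exact ((z n • R n).le_opNorm _).trans (mul_le_of_le_one_left (norm_nonneg _) (h1 n))
  have h3 := hN n hn
  have h4 := dist_triangle4 (z n • R n ψ) (z n • R n y) y ψ
  rw [dist_comm y ψ] at h4
  simp only at h3
  linarith

/-- Stone's theorem: a self-adjoint operator generates a unitary group. -/
theorem exists_isUnitaryGroupOf {H : E →ₗ.[ℂ] E} (hH : IsSelfAdjoint H) :
    ∃ U, IsUnitaryGroupOf H U := by
  have hex : ∀ r : ℝ, r ≠ 0 → ∃ R, IsResolvent H (Complex.I * r) R ∧ ‖R‖ ≤ |r|⁻¹ := fun r hr => by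
    refine exists_isResolvent hH _ (abs_pos.2 hr) (fun p hp => norm_add_I_smul_sq hH r hp)
      fun p hp => ?_
    have := norm_add_I_smul_sq hH (-r) hp
    rw [abs_neg] at this
    simpa using this
  choose! R hR hRn using hex
  have hn0 : ∀ n : ℕ, (n + 1 : ℝ) ≠ 0 := fun n => by positivity
  have hn1 : ∀ n : ℕ, (-(n + 1 : ℝ)) ≠ 0 := fun n => neg_ne_zero.2 (hn0 n)
  have hstar : ∀ r : ℝ, r ≠ 0 → star (R r) = R (-r) := fun r hr => by
    rw [ContinuousLinearMap.star_eq_adjoint, eq_comm, ContinuousLinearMap.eq_adjoint_iff]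
    intro x y
    have h1 := hR (-r) (neg_ne_zero.2 hr)
    have h2 := hR r hr
    refine h1.inner hH ?_ x y
    simpa using h2
  -- Formally this is `m²H / (H² + m²)` with `m = n + 1`, a bounded self-adjoint truncation of `H`.
  -- On the domain it is the average of `i m R(m)` and `-i m R(-m)` applied to `Hx`, and both of
  -- these tend strongly to the identity.
  let T : ℕ → E →L[ℂ] E := fun n =>
    (((n + 1 : ℝ) ^ 2 / 2 : ℝ) : ℂ) • (R (n + 1) + R (-(n + 1)))
  have hT : ∀ n, IsSelfAdjoint (T n) := fun n => by
    rw [IsSelfAdjoint, star_smul, star_add, hstar _ (hn0 n), hstar _ (hn1 n), neg_neg,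
      add_comm (R (-(n + 1 : ℝ)))]
    exact congrArg (· • _) (Complex.conj_ofReal _)
  have hcomm : ∀ m n, Commute (T m) (T n) := fun m n => by
    have h := fun r s (hr : r ≠ 0) (hs : s ≠ 0) => (hR r hr).commute (hR s hs)
    refine Commute.smul_left (Commute.smul_right ?_ _) _
    exact ((h _ _ (hn0 m) (hn0 n)).add_right (h _ _ (hn0 m) (hn1 n))).add_left
      ((h _ _ (hn1 m) (hn0 n)).add_right (h _ _ (hn1 m) (hn1 n)))
  have hlim0 : Tendsto (fun n : ℕ => (n + 1 : ℝ)⁻¹) atTop (𝓝 0) :=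
    tendsto_inv_atTop_zero.comp (tendsto_atTop_add_const_right _ _ tendsto_natCast_atTop_atTop)
  have hres : ∀ (ε : ℝ), |ε| = 1 → ∀ ψ, Tendsto
      (fun n : ℕ => (Complex.I * (ε * (n + 1 : ℝ) : ℝ)) • R (ε * (n + 1)) ψ) atTop (𝓝 ψ) := by
    intro ε hε ψ
    have hne : ∀ n : ℕ, ε * (n + 1 : ℝ) ≠ 0 := fun n =>
      mul_ne_zero (by rintro rfl; simp at hε) (hn0 n)
    have habs : ∀ n : ℕ, |ε * (n + 1 : ℝ)| = n + 1 := fun n => by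
      rw [abs_mul, hε, one_mul, abs_of_pos (by positivity)]
    refine tendsto_smul_resolvent hH (fun n => hR _ (hne n)) (fun n => ?_) ?_ ψ
    · rw [norm_smul, norm_mul, Complex.norm_I, one_mul, Complex.norm_real, Real.norm_eq_abs]
      refine (mul_le_mul_of_nonneg_left (hRn _ (hne n)) (abs_nonneg _)).trans_eq ?_
      exact mul_inv_cancel₀ (abs_ne_zero.2 (hne n))
    · refine squeeze_zero (fun _ => norm_nonneg _) (fun n => ?_) hlim0
      have := hRn _ (hne n)
      rwa [habs] at this
  obtain ⟨U, hU, -⟩ := exists_unitaryGroup_tendsto hH hT hcomm fun p hp => by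
    have h1 := hres 1 (by simp) p.2
    have h2 := hres (-1) (by simp) p.2
    have h3 := (h1.add h2).const_smul (1 / 2 : ℂ)
    rw [show (1 / 2 : ℂ) • (p.2 + p.2) = p.2 by module] at h3
    refine h3.congr fun n => ?_
    have e1 := (hR _ (hn0 n)).apply_graph p hp
    have e2 := (hR _ (hn1 n)).apply_graph p hp
    rw [map_add, map_smul] at e1 e2
    have e3 : R (n + 1) p.2 = p.1 - (Complex.I * (n + 1 : ℝ) : ℂ) • R (n + 1) p.1 :=
      eq_sub_of_add_eq e1
    have e4 : R (-(n + 1)) p.2 = p.1 - (Complex.I * (-(n + 1) : ℝ) : ℂ) • R (-(n + 1)) p.1 :=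
      eq_sub_of_add_eq e2
    rw [one_mul, neg_one_mul, e3, e4]
    change _ = (((n + 1 : ℝ) ^ 2 / 2 : ℝ) : ℂ) • (R (n + 1) p.1 + R (-(n + 1)) p.1)
    simp only [smul_sub, smul_add, smul_smul]
    push_cast
    match_scalars
    · ring
    · linear_combination (-(1 / 2 : ℂ) * (n + 1) ^ 2) * Complex.I_sq
    · linear_combination (-(1 / 2 : ℂ) * (n + 1) ^ 2) * Complex.I_sq
  exact ⟨U, hU⟩

lemma isUnitaryGroupOf_unitaryGroup {H : E →ₗ.[ℂ] E} (hH : IsSelfAdjoint H) :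
    IsUnitaryGroupOf H (unitaryGroup H) := by
  have h := exists_isUnitaryGroupOf hH
  rw [unitaryGroup, dif_pos h]
  exact h.choose_spec

end Stone

/-! ## A regularized Hilbert transform kernel -/

section Kernel

open MeasureTheory Filter Real

/-- The kernel `(exp (-α t²) - exp (-N t²)) / t`, a Gaussian regularization of `1 / t`. -/
def gaussKernel (α N t : ℝ) : ℝ := (exp (-α * t ^ 2) - exp (-N * t ^ 2)) / t

/-- A smoothed sign function: `π erf (x / (2 √β))`. -/
def smoothSign (β x : ℝ) : ℝ := ∫ y in (0 : ℝ)..x, √(π / β) * exp (-(1 / (4 * β)) * y ^ 2)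

/-- Also valid at `t = 0`, where the kernel takes the default value zero and the Gaussians agree. -/
lemma mul_gaussKernel (α N t : ℝ) :
    t * gaussKernel α N t = exp (-α * t ^ 2) - exp (-N * t ^ 2) := by
  rcases eq_or_ne t 0 with rfl | h
  · simp
  · rw [gaussKernel, mul_div_cancel₀ _ h]

lemma gaussKernel_neg (α N t : ℝ) : gaussKernel α N (-t) = -gaussKernel α N t := by
  simp [gaussKernel, div_neg]

lemma gaussKernel_nonneg {α N t : ℝ} (h : α ≤ N) (ht : 0 ≤ t) : 0 ≤ gaussKernel α N t := by
  refine div_nonneg (sub_nonneg.2 (exp_le_exp.2 ?_)) ht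
  nlinarith [sq_nonneg t]

lemma abs_gaussKernel {α N t : ℝ} (h : α ≤ N) : |gaussKernel α N t| = gaussKernel α N |t| := by
  rcases abs_cases t with ⟨h1, h2⟩ | ⟨h1, h2⟩
  · rw [h1, abs_of_nonneg (gaussKernel_nonneg h h2)]
  · have := gaussKernel_nonneg h (t := -t) (by linarith)
    rw [h1, ← abs_of_nonneg this, gaussKernel_neg, abs_neg]

lemma gaussKernel_le {α N t : ℝ} (ht : 0 < t) : gaussKernel α N t ≤ exp (-α * t ^ 2) / t := by
  unfold gaussKernel
  gcongr
  linarith [exp_pos (-N * t ^ 2)]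

/-- From `1 - exp(-s) ≤ s`: the difference of the Gaussians cancels the singularity of `1/t`.
Integrability of the kernel and its continuity at zero follow from this. -/
lemma gaussKernel_le_mul {α N t : ℝ} (ht : 0 ≤ t) :
    gaussKernel α N t ≤ (N - α) * (t * exp (-α * t ^ 2)) := by
  rcases ht.eq_or_lt with rfl | ht
  · simp [gaussKernel]
  rw [gaussKernel, div_le_iff₀ ht]
  have h1 : exp (-N * t ^ 2) = exp (-α * t ^ 2) * exp (-(N - α) * t ^ 2) := by
    rw [← exp_add]; ring_nf
  have h2 := add_one_le_exp (-(N - α) * t ^ 2)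
  rw [h1]
  nlinarith [exp_pos (-α * t ^ 2)]

lemma integrable_gaussKernel {α N : ℝ} (hα : 0 < α) (h : α ≤ N) :
    Integrable (gaussKernel α N) := by
  have h1 : Integrable fun t : ℝ => (N - α) * (t * exp (-α * t ^ 2)) :=
    (integrable_mul_exp_neg_mul_sq hα).const_mul _
  refine h1.norm.mono' ?_ (Eventually.of_forall fun t => ?_)
  · unfold gaussKernel
    exact Measurable.aestronglyMeasurable (by fun_prop)
  · rw [norm_eq_abs, abs_gaussKernel h]
    refine (gaussKernel_le_mul (abs_nonneg t)).trans_eq ?_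
    rw [norm_eq_abs, abs_mul, abs_mul, abs_of_nonneg (sub_nonneg.2 h), abs_of_pos (exp_pos _),
      sq_abs]

lemma integral_gaussKernel (α N : ℝ) : ∫ t, gaussKernel α N t = 0 := by
  have h := integral_neg_eq_self (gaussKernel α N) volume
  simp only [gaussKernel_neg, integral_neg] at h
  linarith

lemma hasDerivAt_smoothSign (β x : ℝ) :
    HasDerivAt (smoothSign β) (√(π / β) * exp (-(1 / (4 * β)) * x ^ 2)) x := by
  have hc : Continuous fun y : ℝ => √(π / β) * exp (-(1 / (4 * β)) * y ^ 2) := by fun_prop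
  exact intervalIntegral.integral_hasDerivAt_right (hc.intervalIntegrable _ _)
    hc.stronglyMeasurable.stronglyMeasurableAtFilter hc.continuousAt

lemma continuous_smoothSign (β : ℝ) : Continuous (smoothSign β) :=
  continuous_iff_continuousAt.2 fun x => (hasDerivAt_smoothSign β x).continuousAt

lemma smoothSign_nonneg {β x : ℝ} (hx : 0 ≤ x) : 0 ≤ smoothSign β x :=
  intervalIntegral.integral_nonneg hx fun _ _ => by positivity

/-- Used with `β = N`: the contribution of the second Gaussian is small for large `N` on vectors
where the operator acts boundedly. -/
lemma smoothSign_le_mul {β x : ℝ} (hβ : 0 < β) (hx : 0 ≤ x) :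
    smoothSign β x ≤ √(π / β) * x := by
  have hc : Continuous fun y : ℝ => √(π / β) * exp (-(1 / (4 * β)) * y ^ 2) := by fun_prop
  calc smoothSign β x ≤ ∫ _ in (0 : ℝ)..x, √(π / β) := by
        refine intervalIntegral.integral_mono_on hx (hc.intervalIntegrable _ _)
          (continuous_const.intervalIntegrable _ _) fun y _ => ?_
        refine mul_le_of_le_one_right (sqrt_nonneg _) (exp_le_one_iff.2 ?_)
        have : 0 ≤ 1 / (4 * β) := by positivity
        nlinarith [sq_nonneg y]
    _ = √(π / β) * x := by simp [mul_comm]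

lemma pi_sub_smoothSign {β x : ℝ} (hβ : 0 < β) (hx : 0 ≤ x) :
    π - smoothSign β x = √(π / β) * ∫ y in Set.Ioi x, exp (-(1 / (4 * β)) * y ^ 2) := by
  have hb : 0 < 1 / (4 * β) := by positivity
  have hint : Integrable fun y : ℝ => exp (-(1 / (4 * β)) * y ^ 2) := integrable_exp_neg_mul_sq hb
  have h1 : ∫ y in Set.Ioi (0 : ℝ), exp (-(1 / (4 * β)) * y ^ 2) = √(π * β) := by
    rw [integral_gaussian_Ioi]
    have : π / (1 / (4 * β)) = (π * β) * 2 ^ 2 := by field_simp; ring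
    rw [this, sqrt_mul' _ (by norm_num), sqrt_sq (by norm_num)]
    ring
  have h2 : √(π / β) * √(π * β) = π := by
    rw [← sqrt_mul (by positivity), show π / β * (π * β) = π ^ 2 by field_simp,
      sqrt_sq pi_pos.le]
  have h3 := intervalIntegral.integral_Ioi_sub_Ioi (f := fun y : ℝ => exp (-(1 / (4 * β)) * y ^ 2))
    (a := 0) (b := x) hint.integrableOn hx
  rw [smoothSign, intervalIntegral.integral_const_mul, ← h3, h1, mul_sub, h2]
  ring

lemma smoothSign_le_pi {β x : ℝ} (hβ : 0 < β) (hx : 0 ≤ x) : smoothSign β x ≤ π := by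
  have h := pi_sub_smoothSign hβ hx
  have : 0 ≤ √(π / β) * ∫ y in Set.Ioi x, exp (-(1 / (4 * β)) * y ^ 2) :=
    mul_nonneg (sqrt_nonneg _) (integral_nonneg fun _ => (exp_pos _).le)
  linarith

/-- The tail integral from `x`, shifted to start at zero, has exponent `(y + x)² ≥ y² + γ²`. The
factor in `γ` comes out and what remains is the full half-line integral, worth `π`. -/
lemma pi_sub_smoothSign_le {β x γ : ℝ} (hβ : 0 < β) (hγ : 0 ≤ γ) (hx : γ ≤ x) :
    π - smoothSign β x ≤ π * exp (-(1 / (4 * β)) * γ ^ 2) := by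
  have hb : 0 < 1 / (4 * β) := by positivity
  have hx0 := hγ.trans hx
  have hint : Integrable fun y : ℝ => exp (-(1 / (4 * β)) * y ^ 2) := integrable_exp_neg_mul_sq hb
  have h0 := pi_sub_smoothSign hβ le_rfl
  rw [show smoothSign β 0 = 0 from intervalIntegral.integral_same, sub_zero] at h0
  rw [pi_sub_smoothSign hβ hx0]
  conv_rhs => rw [h0]
  have h1 : ∫ y in Set.Ioi x, exp (-(1 / (4 * β)) * y ^ 2)
      = ∫ y in Set.Ioi (0 : ℝ), exp (-(1 / (4 * β)) * (y + x) ^ 2) := by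
    have := (measurePreserving_add_right volume x).setIntegral_preimage_emb
      (measurableEmbedding_addRight x) (fun y => exp (-(1 / (4 * β)) * y ^ 2)) (Set.Ioi x)
    rw [← this]
    simp
  rw [h1, mul_assoc, mul_comm (∫ y in Set.Ioi (0 : ℝ), exp (-(1 / (4 * β)) * y ^ 2)),
    ← integral_const_mul (exp _)]
  refine mul_le_mul_of_nonneg_left ?_ (sqrt_nonneg _)
  refine setIntegral_mono_on (hint.comp_add_right x).integrableOn
    (hint.const_mul _).integrableOn measurableSet_Ioi fun y hy => ?_
  rw [← exp_add, exp_le_exp]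
  have hy' : (0 : ℝ) < y := hy
  nlinarith [mul_nonneg hb.le (mul_nonneg hy'.le hx0), mul_nonneg hb.le
    (show 0 ≤ x ^ 2 - γ ^ 2 by nlinarith)]

lemma integral_cexp_mul_gaussian {b : ℝ} (hb : 0 < b) (x : ℝ) :
    ∫ t : ℝ, Complex.exp (Complex.I * t * x) * (exp (-b * t ^ 2) : ℝ)
      = ((√(π / b) * exp (-(1 / (4 * b)) * x ^ 2) : ℝ) : ℂ) := by
  have h := fourierIntegral_gaussian (b := (b : ℂ)) (by simpa using hb) (x : ℂ)
  have h1 : ((π : ℂ) / b) ^ (1 / 2 : ℂ) = ((√(π / b) : ℝ) : ℂ) := by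
    rw [sqrt_eq_rpow, Complex.ofReal_cpow (by positivity)]
    push_cast
    rfl
  rw [h1] at h
  rw [Complex.ofReal_mul]
  convert h using 1
  · refine integral_congr_ae (Eventually.of_forall fun t => ?_)
    simp only
    push_cast
    ring_nf
  · push_cast
    ring_nf

/-- The Fourier transform of the kernel. -/
lemma integral_gaussKernel_mul_cexp {α N : ℝ} (hα : 0 < α) (h : α ≤ N) (x : ℝ) :
    ∫ t : ℝ, (gaussKernel α N t : ℂ) * Complex.exp (Complex.I * t * x)
      = Complex.I * ((smoothSign α x - smoothSign N x : ℝ) : ℂ) := by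
  have hN : 0 < N := hα.trans_le h
  set J : ℝ → ℂ := fun x => ∫ t : ℝ, (gaussKernel α N t : ℂ) * Complex.exp (Complex.I * t * x)
  have hnorm : ∀ t x : ℝ, ‖Complex.exp (Complex.I * t * x)‖ = 1 := fun t x => by
    rw [show Complex.I * t * x = ((t * x : ℝ) : ℂ) * Complex.I by push_cast; ring,
      Complex.norm_exp_ofReal_mul_I]
  have hmeas : ∀ x : ℝ, AEStronglyMeasurable
      (fun t : ℝ => (gaussKernel α N t : ℂ) * Complex.exp (Complex.I * t * x)) volume := fun x =>
    (Complex.continuous_ofReal.comp_aestronglyMeasurable (integrable_gaussKernel hα h).1).mul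
      (Continuous.aestronglyMeasurable (by fun_prop))
  have hgi : ∀ {b : ℝ}, 0 < b → ∀ x : ℝ, Integrable fun t : ℝ =>
      Complex.exp (Complex.I * t * x) * (exp (-b * t ^ 2) : ℝ) := fun hb x => by
    refine (integrable_exp_neg_mul_sq hb).mono'
      (Continuous.aestronglyMeasurable (by fun_prop)) (Eventually.of_forall fun t => ?_)
    rw [norm_mul, hnorm, one_mul, Complex.norm_real, norm_eq_abs, abs_of_pos (exp_pos _)]
  have hJ : ∀ x, HasDerivAt J (Complex.I * ((√(π / α) * exp (-(1 / (4 * α)) * x ^ 2)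
      - √(π / N) * exp (-(1 / (4 * N)) * x ^ 2) : ℝ) : ℂ)) x := by
    intro x
    -- Differentiating in `x` produces a factor `t` that cancels the denominator of the kernel and
    -- leaves two Gaussian Fourier transforms. The constant of integration is zero because the
    -- kernel is odd.
    have key := hasDerivAt_integral_of_dominated_loc_of_deriv_le (μ := volume)
      (F := fun (x t : ℝ) => (gaussKernel α N t : ℂ) * Complex.exp (Complex.I * t * x))
      (F' := fun (x t : ℝ) => Complex.I * (Complex.exp (Complex.I * t * x) * (exp (-α * t ^ 2) : ℝ)
        - Complex.exp (Complex.I * t * x) * (exp (-N * t ^ 2) : ℝ)))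
      (x₀ := x) (s := Set.univ) (bound := fun t => exp (-α * t ^ 2) + exp (-N * t ^ 2))
      Filter.univ_mem (Eventually.of_forall hmeas) ?_ ?_ ?_ ?_ ?_
    · have h2 := key.2
      rw [integral_const_mul, integral_sub (hgi hα x) (hgi hN x), integral_cexp_mul_gaussian hα,
        integral_cexp_mul_gaussian hN, ← Complex.ofReal_sub] at h2
      exact h2
    · refine (integrable_gaussKernel hα h).norm.mono' (hmeas x) (Eventually.of_forall fun t => ?_)
      rw [norm_mul, hnorm, mul_one, Complex.norm_real]
    · exact Continuous.aestronglyMeasurable (by fun_prop)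
    · refine Eventually.of_forall fun t y _ => ?_
      rw [norm_mul, Complex.norm_I, one_mul]
      refine (norm_sub_le _ _).trans_eq ?_
      rw [norm_mul, norm_mul, hnorm, one_mul, one_mul, Complex.norm_real, Complex.norm_real,
        norm_eq_abs, norm_eq_abs, abs_of_pos (exp_pos _), abs_of_pos (exp_pos _)]
    · exact (integrable_exp_neg_mul_sq hα).add (integrable_exp_neg_mul_sq hN)
    · refine Eventually.of_forall fun t y _ => ?_
      have h1 : HasDerivAt (fun y : ℝ => Complex.I * t * (y : ℂ)) (Complex.I * t * 1) y :=
        (Complex.ofRealCLM.hasDerivAt (x := y)).const_mul _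
      have h2 := (h1.cexp).const_mul (gaussKernel α N t : ℂ)
      convert! h2 using 1
      have h3 : ((t * gaussKernel α N t : ℝ) : ℂ)
          = ((exp (-α * t ^ 2) - exp (-N * t ^ 2) : ℝ) : ℂ) := by rw [mul_gaussKernel]
      push_cast at h3 ⊢
      linear_combination (-Complex.I * Complex.exp (Complex.I * t * y)) * h3
  have hd : ∀ x, HasDerivAt (fun x => J x - Complex.I * ((smoothSign α x - smoothSign N x : ℝ) : ℂ))
      0 x := fun x => by
    have h1 := ((hasDerivAt_smoothSign α x).sub (hasDerivAt_smoothSign N x)).ofReal_comp.const_mul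
      Complex.I
    have h2 := (hJ x).sub h1
    rw [sub_self] at h2
    exact h2
  have hc := is_const_of_deriv_eq_zero (fun s => (hd s).differentiableAt) (fun s => (hd s).deriv) x 0
  have hs : ∀ β, smoothSign β 0 = 0 := fun β => intervalIntegral.integral_same
  have hJ0 : J 0 = 0 := by
    simp only [J, Complex.ofReal_zero, mul_zero, Complex.exp_zero, mul_one]
    rw [integral_complex_ofReal, integral_gaussKernel, Complex.ofReal_zero]
  simp only [hJ0, hs] at hc
  simpa [sub_eq_zero] using hc

end Kernel

/-! ## The spectral filter of a gapped operator -/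

section Filtering

open MeasureTheory Filter Real

lemma continuous_gaussKernel {α N : ℝ} (h : α ≤ N) : Continuous (gaussKernel α N) := by
  refine continuous_iff_continuousAt.2 fun t => ?_
  rcases eq_or_ne t 0 with rfl | ht
  · have h0 : gaussKernel α N 0 = 0 := by simp [gaussKernel]
    rw [ContinuousAt, h0, tendsto_zero_iff_norm_tendsto_zero]
    have hc : Continuous fun t : ℝ => (N - α) * (|t| * exp (-α * |t| ^ 2)) := by fun_prop
    refine squeeze_zero (g := fun t : ℝ => (N - α) * (|t| * exp (-α * |t| ^ 2)))
      (fun _ => norm_nonneg _) (fun t => ?_) ?_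
    swap
    · simpa only [abs_zero, zero_mul, mul_zero] using hc.tendsto 0
    rw [norm_eq_abs, abs_gaussKernel h]
    exact gaussKernel_le_mul (abs_nonneg t)
  · exact ContinuousAt.div (by fun_prop) continuousAt_id ht

variable {E : Type v} [NormedAddCommGroup E] [InnerProductSpace ℂ E] [CompleteSpace E]

lemma expGroup_eq_cfc {T : E →L[ℂ] E} (hT : IsSelfAdjoint T) (t : ℝ) :
    expGroup T t = cfc (fun z : ℂ => Complex.exp (Complex.I * t * z)) T := by
  have hn : IsStarNormal T := hT.isStarNormal
  have h1 : t • (Complex.I • T) = cfc (fun z : ℂ => Complex.I * t * z) T := by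
    rw [cfc_const_mul_id _ T, ← Complex.coe_smul, smul_smul, mul_comm]
  rw [expGroup, h1, ← CFC.complex_exp_eq_normedSpace_exp (cfc_predicate _ _)]
  exact (cfc_comp' Complex.exp (fun z : ℂ => Complex.I * t * z) T (by fun_prop) (by fun_prop)).symm

lemma le_re_of_mem_spectrum {T : E →L[ℂ] E} (hT : IsSelfAdjoint T) {γ : ℝ}
    (hγ : ∀ ψ, γ * ‖ψ‖ ^ 2 ≤ (⟪ψ, T ψ⟫_ℂ).re) {z : ℂ} (hz : z ∈ spectrum ℂ T) :
    z = (z.re : ℂ) ∧ γ ≤ z.re := by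
  have h1 := hT.mem_spectrum_eq_re hz
  refine ⟨h1, ?_⟩
  have h2 : algebraMap ℝ (E →L[ℂ] E) γ ≤ T := by
    rw [ContinuousLinearMap.le_def]
    refine ⟨?_, fun ψ => ?_⟩
    · exact ContinuousLinearMap.isSelfAdjoint_iff_isSymmetric.1
        (hT.sub (IsSelfAdjoint.algebraMap _ (IsSelfAdjoint.all γ)))
    · have e1 : (T - algebraMap ℝ (E →L[ℂ] E) γ) ψ = T ψ - (γ : ℂ) • ψ := by
        rw [Algebra.algebraMap_eq_smul_one, sub_apply]
        rfl
      change 0 ≤ RCLike.re ⟪(T - algebraMap ℝ (E →L[ℂ] E) γ) ψ, ψ⟫_ℂ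
      rw [e1, inner_sub_left, inner_smul_left, inner_self_eq_norm_sq_to_K, map_sub,
        inner_re_symm, Complex.conj_ofReal]
      have e2 : RCLike.re ((γ : ℂ) * ((‖ψ‖ : ℝ) : ℂ) ^ 2) = γ * ‖ψ‖ ^ 2 := by
        rw [← Complex.ofReal_pow, ← Complex.ofReal_mul]
        exact Complex.ofReal_re _
      have e3 := hγ ψ
      simp only [Complex.coe_algebraMap] 
      rw [e2]
      exact sub_nonneg.2 e3
  refine (algebraMap_le_iff_le_spectrum hT).1 h2 _ ?_
  rw [h1] at hz
  exact (spectrum.algebraMap_mem_iff ℂ).1 hz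

lemma integral_gaussKernel_smul_expGroup {T : E →L[ℂ] E} (hT : IsSelfAdjoint T) {α N : ℝ}
    (hα : 0 < α) (h : α ≤ N) :
    ∫ t : ℝ, gaussKernel α N t • expGroup T t
      = cfc (fun z : ℂ => Complex.I * ((smoothSign α z.re - smoothSign N z.re : ℝ) : ℂ)) T := by
  have hn : IsStarNormal T := hT.isStarNormal
  have hcont : Continuous fun p : ℝ × ℂ =>
      (gaussKernel α N p.1 : ℂ) * Complex.exp (Complex.I * p.1 * p.2) := by
    have := (continuous_gaussKernel h).comp (continuous_fst (X := ℝ) (Y := ℂ))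
    refine (Complex.continuous_ofReal.comp this).mul ?_
    fun_prop
  have h1 : ∀ t : ℝ, gaussKernel α N t • expGroup T t
      = cfc (fun z : ℂ => (gaussKernel α N t : ℂ) * Complex.exp (Complex.I * t * z)) T := fun t => by
    rw [cfc_const_mul _ _ _ (by fun_prop), expGroup_eq_cfc hT, Complex.coe_smul]
  simp only [h1]
  rw [← cfc_integral (f := fun (t : ℝ) (z : ℂ) =>
      (gaussKernel α N t : ℂ) * Complex.exp (Complex.I * t * z)) (bound := fun t => |gaussKernel α N t|)
    T hcont.continuousOn (Eventually.of_forall fun t z hz => ?_)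
    (integrable_gaussKernel hα h).abs.hasFiniteIntegral]
  · refine cfc_congr fun z hz => ?_
    have hz' := hT.mem_spectrum_eq_re hz
    conv_lhs => rw [hz']
    rw [integral_gaussKernel_mul_cexp hα h]
  · have hz' := hT.mem_spectrum_eq_re hz
    rw [norm_mul, Complex.norm_real, norm_eq_abs, hz',
      show Complex.I * t * (z.re : ℂ) = ((t * z.re : ℝ) : ℂ) * Complex.I by push_cast; ring,
      Complex.norm_exp_ofReal_mul_I, mul_one]

lemma integrable_gaussKernel_smul {F : Type*} [NormedAddCommGroup F] [NormedSpace ℝ F]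
    {α N : ℝ} (hα : 0 < α) (h : α ≤ N) {f : ℝ → F} (hf : Continuous f) {C : ℝ}
    (hC : ∀ t, ‖f t‖ ≤ C) : Integrable fun t => gaussKernel α N t • f t := by
  refine ((integrable_gaussKernel hα h).norm.mul_const C).mono'
    (((continuous_gaussKernel h).smul hf).aestronglyMeasurable) (Eventually.of_forall fun t => ?_)
  rw [norm_smul]
  exact mul_le_mul_of_nonneg_left (hC t) (norm_nonneg _)

/-- The filter estimate for bounded operators. -/
lemma norm_filter_expGroup_le {T : E →L[ℂ] E} (hT : IsSelfAdjoint T) {γ : ℝ} (hγ : 0 < γ)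
    (hpos : ∀ ψ, γ * ‖ψ‖ ^ 2 ≤ (⟪ψ, T ψ⟫_ℂ).re) {α N : ℝ} (hα : 0 < α) (h : α ≤ N) (φ x : E) :
    ‖(∫ t : ℝ, gaussKernel α N t • expGroup T t φ) - (Complex.I * π) • φ‖
      ≤ π * exp (-(1 / (4 * α)) * γ ^ 2) * ‖φ‖ + π * ‖φ - x‖ + √(π / N) * ‖T x‖ := by
  have hN : 0 < N := hα.trans_le h
  have hn : IsStarNormal T := hT.isStarNormal
  have hU := isUnitaryGroup_expGroup hT
  have hspec := fun z hz => le_re_of_mem_spectrum hT hpos (z := z) hz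
  have hcS : ∀ β, Continuous fun z : ℂ => ((smoothSign β z.re : ℝ) : ℂ) := fun β =>
    Complex.continuous_ofReal.comp ((continuous_smoothSign β).comp Complex.continuous_re)
  have hcexp : Continuous (expGroup T) :=
    continuous_iff_continuousAt.2 fun t => (hasDerivAt_expGroup T t).continuousAt
  have e1 : ∫ t : ℝ, gaussKernel α N t • expGroup T t φ
      = (∫ t : ℝ, gaussKernel α N t • expGroup T t) φ := by
    rw [ContinuousLinearMap.integral_apply
      (integrable_gaussKernel_smul hα h hcexp fun t => hU.norm_le_one t)]
    rfl
  -- By functional calculus the filter is `iπ - A - B`. The operator `A` is small by the lower bound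
  -- on the spectrum. `B` is only bounded by `π` uniformly in `T`, so smallness comes from the
  -- factorization `B = G T` on a chosen vector `x` near `φ`.
  set A := cfc (fun z : ℂ => Complex.I * ((π - smoothSign α z.re : ℝ) : ℂ)) T with hA
  set B := cfc (fun z : ℂ => Complex.I * ((smoothSign N z.re : ℝ) : ℂ)) T with hB
  set G := cfc (fun z : ℂ => Complex.I * ((smoothSign N z.re / z.re : ℝ) : ℂ)) T with hG
  have hBG : B = G * T := by
    have hGT : G * T = G * cfc (fun z : ℂ => z) T := by rw [cfc_id' ℂ T]
    have hc : ContinuousOn (fun z : ℂ => Complex.I * ((smoothSign N z.re / z.re : ℝ) : ℂ))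
        (spectrum ℂ T) := by
      refine continuousOn_const.mul (Complex.continuous_ofReal.comp_continuousOn ?_)
      refine ContinuousOn.div ((continuous_smoothSign N).comp Complex.continuous_re).continuousOn
        Complex.continuous_re.continuousOn fun z hz => ?_
      exact (hγ.trans_le (hspec z hz).2).ne'
    rw [hGT, hG, hB, ← cfc_mul _ (fun z : ℂ => z) T hc continuousOn_id]
    refine cfc_congr fun z hz => ?_
    obtain ⟨h1, h2⟩ := hspec z hz
    have h3 : (z.re : ℂ) ≠ 0 := by exact_mod_cast (hγ.trans_le h2).ne'
    conv_rhs => rw [h1]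
    push_cast
    rw [Complex.ofReal_re]
    field_simp
  have e2 : (∫ t : ℝ, gaussKernel α N t • expGroup T t) = (Complex.I * π) • 1 - A - B := by
    have hc1 : Continuous fun z : ℂ => Complex.I * ((π - smoothSign α z.re : ℝ) : ℂ) := by
      have := hcS α
      push_cast
      fun_prop
    have hc2 : Continuous fun z : ℂ => Complex.I * ((smoothSign N z.re : ℝ) : ℂ) := by
      have := hcS N
      fun_prop
    rw [integral_gaussKernel_smul_expGroup hT hα h, ← Algebra.algebraMap_eq_smul_one,
      ← cfc_const (Complex.I * π : ℂ) T, hA, hB,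
      ← cfc_sub _ _ T continuousOn_const hc1.continuousOn,
      ← cfc_sub (fun z : ℂ => Complex.I * π - Complex.I * ((π - smoothSign α z.re : ℝ) : ℂ)) _ T
        (continuous_const.sub hc1).continuousOn hc2.continuousOn]
    refine cfc_congr fun z _ => ?_
    push_cast
    ring
  have hAn : ‖A‖ ≤ π * exp (-(1 / (4 * α)) * γ ^ 2) := by
    refine norm_cfc_le (by positivity) fun z hz => ?_
    obtain ⟨h1, h2⟩ := hspec z hz
    rw [norm_mul, Complex.norm_I, one_mul, Complex.norm_real, norm_eq_abs, abs_of_nonneg]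
    · exact pi_sub_smoothSign_le hα hγ.le h2
    · exact sub_nonneg.2 (smoothSign_le_pi hα (hγ.le.trans h2))
  have hBn : ‖B‖ ≤ π := by
    refine norm_cfc_le pi_pos.le fun z hz => ?_
    obtain ⟨h1, h2⟩ := hspec z hz
    rw [norm_mul, Complex.norm_I, one_mul, Complex.norm_real, norm_eq_abs, abs_of_nonneg]
    · exact smoothSign_le_pi hN (hγ.le.trans h2)
    · exact smoothSign_nonneg (hγ.le.trans h2)
  have hGn : ‖G‖ ≤ √(π / N) := by
    refine norm_cfc_le (sqrt_nonneg _) fun z hz => ?_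
    obtain ⟨h1, h2⟩ := hspec z hz
    have h3 : 0 < z.re := hγ.trans_le h2
    rw [norm_mul, Complex.norm_I, one_mul, Complex.norm_real, norm_eq_abs, abs_of_nonneg,
      div_le_iff₀ h3]
    · exact smoothSign_le_mul hN h3.le
    · exact div_nonneg (smoothSign_nonneg h3.le) h3.le
  have e3 : (∫ t : ℝ, gaussKernel α N t • expGroup T t φ) - (Complex.I * π) • φ
      = -(A φ) - B (φ - x) - G (T x) := by
    rw [e1, e2]
    have : G (T x) = B x := by rw [hBG]; rfl
    rw [this, map_sub]
    change (Complex.I * π) • φ - A φ - B φ - (Complex.I * π) • φ = _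
    abel
  rw [e3]
  refine (norm_sub_le _ _).trans (add_le_add ((norm_sub_le _ _).trans (add_le_add ?_ ?_)) ?_)
  · rw [norm_neg]
    exact A.le_of_opNorm_le hAn φ
  · exact B.le_of_opNorm_le hBn _
  · exact G.le_of_opNorm_le hGn _

/-- Bounded approximations from below of a self-adjoint operator with a positive lower bound. -/
lemma exists_approximation {K : E →ₗ.[ℂ] E} (hK : IsSelfAdjoint K) {γ : ℝ} (hγ : 0 < γ)
    (hpos : ∀ p ∈ K.graph, γ * ‖p.1‖ ^ 2 ≤ (⟪p.1, p.2⟫_ℂ).re) :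
    ∃ T : ℕ → E →L[ℂ] E, (∀ n, IsSelfAdjoint (T n)) ∧ (∀ m n, Commute (T m) (T n)) ∧
      (∀ n ψ, γ * ‖ψ‖ ^ 2 ≤ (⟪ψ, T n ψ⟫_ℂ).re) ∧
      ∀ p ∈ K.graph, Tendsto (fun n => T n p.1) atTop (𝓝 p.2) := by
  have hlow : ∀ n : ℕ, ∀ p ∈ K.graph, (n + 1 + γ) * ‖p.1‖ ≤ ‖p.2 + ((n + 1 : ℝ) : ℂ) • p.1‖ := by
    intro n p hp
    rcases (norm_nonneg p.1).eq_or_lt with h0 | h0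
    · rw [← h0, mul_zero]; exact norm_nonneg _
    have h1 : (⟪p.1, p.2 + ((n + 1 : ℝ) : ℂ) • p.1⟫_ℂ).re ≤ ‖p.1‖ * ‖p.2 + ((n + 1 : ℝ) : ℂ) • p.1‖ :=
      re_inner_le_norm (𝕜 := ℂ) _ _
    have h2 : (⟪p.1, p.2 + ((n + 1 : ℝ) : ℂ) • p.1⟫_ℂ).re
        = (⟪p.1, p.2⟫_ℂ).re + (n + 1) * ‖p.1‖ ^ 2 := by
      rw [inner_add_right, inner_smul_right, inner_self_eq_norm_sq_to_K, Complex.add_re]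
      congr 1
      simp only [Complex.coe_algebraMap]
      rw [← Complex.ofReal_pow, ← Complex.ofReal_mul, Complex.ofReal_re]
    have h3 := hpos p hp
    rw [h2] at h1
    refine le_of_mul_le_mul_left ?_ h0
    nlinarith
  have hex : ∀ n : ℕ, ∃ R, IsResolvent K ((n + 1 : ℝ) : ℂ) R ∧ ‖R‖ ≤ (n + 1 + γ)⁻¹ := fun n =>
    exists_isResolvent hK _ (by positivity) (hlow n) (by
      rw [Complex.conj_ofReal]; exact hlow n)
  choose R hR hRn using hex
  have hRsa : ∀ n, IsSelfAdjoint (R n) := fun n => by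
    rw [ContinuousLinearMap.isSelfAdjoint_iff_isSymmetric]
    intro x y
    exact (hR n).inner hK (by rw [Complex.conj_ofReal]; exact hR n) x y
  -- With `K = γ + K'` and `m = n + 1 + γ`, this is `γ` plus the Yosida approximation `m K' (K' +
  -- m)⁻¹ = m - m² (K' + m)⁻¹`. Shifting by `γ` first keeps the exact lower bound `γ` for every `n`.
  let T : ℕ → E →L[ℂ] E := fun n =>
    ((γ + (n + 1 + γ) : ℝ) : ℂ) • 1 - (((n + 1 + γ) ^ 2 : ℝ) : ℂ) • R n
  have hTapp : ∀ n ψ, T n ψ = ((γ + (n + 1 + γ) : ℝ) : ℂ) • ψ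
    - (((n + 1 + γ) ^ 2 : ℝ) : ℂ) • R n ψ := fun n ψ => rfl
  refine ⟨T, fun n => ?_, fun m n => ?_, fun n ψ => ?_, fun p hp => ?_⟩
  · rw [IsSelfAdjoint, star_sub, star_smul, star_smul, star_one, (hRsa n).star_eq]
    simp only [Complex.star_def, Complex.conj_ofReal]
    rfl
  · refine Commute.sub_left ?_ ?_
    · exact (Commute.one_left _).smul_left _
    · refine Commute.smul_left (Commute.sub_right ?_ ?_) _
      · exact (Commute.one_right _).smul_right _
      · exact ((hR m).commute (hR n)).smul_right _
  · set x := R n ψ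
    set y := ψ - ((n + 1 : ℝ) : ℂ) • x with hy
    have hg : (x, y) ∈ K.graph := (hR n).mem_graph ψ
    set w' := y - (γ : ℂ) • x with hw
    set m : ℝ := n + 1 + γ with hm
    have hm0 : 0 < m := by positivity
    have hψ : ψ = w' + (m : ℂ) • x := by
      rw [hw, hy, hm]; push_cast; module
    have hTψ : T n ψ = (γ : ℂ) • ψ + (m : ℂ) • w' := by
      rw [hTapp]
      change _ - _ • x = _
      rw [← hm, hw, hy, hm]; push_cast; module
    -- Here `w' = K'x`, so this is positivity of `K'`. It makes both extra terms in the quadratic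
    -- form of `T n` nonnegative.
    have hx : 0 ≤ (⟪x, w'⟫_ℂ).re := by
      have := hpos _ hg
      rw [hw, inner_sub_right, inner_smul_right, inner_self_eq_norm_sq_to_K, Complex.sub_re]
      simp only [Complex.coe_algebraMap]
      rw [← Complex.ofReal_pow, ← Complex.ofReal_mul, Complex.ofReal_re]
      exact sub_nonneg.2 this
    have h1 : (⟪ψ, T n ψ⟫_ℂ).re = γ * ‖ψ‖ ^ 2 + (m * ‖w'‖ ^ 2 + m ^ 2 * (⟪x, w'⟫_ℂ).re) := by
      rw [hTψ, inner_add_right, inner_smul_right, inner_smul_right, inner_self_eq_norm_sq_to_K,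
        Complex.add_re]
      simp only [Complex.coe_algebraMap]
      rw [← Complex.ofReal_pow, ← Complex.ofReal_mul, Complex.ofReal_re, Complex.re_ofReal_mul]
      congr 1
      rw [hψ, inner_add_left, inner_smul_left, inner_self_eq_norm_sq_to_K, Complex.conj_ofReal,
        Complex.add_re, Complex.re_ofReal_mul]
      simp only [Complex.coe_algebraMap]
      rw [← Complex.ofReal_pow, Complex.ofReal_re]
      ring
    rw [h1]
    have : 0 ≤ m * ‖w'‖ ^ 2 + m ^ 2 * (⟪x, w'⟫_ℂ).re := by positivity
    linarith
  · have hlim0 : Tendsto (fun n : ℕ => (n + 1 + γ : ℝ)⁻¹) atTop (𝓝 0) :=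
      tendsto_inv_atTop_zero.comp (tendsto_atTop_add_const_right _ _
        (tendsto_atTop_add_const_right _ _ tendsto_natCast_atTop_atTop))
    have hR0 : Tendsto (fun n => ‖R n‖) atTop (𝓝 0) :=
      squeeze_zero (fun _ => norm_nonneg _) hRn hlim0
    set w' := p.2 - (γ : ℂ) • p.1 with hw
    have h1 := tendsto_smul_resolvent hK hR (fun n => by
      rw [norm_smul, Complex.norm_real, norm_eq_abs, abs_of_pos (by positivity)]
      refine (mul_le_mul_of_nonneg_left (hRn n) (by positivity)).trans ?_
      rw [← div_eq_mul_inv, div_le_one (by positivity)]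
      linarith) hR0 w'
    have h2 : Tendsto (fun n => (γ : ℂ) • R n w') atTop (𝓝 0) := by
      rw [tendsto_zero_iff_norm_tendsto_zero]
      have h0 := (hR0.mul_const ‖w'‖).const_mul ‖(γ : ℂ)‖
      rw [zero_mul, mul_zero] at h0
      refine squeeze_zero (fun _ => norm_nonneg _) (fun n => ?_) h0
      rw [norm_smul]
      exact mul_le_mul_of_nonneg_left ((R n).le_opNorm _) (norm_nonneg _)
    have h3 := (h1.add h2).const_add ((γ : ℂ) • p.1)
    rw [add_zero, show (γ : ℂ) • p.1 + w' = p.2 by rw [hw]; abel] at h3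
    refine h3.congr fun n => ?_
    have e1 := (hR n).apply_graph p hp
    have e2 : R n w' = p.1 - ((n + 1 + γ : ℝ) : ℂ) • R n p.1 := by
      conv_rhs => enter [1]; rw [← e1]
      rw [hw, map_sub, map_add, map_smul, map_smul]
      push_cast
      module
    rw [hTapp, e2]
    push_cast
    module

/-- The filter `∫ k(t) exp (i t K) dt` of an operator `K ≥ γ` is `i π`, up to an
exponentially small error. -/
theorem norm_filter_le {K : E →ₗ.[ℂ] E} (hK : IsSelfAdjoint K) {U : ℝ → E →L[ℂ] E}
    (hU : IsUnitaryGroupOf K U) {γ : ℝ} (hγ : 0 < γ)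
    (hpos : ∀ p ∈ K.graph, γ * ‖p.1‖ ^ 2 ≤ (⟪p.1, p.2⟫_ℂ).re) {α N : ℝ} (hα : 0 < α) (h : α ≤ N)
    (φ : E) {p : E × E} (hp : p ∈ K.graph) :
    ‖(∫ t : ℝ, gaussKernel α N t • U t φ) - (Complex.I * π) • φ‖
      ≤ π * exp (-(1 / (4 * α)) * γ ^ 2) * ‖φ‖ + π * ‖φ - p.1‖ + √(π / N) * ‖p.2‖ := by
  obtain ⟨T, hT, hcomm, hTpos, hlim⟩ := exists_approximation hK hγ hpos
  obtain ⟨V, hV, hTV⟩ := exists_unitaryGroup_tendsto hK hT hcomm hlim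
  -- The limit group is generated by `K`, so uniqueness identifies it with the given one and the
  -- estimate, which does not involve `‖T n‖`, passes to the limit.
  obtain rfl : V = U := hV.unique hK hU
  have h1 : Tendsto (fun n => ∫ t : ℝ, gaussKernel α N t • expGroup (T n) t φ) atTop
      (𝓝 (∫ t : ℝ, gaussKernel α N t • V t φ)) := by
    refine tendsto_integral_of_dominated_convergence (fun t => |gaussKernel α N t| * ‖φ‖)
      (fun n => ?_) ((integrable_gaussKernel hα h).abs.mul_const _) (fun n => ?_) ?_
    · exact ((continuous_gaussKernel h).smul
        ((isUnitaryGroup_expGroup (hT n)).continuous φ)).aestronglyMeasurable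
    · refine Eventually.of_forall fun t => ?_
      rw [norm_smul, (isUnitaryGroup_expGroup (hT n)).norm_map, norm_eq_abs]
    · exact Eventually.of_forall fun t => (hTV t φ).const_smul _
  exact le_of_tendsto_of_tendsto (h1.sub_const _).norm
    (((hlim p hp).norm.const_mul _).const_add _) (Eventually.of_forall fun n =>
      norm_filter_expGroup_le (hT n) hγ (hTpos n) hα h φ p.1)

end Filtering

/-! ## Exponential clustering from a commutator bound -/

section Clustering

open MeasureTheory Filter Real

/-- Convexity puts the exponential below its chord on `[0, T]`. The resulting factor `t/T`
compensates the singularity of the kernel at short times. -/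
lemma exp_mul_sub_one_le {κ t T : ℝ} (ht : 0 ≤ t) (hT : 0 < T) (htT : t ≤ T) :
    exp (κ * t) - 1 ≤ t / T * (exp (κ * T) - 1) := by
  have h1 : t / T ≤ 1 := (div_le_one hT).2 htT
  have h := convexOn_exp.2 (Set.mem_univ 0) (Set.mem_univ (κ * T))
    (sub_nonneg.2 h1) (div_nonneg ht hT.le) (by ring)
  simp only [smul_eq_mul, mul_zero, zero_add, exp_zero, mul_one] at h
  rw [show t / T * (κ * T) = κ * t by field_simp] at h
  linarith

lemma integral_Ioi_mul_exp_neg_mul_sq {α T : ℝ} (hα : 0 < α) :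
    ∫ t in Set.Ioi T, t * exp (-α * t ^ 2) = exp (-α * T ^ 2) / (2 * α) := by
  have hd : ∀ t : ℝ, HasDerivAt (fun t => -(exp (-α * t ^ 2) / (2 * α))) (t * exp (-α * t ^ 2)) t :=
    fun t => by
      have h1 : HasDerivAt (fun t : ℝ => -α * t ^ 2) (-α * (2 * t)) t := by
        simpa using (hasDerivAt_pow 2 t).const_mul (-α)
      convert! (h1.exp.div_const (2 * α)).neg using 1
      field_simp
  have hlim : Tendsto (fun t : ℝ => -(exp (-α * t ^ 2) / (2 * α))) atTop (𝓝 0) := by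
    have h1 : Tendsto (fun t : ℝ => -α * t ^ 2) atTop atBot :=
      (tendsto_pow_atTop two_ne_zero).const_mul_atTop_of_neg (by linarith)
    simpa using ((tendsto_exp_atBot.comp h1).div_const (2 * α)).neg
  rw [integral_Ioi_of_hasDerivAt_of_tendsto (hd T).continuousAt.continuousWithinAt
    (fun t _ => hd t) (integrable_mul_exp_neg_mul_sq hα).integrableOn hlim]
  ring

/-- Half-line bound for the kernel against a function which is small for short times. -/
lemma integral_Ioi_gaussKernel_mul_le {α N D κ C T : ℝ} (hα : 0 < α) (h : α ≤ N) (hD : 0 ≤ D)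
    (hT : 0 < T) {f : ℝ → ℝ} (hf : Continuous f)
    (h0 : ∀ t, 0 ≤ f t) (h1 : ∀ t, 0 < t → f t ≤ D * (exp (κ * t) - 1)) (h2 : ∀ t, f t ≤ C) :
    ∫ t in Set.Ioi 0, gaussKernel α N t * f t
      ≤ D * exp (κ * T) + C / (2 * α * T ^ 2) * exp (-α * T ^ 2) := by
  have hC : 0 ≤ C := (h0 0).trans (h2 0)
  have hint : Integrable fun t => gaussKernel α N t * f t :=
    integrable_gaussKernel_smul hα h hf (C := C) fun t => by
      rw [norm_eq_abs, abs_of_nonneg (h0 t)]; exact h2 t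
  rw [← Set.Ioc_union_Ioi_eq_Ioi hT.le, setIntegral_union (Set.Ioc_disjoint_Ioi le_rfl)
    measurableSet_Ioi hint.integrableOn hint.integrableOn]
  refine add_le_add ?_ ?_
  · have hb : ∀ t ∈ Set.Ioc 0 T, gaussKernel α N t * f t ≤ D * (exp (κ * T) - 1) / T := by
      intro t ht
      have e1 : gaussKernel α N t ≤ 1 / t := by
        refine (gaussKernel_le ht.1).trans ?_
        have := ht.1
        gcongr
        exact exp_le_one_iff.2 (by nlinarith [sq_nonneg t])
      have e2 := (h1 t ht.1).trans
        (mul_le_mul_of_nonneg_left (exp_mul_sub_one_le ht.1.le hT ht.2) hD)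
      have e3 : gaussKernel α N t * f t ≤ 1 / t * (D * (t / T * (exp (κ * T) - 1))) :=
        mul_le_mul e1 e2 (h0 t) (by have := ht.1; positivity)
      refine e3.trans_eq ?_
      have := ht.1
      field_simp
    have hconst : IntegrableOn (fun _ : ℝ => D * (exp (κ * T) - 1) / T) (Set.Ioc 0 T) :=
      integrableOn_const (by simp)
    refine (setIntegral_mono_on hint.integrableOn hconst measurableSet_Ioc hb).trans ?_
    rw [setIntegral_const, smul_eq_mul, Measure.real, Real.volume_Ioc, sub_zero,
      ENNReal.toReal_ofReal hT.le, mul_div_cancel₀ _ hT.ne']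
    nlinarith
  · have hb : ∀ t ∈ Set.Ioi T, gaussKernel α N t * f t ≤ C / T ^ 2 * (t * exp (-α * t ^ 2)) := by
      intro t ht
      have ht' : T < t := ht
      have ht0 : 0 < t := hT.trans ht'
      have e1 : gaussKernel α N t ≤ t * exp (-α * t ^ 2) / T ^ 2 := by
        refine (gaussKernel_le ht0).trans ?_
        rw [div_le_div_iff₀ ht0 (by positivity)]
        have : T ^ 2 ≤ t ^ 2 := by gcongr
        nlinarith [exp_pos (-α * t ^ 2)]
      have e3 := mul_le_mul e1 (h2 t) (h0 t) (by positivity)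
      refine e3.trans_eq ?_
      ring
    refine (setIntegral_mono_on hint.integrableOn
      ((integrable_mul_exp_neg_mul_sq hα).const_mul _).integrableOn measurableSet_Ioi hb).trans ?_
    rw [integral_const_mul, integral_Ioi_mul_exp_neg_mul_sq hα]
    refine le_of_eq ?_
    field_simp

lemma norm_integral_gaussKernel_smul_le {α N D κ C T : ℝ} (hα : 0 < α) (h : α ≤ N) (hD : 0 ≤ D)
    (hT : 0 < T) {c : ℝ → ℂ} (hc : Continuous c)
    (h1 : ∀ t, ‖c t‖ ≤ D * (exp (κ * |t|) - 1)) (h2 : ∀ t, ‖c t‖ ≤ C) :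
    ‖∫ t, gaussKernel α N t • c t‖
      ≤ 2 * (D * exp (κ * T) + C / (2 * α * T ^ 2) * exp (-α * T ^ 2)) := by
  refine (norm_integral_le_integral_norm _).trans ?_
  have hint := (integrable_gaussKernel_smul hα h hc h2).norm
  rw [← intervalIntegral.integral_Iic_add_Ioi (b := 0) hint.integrableOn hint.integrableOn]
  have e1 : ∫ t in Set.Iic 0, ‖gaussKernel α N t • c t‖
      = ∫ t in Set.Ioi 0, gaussKernel α N t * ‖c (-t)‖ := by
    have := integral_comp_neg_Ioi (0 : ℝ) fun t => ‖gaussKernel α N t • c t‖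
    rw [neg_zero] at this
    rw [← this]
    refine setIntegral_congr_fun measurableSet_Ioi fun t ht => ?_
    rw [norm_smul, gaussKernel_neg, norm_neg, norm_eq_abs,
      abs_of_nonneg (gaussKernel_nonneg h (le_of_lt ht))]
  have e2 : ∫ t in Set.Ioi 0, ‖gaussKernel α N t • c t‖
      = ∫ t in Set.Ioi 0, gaussKernel α N t * ‖c t‖ := by
    refine setIntegral_congr_fun measurableSet_Ioi fun t ht => ?_
    rw [norm_smul, norm_eq_abs, abs_of_nonneg (gaussKernel_nonneg h (le_of_lt ht))]
  rw [e1, e2, two_mul]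
  refine add_le_add ?_ ?_
  · refine integral_Ioi_gaussKernel_mul_le hα h hD hT (by fun_prop) (fun _ => norm_nonneg _)
      (fun t ht => ?_) fun t => h2 _
    have := h1 (-t)
    rwa [abs_neg, abs_of_pos ht] at this
  · refine integral_Ioi_gaussKernel_mul_le hα h hD hT (by fun_prop) (fun _ => norm_nonneg _)
      (fun t ht => ?_) fun t => h2 _
    have := h1 t
    rwa [abs_of_pos ht] at this

/-! ### Moving the ground state energy up to the gap -/

variable {E : Type v} [NormedAddCommGroup E] [InnerProductSpace ℂ E]

lemma norm_sub_inner_smul_le {Ω : E} (hΩ : ‖Ω‖ = 1) (ψ : E) : ‖ψ - ⟪Ω, ψ⟫_ℂ • Ω‖ ≤ ‖ψ‖ := by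
  have h1 : ⟪ψ - ⟪Ω, ψ⟫_ℂ • Ω, ⟪Ω, ψ⟫_ℂ • Ω⟫_ℂ = 0 := by
    rw [inner_sub_left, inner_smul_right, inner_smul_right, inner_smul_left,
      inner_self_eq_norm_sq_to_K, hΩ, ← inner_conj_symm ψ Ω]
    simp
  have h2 := norm_add_sq_eq_norm_sq_add_norm_sq_of_inner_eq_zero (𝕜 := ℂ) _ _ h1
  rw [sub_add_cancel] at h2
  nlinarith [norm_nonneg (ψ - ⟪Ω, ψ⟫_ℂ • Ω), norm_nonneg ψ, norm_nonneg (⟪Ω, ψ⟫_ℂ • Ω)]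

/-- The bounded operator `γ |Ω⟩⟨Ω| - E₀`. -/
def groundShift (γ E₀ : ℝ) (Ω : E) : E →L[ℂ] E :=
  (γ : ℂ) • (innerSL ℂ Ω).smulRight Ω - (E₀ : ℂ) • 1

lemma groundShift_apply (γ E₀ : ℝ) (Ω ψ : E) :
    groundShift γ E₀ Ω ψ = (γ : ℂ) • ⟪Ω, ψ⟫_ℂ • Ω - (E₀ : ℂ) • ψ := rfl

/-- The group of `H + γ |Ω⟩⟨Ω| - E₀`. -/
def shiftGroup (U : ℝ → E →L[ℂ] E) (γ E₀ : ℝ) (Ω : E) (t : ℝ) : E →L[ℂ] E :=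
  Complex.exp (-(E₀ * t * Complex.I)) • U t
    + (Complex.exp (γ * t * Complex.I) - 1) • (innerSL ℂ Ω).smulRight Ω

lemma shiftGroup_apply (U : ℝ → E →L[ℂ] E) (γ E₀ : ℝ) (Ω : E) (t : ℝ) (ψ : E) :
    shiftGroup U γ E₀ Ω t ψ = Complex.exp (-(E₀ * t * Complex.I)) • U t ψ
    + (Complex.exp (γ * t * Complex.I) - 1) • ⟪Ω, ψ⟫_ℂ • Ω := rfl

lemma IsUnitaryGroup.exp_smul_apply_eigenvector {U : ℝ → E →L[ℂ] E} (hU : IsUnitaryGroup U)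
    {Ω : E} {E₀ : ℝ} (hΩ : (Ω, (E₀ : ℂ) • Ω) ∈ generator U) (t : ℝ) :
    Complex.exp (-(E₀ * t * Complex.I)) • U t Ω = Ω := by
  have hd : ∀ s : ℝ, HasDerivAt (fun s : ℝ => Complex.exp (-(E₀ * s * Complex.I)) • U s Ω) 0 s := by
    intro s
    have h1 : HasDerivAt (fun s : ℝ => -(E₀ * (s : ℂ) * Complex.I)) (-(E₀ * 1 * Complex.I)) s :=
      (((Complex.ofRealCLM.hasDerivAt (x := s)).const_mul (E₀ : ℂ)).mul_const _).neg
    have h2 := h1.cexp.smul (hU.hasDerivAt hΩ s)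
    convert! h2 using 1
    simp only [map_smul]
    module
  have := is_const_of_deriv_eq_zero (fun s => (hd s).differentiableAt) (fun s => (hd s).deriv) t 0
  rw [this]
  simp [hU.apply_zero]

lemma inner_exp_smul_apply {U : ℝ → E →L[ℂ] E} (hU : IsUnitaryGroup U)
    {Ω : E} {E₀ : ℝ} (hΩ : (Ω, (E₀ : ℂ) • Ω) ∈ generator U) (t : ℝ) (ψ : E) :
    ⟪Ω, Complex.exp (-(E₀ * t * Complex.I)) • U t ψ⟫_ℂ = ⟪Ω, ψ⟫_ℂ := by
  have h1 := hU.exp_smul_apply_eigenvector hΩ t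
  conv_lhs => rw [← h1]
  rw [inner_smul_left, inner_smul_right, hU.inner_map_map, ← mul_assoc, ← Complex.exp_conj,
    ← Complex.exp_add]
  simp

/-- The added rank-one term turns the phase of `Ω` from `1` into `exp(iγt)` and does not touch the
orthogonal complement, which the normalized group preserves. -/
lemma isUnitaryGroup_shiftGroup {U : ℝ → E →L[ℂ] E} (hU : IsUnitaryGroup U)
    {Ω : E} (h1 : ‖Ω‖ = 1) {E₀ : ℝ} (hΩ : (Ω, (E₀ : ℂ) • Ω) ∈ generator U) (γ : ℝ) :
    IsUnitaryGroup (shiftGroup U γ E₀ Ω) := by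
  have hs : ⟪Ω, Ω⟫_ℂ = 1 := by rw [inner_self_eq_norm_sq_to_K, h1]; simp
  refine ⟨?_, fun s t => ?_, fun t ψ => ?_, fun ψ => ?_⟩
  · ext ψ
    simp [shiftGroup_apply, hU.apply_zero]
  · ext ψ
    have h3 : ∀ z c : ℂ, Complex.exp (-(E₀ * s * Complex.I)) • z • c • U s Ω = z • c • Ω :=
        fun z c => by
      conv_rhs => rw [← hU.exp_smul_apply_eigenvector hΩ s]
      module
    rw [mul_apply_eq_comp, shiftGroup_apply, shiftGroup_apply U γ E₀ Ω s,
      shiftGroup_apply U γ E₀ Ω t, inner_add_right, inner_exp_smul_apply hU hΩ, map_add, smul_add,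
      map_smul, map_smul, map_smul, inner_smul_right, inner_smul_right, hs, mul_one, h3, hU.apply_add]
    rw [show -(E₀ * ((s + t : ℝ) : ℂ) * Complex.I) = -(E₀ * s * Complex.I) + -(E₀ * t * Complex.I) by
      push_cast; ring, show γ * ((s + t : ℝ) : ℂ) * Complex.I
        = γ * s * Complex.I + γ * t * Complex.I by push_cast; ring, Complex.exp_add, Complex.exp_add]
    module
  · set x := Complex.exp (-(E₀ * t * Complex.I)) • U t ψ with hx
    have hxn : ‖x‖ = ‖ψ‖ := by
      rw [hx, norm_smul, hU.norm_map, show -(E₀ * t * Complex.I) = ((-(E₀ * t) : ℝ) : ℂ) * Complex.I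
        by push_cast; ring, Complex.norm_exp_ofReal_mul_I, one_mul]
    set c := ⟪Ω, ψ⟫_ℂ with hc
    have hcx : ⟪Ω, x⟫_ℂ = c := inner_exp_smul_apply hU hΩ t ψ
    have hcx' : ⟪x, Ω⟫_ℂ = starRingEnd ℂ c := by rw [← hcx, inner_conj_symm]
    set z := Complex.exp (γ * t * Complex.I) with hz
    have hzn : z * starRingEnd ℂ z = 1 := by
      rw [hz, ← Complex.exp_conj, ← Complex.exp_add]; simp
    have key : ⟪shiftGroup U γ E₀ Ω t ψ, shiftGroup U γ E₀ Ω t ψ⟫_ℂ = ⟪x, x⟫_ℂ := by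
      rw [shiftGroup_apply, ← hx, ← hc, ← hz]
      simp only [inner_add_left, inner_add_right, inner_smul_left, inner_smul_right, hcx, hcx', hs,
        map_sub, map_one]
      linear_combination (c * starRingEnd ℂ c) * hzn
    rw [inner_self_eq_norm_sq_to_K, inner_self_eq_norm_sq_to_K, hxn] at key
    have h2 : ‖shiftGroup U γ E₀ Ω t ψ‖ ^ 2 = ‖ψ‖ ^ 2 := by exact_mod_cast key
    exact (sq_eq_sq₀ (norm_nonneg _) (norm_nonneg _)).1 h2
  · simp only [shiftGroup_apply]
    have := hU.continuous ψ
    fun_prop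

lemma isUnitaryGroupOf_shiftGroup {H : E →ₗ.[ℂ] E} {U : ℝ → E →L[ℂ] E} (hU : IsUnitaryGroupOf H U)
    {Ω : E} (h1 : ‖Ω‖ = 1) {E₀ : ℝ} (hΩ : (Ω, (E₀ : ℂ) • Ω) ∈ H.graph) (γ : ℝ) :
    IsUnitaryGroupOf (H + (groundShift γ E₀ Ω).toLinearMap.toPMap ⊤) (shiftGroup U γ E₀ Ω) := by
  obtain ⟨hU', hg⟩ := isUnitaryGroupOf_iff.1 hU
  refine isUnitaryGroupOf_iff.2 ⟨isUnitaryGroup_shiftGroup hU' h1 (hg hΩ) γ, ?_⟩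
  rintro ⟨x, y⟩ hp
  have hx := mem_generator.1 (hg ((mem_graph_add_toPMap _ _ _ _).1 hp))
  rw [mem_generator]
  have a1 : HasDerivAt (fun s : ℝ => -(E₀ * (s : ℂ) * Complex.I)) (-(E₀ * 1 * Complex.I)) 0 :=
    (((Complex.ofRealCLM.hasDerivAt (x := 0)).const_mul (E₀ : ℂ)).mul_const _).neg
  have a2 : HasDerivAt (fun s : ℝ => γ * (s : ℂ) * Complex.I) (γ * 1 * Complex.I) 0 :=
    (((Complex.ofRealCLM.hasDerivAt (x := 0)).const_mul (γ : ℂ)).mul_const _)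
  have a3 := (a1.cexp.smul hx).add ((a2.cexp.sub_const 1).smul_const (⟪Ω, x⟫_ℂ • Ω))
  convert! a3 using 1
  rw [groundShift_apply, hU'.apply_zero]
  simp only [Complex.ofReal_zero, mul_zero, zero_mul, neg_zero, Complex.exp_zero]
  module

variable [CompleteSpace E]

lemma isSelfAdjoint_groundShift (γ E₀ : ℝ) (Ω : E) : IsSelfAdjoint (groundShift γ E₀ Ω) := by
  rw [ContinuousLinearMap.isSelfAdjoint_iff_isSymmetric]
  intro x y
  change ⟪groundShift γ E₀ Ω x, y⟫_ℂ = ⟪x, groundShift γ E₀ Ω y⟫_ℂ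
  simp only [groundShift_apply, inner_sub_left, inner_sub_right, inner_smul_left, inner_smul_right,
    Complex.conj_ofReal, inner_conj_symm]
  ring

/-- On `Ω` the shifted operator equals `γ`, on the complement it is at least `γ` by the gap, and the
mixed terms vanish by symmetry of `H`. Hence the filter applies on the whole space, with no
restriction to the complement of `Ω`. -/
lemma groundShift_lower_bound {H : E →ₗ.[ℂ] E} (hH : IsSelfAdjoint H) {γ E₀ : ℝ}
    {Ω : E} (h1 : ‖Ω‖ = 1) (hΩ : (Ω, (E₀ : ℂ) • Ω) ∈ H.graph)
    (hgap : ∀ p ∈ H.graph, ⟪Ω, p.1⟫_ℂ = 0 → (E₀ + γ) * ‖p.1‖ ^ 2 ≤ (⟪p.1, p.2⟫_ℂ).re)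
    {p : E × E} (hp : p ∈ (H + (groundShift γ E₀ Ω).toLinearMap.toPMap ⊤).graph) :
    γ * ‖p.1‖ ^ 2 ≤ (⟪p.1, p.2⟫_ℂ).re := by
  obtain ⟨x, z⟩ := p
  have hs : ⟪Ω, Ω⟫_ℂ = 1 := by rw [inner_self_eq_norm_sq_to_K, h1]; simp
  have hxy := (mem_graph_add_toPMap _ _ _ _).1 hp
  set y := z - groundShift γ E₀ Ω x with hy
  set c := ⟪Ω, x⟫_ℂ with hc
  have hg : (x - c • Ω, y - c • (E₀ : ℂ) • Ω) ∈ H.graph :=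
    H.graph.sub_mem hxy (H.graph.smul_mem c hΩ)
  set x' := x - c • Ω with hx'
  set y' := y - c • (E₀ : ℂ) • Ω with hy'
  have e1 : ⟪Ω, x'⟫_ℂ = 0 := by
    rw [hx', inner_sub_right, inner_smul_right, hs, ← hc]; ring
  have e1' : ⟪x', Ω⟫_ℂ = 0 := by rw [← inner_conj_symm, e1, map_zero]
  have e2 : ⟪Ω, y'⟫_ℂ = 0 := by
    have := inner_graph_of_isSelfAdjoint hH hΩ hg
    simp only [inner_smul_left, e1, mul_zero] at this
    exact this.symm
  have e3 := hgap _ hg e1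
  have hxx : x = c • Ω + x' := by rw [hx']; abel
  have hz : z = y' - (E₀ : ℂ) • x' + (γ : ℂ) • c • Ω := by
    have : z = y + groundShift γ E₀ Ω x := by rw [hy]; abel
    rw [this, groundShift_apply, ← hc, hy', hx']
    module
  have e4 : ‖x‖ ^ 2 = ‖c‖ ^ 2 + ‖x'‖ ^ 2 := by
    have := norm_add_sq_eq_norm_sq_add_norm_sq_of_inner_eq_zero (𝕜 := ℂ) (c • Ω) x' (by
      rw [inner_smul_left, e1, mul_zero])
    rw [← hxx, norm_smul, h1, mul_one] at this
    nlinarith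
  have e5 : ⟪x, z⟫_ℂ = ⟪x', y'⟫_ℂ - E₀ * ⟪x', x'⟫_ℂ + γ * (c * starRingEnd ℂ c) := by
    rw [hz, hxx]
    simp only [inner_add_left, inner_add_right, inner_sub_right, inner_smul_left, inner_smul_right,
      e1, e1', e2, hs]
    ring
  have e6 : (⟪x, z⟫_ℂ).re = (⟪x', y'⟫_ℂ).re - E₀ * ‖x'‖ ^ 2 + γ * ‖c‖ ^ 2 := by
    rw [e5, inner_self_eq_norm_sq_to_K, Complex.mul_conj, Complex.normSq_eq_norm_sq]
    simp only [Complex.coe_algebraMap]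
    rw [← Complex.ofReal_pow, ← Complex.ofReal_mul, ← Complex.ofReal_mul, Complex.add_re,
      Complex.sub_re, Complex.ofReal_re, Complex.ofReal_re]
  change γ * ‖x‖ ^ 2 ≤ (⟪x, z⟫_ℂ).re
  simp only at e3
  rw [e4, e6]
  linarith

/-- Exponential clustering in a gapped ground state, for observables that satisfy a commutator
bound of Lieb-Robinson type. The time cutoff `T` is arbitrary. -/
theorem norm_correlation_le {H : E →ₗ.[ℂ] E} (hH : IsSelfAdjoint H) {γ : ℝ} (hγ : 0 < γ) {Ω : E}
    (hΩ : IsGappedGroundState H γ Ω) {A B : E →L[ℂ] E} (hAB : A * B = B * A) {D κ : ℝ}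
    (hD : 0 ≤ D)
    (hc : ∀ t, ‖A * heisenberg H t B - heisenberg H t B * A‖ ≤ D * (exp (κ * |t|) - 1))
    {T : ℝ} (hT : 0 < T) :
    ‖correlation Ω A B‖ ≤ ‖A‖ * ‖B‖ * (1 + 1 / (γ * T)) * exp (-(γ * T / 2)) + D * exp (κ * T) := by
  obtain ⟨hn, E₀, ⟨Ω', hΩ', hE⟩, hgap⟩ := hΩ
  have hs : ⟪Ω, Ω⟫_ℂ = 1 := by rw [inner_self_eq_norm_sq_to_K, hn]; simp
  have hgr : (Ω, (E₀ : ℂ) • Ω) ∈ H.graph := by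
    rw [← hE, ← hΩ']; exact H.mem_graph Ω'
  have hgap' : ∀ p ∈ H.graph, ⟪Ω, p.1⟫_ℂ = 0 → (E₀ + γ) * ‖p.1‖ ^ 2 ≤ (⟪p.1, p.2⟫_ℂ).re := by
    rintro ⟨x, y⟩ hp h0
    obtain ⟨ψ, h1, h2⟩ := (LinearPMap.mem_graph_iff _).1 hp
    simp only at h1 h2 h0 ⊢
    rw [← h1, ← h2]
    exact hgap ψ (by rw [h1]; exact h0)
  have hUH := isUnitaryGroupOf_unitaryGroup hH
  obtain ⟨hU, hgU⟩ := isUnitaryGroupOf_iff.1 hUH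
  set U := unitaryGroup H
  set K := H + (groundShift γ E₀ Ω).toLinearMap.toPMap ⊤ with hKdef
  have hK : IsSelfAdjoint K := isSelfAdjoint_add_toPMap hH (isSelfAdjoint_groundShift _ _ _)
  have hWK := isUnitaryGroupOf_shiftGroup hUH hn hgr γ
  obtain ⟨hW, -⟩ := isUnitaryGroupOf_iff.1 hWK
  set W := shiftGroup U γ E₀ Ω with hWdef
  have hev := hU.exp_smul_apply_eigenvector (hgU hgr)
  have hphase : ∀ t : ℝ, starRingEnd ℂ (Complex.exp (-(E₀ * t * Complex.I)))
      * Complex.exp (-(E₀ * t * Complex.I)) = 1 := fun t => by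
    rw [← Complex.exp_conj, ← Complex.exp_add]; simp
  have hUneg : ∀ t : ℝ, U (-t) Ω = Complex.exp (-(E₀ * t * Complex.I)) • Ω := fun t => by
    have := hev t
    conv_lhs => rw [← this]
    rw [map_smul, hU.neg_apply_apply]
  set φ := B Ω - ⟪Ω, B Ω⟫_ℂ • Ω with hφ
  set φ' := star B Ω - ⟪Ω, star B Ω⟫_ℂ • Ω with hφ'
  have hφ0 : ∀ ψ : E, ⟪Ω, ψ - ⟪Ω, ψ⟫_ℂ • Ω⟫_ℂ = 0 := fun ψ => by
    rw [inner_sub_right, inner_smul_right, hs]; ring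
  have hWφ : ∀ (t : ℝ) (ψ : E), Complex.exp (-(E₀ * t * Complex.I)) • U t ψ
      = W t (ψ - ⟪Ω, ψ⟫_ℂ • Ω) + ⟪Ω, ψ⟫_ℂ • Ω := fun t ψ => by
    rw [hWdef, shiftGroup_apply, hφ0, zero_smul, smul_zero, add_zero, map_sub, smul_sub, map_smul,
      smul_comm _ ⟪Ω, ψ⟫_ℂ, hev, sub_add_cancel]
  -- The disconnected parts `⟨A⟩⟨B⟩` are equal in both orderings and cancel in the commutator; what
  -- remains is expressed by orbits of vectors orthogonal to `Ω`.
  set c : ℝ → ℂ := fun t => ⟪Ω, (A * heisenberg H t B - heisenberg H t B * A) Ω⟫_ℂ with hcdef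
  have hstarB : ∀ x y : E, ⟪star B x, y⟫_ℂ = ⟪x, B y⟫_ℂ := fun x y => by
    rw [ContinuousLinearMap.star_eq_adjoint, ContinuousLinearMap.adjoint_inner_left]
  have hstarA : ∀ x y : E, ⟪star A x, y⟫_ℂ = ⟪x, A y⟫_ℂ := fun x y => by
    rw [ContinuousLinearMap.star_eq_adjoint, ContinuousLinearMap.adjoint_inner_left]
  have hstarB' : ∀ x y : E, ⟪B x, y⟫_ℂ = ⟪x, star B y⟫_ℂ := fun x y => by
    rw [ContinuousLinearMap.star_eq_adjoint, ContinuousLinearMap.adjoint_inner_right]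
  have hct : ∀ t, c t = ⟪star A Ω, W t φ⟫_ℂ - ⟪W t φ', A Ω⟫_ℂ := by
    intro t
    have e1 : ⟪Ω, (A * heisenberg H t B) Ω⟫_ℂ
        = ⟪star A Ω, W t φ⟫_ℂ + ⟪Ω, B Ω⟫_ℂ * ⟪Ω, A Ω⟫_ℂ := by
      change ⟪Ω, A (U t (B (U (-t) Ω)))⟫_ℂ = _
      rw [hUneg, map_smul, map_smul, ← hstarA, hWφ, inner_add_right, inner_smul_right, hstarA Ω Ω]
    have e2 : ⟪Ω, (heisenberg H t B * A) Ω⟫_ℂ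
        = ⟪W t φ', A Ω⟫_ℂ + ⟪Ω, B Ω⟫_ℂ * ⟪Ω, A Ω⟫_ℂ := by
      change ⟪Ω, U t (B (U (-t) (A Ω)))⟫_ℂ = _
      rw [hU.inner_map_right, hUneg, ← hstarB, ← hU.inner_map_left, map_smul, map_smul, hWφ,
        inner_add_left, inner_smul_left, inner_conj_symm, hstarB]
    change ⟪Ω, (A * heisenberg H t B - heisenberg H t B * A) Ω⟫_ℂ = _
    rw [sub_apply, inner_sub_right, e1, e2]
    ring
  have hcorr1 : ⟪star A Ω, φ⟫_ℂ = correlation Ω A B := by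
    rw [hφ, inner_sub_right, inner_smul_right, hstarA, hstarA, correlation]
    simp only [mul_apply_eq_comp]
    ring
  -- Commutation at time zero enters here: the reversed ordering has the same truncated correlation.
  have hcorr2 : ⟪φ', A Ω⟫_ℂ = correlation Ω A B := by
    rw [hφ', inner_sub_left, inner_smul_left, inner_conj_symm, hstarB, hstarB, correlation, hAB]
    simp only [mul_apply_eq_comp]
    ring
  have hcc : Continuous c := by
    have h1 := hW.continuous φ
    have h2 := hW.continuous φ'
    have : c = fun t => ⟪star A Ω, W t φ⟫_ℂ - ⟪W t φ', A Ω⟫_ℂ := funext hct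
    rw [this]
    fun_prop
  have hAΩ : ‖A Ω‖ ≤ ‖A‖ := by simpa [hn] using A.le_opNorm Ω
  have hBΩ : ‖B Ω‖ ≤ ‖B‖ := by simpa [hn] using B.le_opNorm Ω
  have hAΩ' : ‖star A Ω‖ ≤ ‖A‖ := by simpa [hn] using (star A).le_opNorm Ω
  have hBΩ' : ‖star B Ω‖ ≤ ‖B‖ := by simpa [hn] using (star B).le_opNorm Ω
  have hφn : ‖φ‖ ≤ ‖B‖ := (norm_sub_inner_smul_le hn _).trans hBΩ
  have hφn' : ‖φ'‖ ≤ ‖B‖ := (norm_sub_inner_smul_le hn _).trans hBΩ'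
  have hcC : ∀ t, ‖c t‖ ≤ 2 * (‖A‖ * ‖B‖) := fun t => by
    rw [hct, two_mul]
    refine (norm_sub_le _ _).trans (add_le_add ?_ ?_)
    · refine (norm_inner_le_norm _ _).trans ?_
      rw [hW.norm_map]
      exact mul_le_mul hAΩ' hφn (norm_nonneg _) (norm_nonneg _)
    · refine (norm_inner_le_norm _ _).trans ?_
      rw [hW.norm_map, mul_comm]
      exact mul_le_mul hAΩ hφn' (norm_nonneg _) (norm_nonneg _)
  have hcD : ∀ t, ‖c t‖ ≤ D * (exp (κ * |t|) - 1) := fun t => by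
    refine le_trans ?_ (hc t)
    refine (norm_inner_le_norm _ _).trans ?_
    rw [hn, one_mul]
    simpa [hn] using (A * heisenberg H t B - heisenberg H t B * A).le_opNorm Ω
  -- This width equalizes the two Gaussian errors: the kernel tail `exp(-αT²)` and the filter error
  -- `exp(-γ²/(4α))` both become `exp(-γT/2)`.
  set α : ℝ := γ / (2 * T) with hα
  have hα0 : 0 < α := by positivity
  have hαT : α * T ^ 2 = γ * T / 2 := by rw [hα]; field_simp
  have hαγ : 1 / (4 * α) * γ ^ 2 = γ * T / 2 := by rw [hα]; field_simp; ring
  set e := exp (-(γ * T / 2)) with he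
  -- The vector need not lie in the domain of `K`; it is replaced by a nearby one that does, and
  -- then `N` is taken large.
  have hfilter : ∀ ψ : E, ∀ ε : ℝ, 0 < ε → ∀ᶠ N : ℝ in atTop,
      ‖(∫ t : ℝ, gaussKernel α N t • W t ψ) - (Complex.I * π) • ψ‖ ≤ π * e * ‖ψ‖ + ε := by
    intro ψ ε hε
    obtain ⟨x, hx, hψx⟩ := Metric.mem_closure_iff.1 (hK.dense_domain ψ) (ε / (2 * π))
      (by positivity)
    have hlim : Tendsto (fun N : ℝ => √(π / N) * ‖K ⟨x, hx⟩‖) atTop (𝓝 0) := by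
      have h1 : Tendsto (fun N : ℝ => π / N) atTop (𝓝 0) := tendsto_const_nhds.div_atTop tendsto_id
      have h2 := (continuous_sqrt.tendsto 0).comp h1
      rw [sqrt_zero] at h2
      simpa using h2.mul_const ‖K ⟨x, hx⟩‖
    filter_upwards [hlim.eventually_lt_const (show 0 < ε / 2 by positivity),
      eventually_ge_atTop α] with N hN1 hN2
    have h1 := norm_filter_le hK hWK hγ
      (fun p hp => groundShift_lower_bound hH hn hgr hgap' hp) hα0 hN2 ψ (K.mem_graph ⟨x, hx⟩)
    rw [neg_mul, hαγ] at h1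
    refine h1.trans ?_
    rw [dist_eq_norm, lt_div_iff₀ (by positivity)] at hψx
    simp only
    linarith
  have main : ∀ ε : ℝ, 0 < ε → 2 * π * ‖correlation Ω A B‖
      ≤ 2 * (D * exp (κ * T) + 2 * (‖A‖ * ‖B‖) / (γ * T) * e) + 2 * (‖A‖ * (π * e * ‖B‖ + ε)) := by
    intro ε hε
    obtain ⟨N, hN1, hN2, hN3⟩ := ((hfilter φ ε hε).and ((hfilter φ' ε hε).and
      (eventually_ge_atTop α))).exists
    have hi1 : Integrable fun t => gaussKernel α N t • W t φ :=
      integrable_gaussKernel_smul hα0 hN3 (hW.continuous φ) fun t => (hW.norm_map t φ).le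
    have hi2 : Integrable fun t => gaussKernel α N t • W t φ' :=
      integrable_gaussKernel_smul hα0 hN3 (hW.continuous φ') fun t => (hW.norm_map t φ').le
    set I1 := ∫ t : ℝ, gaussKernel α N t • W t φ with hI1
    set I2 := ∫ t : ℝ, gaussKernel α N t • W t φ' with hI2
    have e1 : ∫ t, gaussKernel α N t • c t = ⟪star A Ω, I1⟫_ℂ - ⟪I2, A Ω⟫_ℂ := by
      have a1 : ⟪star A Ω, I1⟫_ℂ = ∫ t, gaussKernel α N t • ⟪star A Ω, W t φ⟫_ℂ := by
        rw [hI1, ← integral_inner hi1]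
        refine integral_congr_ae (Eventually.of_forall fun t => ?_)
        exact inner_smul_right_eq_smul _ _ _
      have a2 : ⟪I2, A Ω⟫_ℂ = ∫ t, gaussKernel α N t • ⟪W t φ', A Ω⟫_ℂ := by
        rw [← inner_conj_symm, hI2, ← integral_inner hi2, ← integral_conj]
        refine integral_congr_ae (Eventually.of_forall fun t => ?_)
        simp only
        rw [inner_conj_symm]
        exact inner_smul_left_eq_smul _ _ _
      have c1 : Continuous fun t => ⟪star A Ω, W t φ⟫_ℂ := by
        have := hW.continuous φ
        fun_prop
      have c2 : Continuous fun t => ⟪W t φ', A Ω⟫_ℂ := by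
        have := hW.continuous φ'
        fun_prop
      rw [a1, a2, ← integral_sub]
      · simp only [hct, smul_sub]
      · exact integrable_gaussKernel_smul hα0 hN3 c1 (C := ‖star A Ω‖ * ‖φ‖) fun t => by
          refine (norm_inner_le_norm _ _).trans ?_
          rw [hW.norm_map]
      · exact integrable_gaussKernel_smul hα0 hN3 c2 (C := ‖φ'‖ * ‖A Ω‖) fun t => by
          refine (norm_inner_le_norm _ _).trans ?_
          rw [hW.norm_map]
    -- The inner product is conjugate linear on the left, so the second filter contributes `-iπ`;
    -- with the minus sign in `c` the two halves add up to `2πi`.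
    have e2 : (2 * π * Complex.I) * correlation Ω A B = (∫ t, gaussKernel α N t • c t)
        - ⟪star A Ω, I1 - (Complex.I * π) • φ⟫_ℂ + ⟪I2 - (Complex.I * π) • φ', A Ω⟫_ℂ := by
      rw [e1, inner_sub_right, inner_sub_left, inner_smul_right, inner_smul_left, hcorr1, hcorr2,
        map_mul, Complex.conj_I, Complex.conj_ofReal]
      ring
    have e3 : ‖(2 * π * Complex.I) * correlation Ω A B‖ = 2 * π * ‖correlation Ω A B‖ := by
      rw [norm_mul, norm_mul, norm_mul, Complex.norm_I, Complex.norm_real, norm_eq_abs,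
        abs_of_pos pi_pos]
      simp
    have e4 := norm_integral_gaussKernel_smul_le hα0 hN3 hD hT hcc hcD hcC
    rw [show 2 * α * T ^ 2 = γ * T by linarith, neg_mul, hαT] at e4
    rw [← e3, e2]
    refine (norm_add_le _ _).trans ?_
    have b1 : ‖⟪star A Ω, I1 - (Complex.I * π) • φ⟫_ℂ‖ ≤ ‖A‖ * (π * e * ‖B‖ + ε) := by
      refine (norm_inner_le_norm _ _).trans ?_
      refine mul_le_mul hAΩ' (hN1.trans ?_) (norm_nonneg _) (norm_nonneg _)
      gcongr
    have b2 : ‖⟪I2 - (Complex.I * π) • φ', A Ω⟫_ℂ‖ ≤ ‖A‖ * (π * e * ‖B‖ + ε) := by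
      refine (norm_inner_le_norm _ _).trans ?_
      rw [mul_comm]
      refine mul_le_mul hAΩ (hN2.trans ?_) (norm_nonneg _) (norm_nonneg _)
      gcongr
    have b3 := norm_sub_le (∫ t, gaussKernel α N t • c t) ⟪star A Ω, I1 - (Complex.I * π) • φ⟫_ℂ
    linarith
  have main' : 2 * π * ‖correlation Ω A B‖
      ≤ 2 * (D * exp (κ * T) + 2 * (‖A‖ * ‖B‖) / (γ * T) * e) + 2 * (‖A‖ * (π * e * ‖B‖)) := by
    refine le_of_forall_pos_le_add fun ε hε => ?_
    have hpos : 0 < 2 * (‖A‖ + 1) := by positivity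
    refine (main (ε / (2 * (‖A‖ + 1))) (by positivity)).trans ?_
    have : 2 * (‖A‖ * (ε / (2 * (‖A‖ + 1)))) ≤ ε := by
      have : 2 * (‖A‖ * (ε / (2 * (‖A‖ + 1)))) = ε * (‖A‖ / (‖A‖ + 1)) := by field_simp
      rw [this]
      refine mul_le_of_le_one_right hε.le ((div_le_one (by positivity)).2 (by linarith))
    linarith
  have h2π : (2 : ℝ) ≤ π := by linarith [pi_gt_three]
  have hpos1 : 0 ≤ D * exp (κ * T) := by positivity
  have hpos2 : 0 ≤ ‖A‖ * ‖B‖ / (γ * T) * e := by positivity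
  have hfin : 2 * π * ‖correlation Ω A B‖ ≤ 2 * π *
      (‖A‖ * ‖B‖ * (1 + 1 / (γ * T)) * e + D * exp (κ * T)) := by
    refine main'.trans ?_
    have r1 : 2 * (‖A‖ * ‖B‖) / (γ * T) * e = 2 * (‖A‖ * ‖B‖ / (γ * T) * e) := by ring
    have r2 : ‖A‖ * ‖B‖ * (1 + 1 / (γ * T)) * e = ‖A‖ * ‖B‖ * e + ‖A‖ * ‖B‖ / (γ * T) * e := by ring
    rw [r1, r2]
    nlinarith [mul_le_mul_of_nonneg_right h2π hpos1, mul_le_mul_of_nonneg_right h2π hpos2]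
  exact le_of_mul_le_mul_left hfin (by positivity)

end Clustering

/-! ## Tensor products over disjoint sets of sites -/

section TensorProducts

variable {Γ : Type u} {𝓗 : Γ → Type v} [∀ x, NormedAddCommGroup (𝓗 x)]
  [∀ x, InnerProductSpace ℂ (𝓗 x)] [∀ x, CompleteSpace (𝓗 x)]

/-- Restriction of a configuration to a smaller set. -/
def resConfig {X Y : Finset Γ} (h : X ⊆ Y) (j : Config 𝓗 Y) : Config 𝓗 X := fun x => j ⟨x.1, h x.2⟩

lemma splitConfig_symm_of_mem {X Y : Finset Γ} (h : X ⊆ Y) (i : Config 𝓗 X) (k) {y : Y}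
    (hy : y.1 ∈ X) : (splitConfig (𝓗 := 𝓗) h).symm (i, k) y = i ⟨y.1, hy⟩ := by
  simp [splitConfig, hy]

lemma splitConfig_symm_of_notMem {X Y : Finset Γ} (h : X ⊆ Y) (i : Config 𝓗 X) (k) {y : Y}
    (hy : y.1 ∉ X) : (splitConfig (𝓗 := 𝓗) h).symm (i, k) y = k ⟨y, hy⟩ := by
  simp [splitConfig, hy]

lemma slice_amplify {X Y : Finset Γ} (h : X ⊆ Y) (A : LocalAlgebra 𝓗 X) (k)
    (ψ : HilbertTensor 𝓗 Y) : slice h k (amplify h A ψ) = A (slice h k ψ) := by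
  ext i
  rw [slice_apply, amplify_apply, Equiv.apply_symm_apply]

/-- Amplified operators act slice by slice, so identities between them reduce to identities over the
smaller set. -/
lemma slice_ext {X Y : Finset Γ} (h : X ⊆ Y) {ψ φ : HilbertTensor 𝓗 Y}
    (hs : ∀ k, slice h k ψ = slice h k φ) : ψ = φ := by
  ext j
  have := congrArg (fun f => f (splitConfig h j).1) (congrArg Subtype.val (hs (splitConfig h j).2))
  have h2 : slice h (splitConfig h j).2 ψ (splitConfig h j).1
      = slice h (splitConfig h j).2 φ (splitConfig h j).1 := this
  rw [slice_apply, slice_apply, Prod.mk.eta, Equiv.symm_apply_apply] at h2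
  exact h2

lemma amplify_mul {X Y : Finset Γ} (h : X ⊆ Y) (A B : LocalAlgebra 𝓗 X) :
    amplify h (A * B) = amplify h A * amplify h B := by
  ext1 ψ
  refine slice_ext h fun k => ?_
  rw [mul_apply_eq_comp, slice_amplify, slice_amplify, slice_amplify]
  rfl

lemma amplify_one {X Y : Finset Γ} (h : X ⊆ Y) : amplify h (1 : LocalAlgebra 𝓗 X) = 1 := by
  ext1 ψ
  refine slice_ext h fun k => ?_
  rw [slice_amplify]
  rfl

lemma amplify_zero {X Y : Finset Γ} (h : X ⊆ Y) : amplify h (0 : LocalAlgebra 𝓗 X) = 0 := by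
  ext1 ψ
  refine slice_ext h fun k => ?_
  rw [slice_amplify]
  simp

lemma amplify_add {X Y : Finset Γ} (h : X ⊆ Y) (A B : LocalAlgebra 𝓗 X) :
    amplify h (A + B) = amplify h A + amplify h B := by
  ext1 ψ
  refine slice_ext h fun k => ?_
  rw [slice_amplify, add_apply, add_apply, map_add, slice_amplify, slice_amplify]

lemma amplify_sum {X Y : Finset Γ} (h : X ⊆ Y) {ι : Type*} (s : Finset ι)
    (A : ι → LocalAlgebra 𝓗 X) : amplify h (∑ i ∈ s, A i) = ∑ i ∈ s, amplify h (A i) := by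
  classical
  induction s using Finset.induction_on with
  | empty => simp [amplify_zero]
  | insert a s ha ih => rw [Finset.sum_insert ha, Finset.sum_insert ha, amplify_add, ih]

lemma norm_amplify_le {X Y : Finset Γ} (h : X ⊆ Y) (A : LocalAlgebra 𝓗 X) :
    ‖amplify h A‖ ≤ ‖A‖ :=
  LinearMap.mkContinuous_norm_le _ (norm_nonneg _) _

lemma hasSum_inner_slice {X Y : Finset Γ} (h : X ⊆ Y) (ψ φ : HilbertTensor 𝓗 Y) :
    HasSum (fun k => ⟪slice h k ψ, slice h k φ⟫_ℂ) ⟪ψ, φ⟫_ℂ := by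
  have h1 := lp.hasSum_inner (𝕜 := ℂ) ψ φ
  rw [← ((Equiv.prodComm _ _).trans (splitConfig h).symm).hasSum_iff] at h1
  exact h1.prod_fiberwise fun k => lp.hasSum_inner (𝕜 := ℂ) (slice h k ψ) (slice h k φ)

lemma amplify_star {X Y : Finset Γ} (h : X ⊆ Y) (A : LocalAlgebra 𝓗 X) :
    star (amplify h A) = amplify h (star A) := by
  rw [ContinuousLinearMap.star_eq_adjoint, eq_comm, ContinuousLinearMap.eq_adjoint_iff]
  intro ψ φ
  have h1 := hasSum_inner_slice h (amplify h (star A) ψ) φ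
  have h2 := hasSum_inner_slice h ψ (amplify h A φ)
  simp only [slice_amplify, ContinuousLinearMap.star_eq_adjoint,
    ContinuousLinearMap.adjoint_inner_left] at h1 h2
  exact h1.unique h2

lemma isSelfAdjoint_amplify {X Y : Finset Γ} (h : X ⊆ Y) {A : LocalAlgebra 𝓗 X}
    (hA : IsSelfAdjoint A) : IsSelfAdjoint (amplify h A) := by
  rw [IsSelfAdjoint, amplify_star, hA.star_eq]

lemma amplify_amplify {X Y Z : Finset Γ} (h : X ⊆ Y) (h' : Y ⊆ Z) (A : LocalAlgebra 𝓗 X) :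
    amplify h' (amplify h A) = amplify (h.trans h') A := by
  ext1 ψ
  ext j
  rw [amplify_apply, amplify_apply, amplify_apply]
  have h1 : slice h (splitConfig h (splitConfig h' j).1).2 (slice h' (splitConfig h' j).2 ψ)
      = slice (h.trans h') (splitConfig (h.trans h') j).2 ψ := by
    ext i
    rw [slice_apply, slice_apply, slice_apply]
    refine congrArg (fun c => ψ c) (funext fun z => ?_)
    by_cases hX : z.1 ∈ X
    · rw [splitConfig_symm_of_mem h' _ _ (h hX),
        splitConfig_symm_of_mem h _ _ (y := ⟨z.1, h hX⟩) hX,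
        splitConfig_symm_of_mem (h.trans h') _ _ hX]
    · rw [splitConfig_symm_of_notMem (h.trans h') _ _ hX]
      by_cases hY : z.1 ∈ Y
      · rw [splitConfig_symm_of_mem h' _ _ hY,
          splitConfig_symm_of_notMem h _ _ (y := ⟨z.1, hY⟩) hX]
        rfl
      · rw [splitConfig_symm_of_notMem h' _ _ hY]
        rfl
  rw [h1]
  rfl

/-- `Y` is the disjoint union of `X` and `X'`. -/
structure IsPartition (X X' Y : Finset Γ) : Prop where
  left : X ⊆ Y
  right : X' ⊆ Y
  disjoint : Disjoint X X'
  cover : ∀ y ∈ Y, y ∈ X ∨ y ∈ X'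

lemma IsPartition.symm {X X' Y : Finset Γ} (h : IsPartition X X' Y) : IsPartition X' X Y :=
  ⟨h.right, h.left, h.disjoint.symm, fun y hy => (h.cover y hy).symm⟩

open Classical in
lemma isPartition_sdiff {X Y : Finset Γ} (h : X ⊆ Y) : IsPartition X (Y \ X) Y :=
  ⟨h, Finset.sdiff_subset, Finset.disjoint_sdiff, fun y hy => by
    by_cases hX : y ∈ X <;> simp [hX, hy]⟩

lemma IsPartition.injective {X X' Y : Finset Γ} (h : IsPartition X X' Y) :
    Function.Injective fun j : Config 𝓗 Y => (resConfig h.left j, resConfig h.right j) := by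
  intro i j hij
  have h1 := congrArg Prod.fst hij
  have h2 := congrArg Prod.snd hij
  funext y
  rcases h.cover y.1 y.2 with hy | hy
  · exact congrFun h1 ⟨y.1, hy⟩
  · exact congrFun h2 ⟨y.1, hy⟩

lemma IsPartition.summable {X X' Y : Finset Γ} (h : IsPartition X X' Y)
    (ψ : HilbertTensor 𝓗 X) (φ : HilbertTensor 𝓗 X') :
    ∃ S ≤ ‖ψ‖ ^ 2 * ‖φ‖ ^ 2, HasSum (fun j : Config 𝓗 Y =>
      ‖ψ (resConfig h.left j) * φ (resConfig h.right j)‖ ^ 2) S := by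
  have h1 := hasSum_norm_sq ψ
  have h2 := hasSum_norm_sq φ
  have h3 : Summable fun p : Config 𝓗 X × Config 𝓗 X' => ‖ψ p.1‖ ^ 2 * ‖φ p.2‖ ^ 2 :=
    h1.summable.mul_of_nonneg h2.summable (fun _ => by positivity) (fun _ => by positivity)
  have h4 := h1.mul h2 h3
  have h5 := h3.comp_injective (IsPartition.injective (𝓗 := 𝓗) h)
  have h6 : (fun j : Config 𝓗 Y => ‖ψ (resConfig h.left j) * φ (resConfig h.right j)‖ ^ 2)
      = (fun p : Config 𝓗 X × Config 𝓗 X' => ‖ψ p.1‖ ^ 2 * ‖φ p.2‖ ^ 2) ∘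
        fun j : Config 𝓗 Y => (resConfig h.left j, resConfig h.right j) := by
    funext j
    simp only [Function.comp_apply]
    rw [norm_mul, mul_pow]
  rw [h6]
  refine ⟨_, ?_, h5.hasSum⟩
  rw [← h4.tsum_eq]
  exact tsum_comp_le_tsum_of_inj h3 (fun _ => by positivity) (IsPartition.injective (𝓗 := 𝓗) h)

/-- The product vector `ψ ⊗ φ`. -/
def mergeFun {X X' Y : Finset Γ} (h : IsPartition X X' Y) (ψ : HilbertTensor 𝓗 X)
    (φ : HilbertTensor 𝓗 X') : HilbertTensor 𝓗 Y :=
  ⟨fun j => ψ (resConfig h.left j) * φ (resConfig h.right j), by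
    obtain ⟨S, _, hS⟩ := h.summable ψ φ
    refine memℓp_gen ?_
    simpa using hS.summable⟩

lemma norm_mergeFun_le {X X' Y : Finset Γ} (h : IsPartition X X' Y) (ψ : HilbertTensor 𝓗 X)
    (φ : HilbertTensor 𝓗 X') : ‖mergeFun h ψ φ‖ ≤ ‖ψ‖ * ‖φ‖ := by
  obtain ⟨S, hle, hS⟩ := h.summable ψ φ
  have h1 : ‖mergeFun h ψ φ‖ ^ 2 = S := (hasSum_norm_sq (mergeFun h ψ φ)).unique hS
  refine (sq_le_sq₀ (norm_nonneg _) (by positivity)).1 ?_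
  rw [mul_pow, h1]
  exact hle

/-- The product `ψ ⊗ φ` as a bounded bilinear map. -/
def merge {X X' Y : Finset Γ} (h : IsPartition X X' Y) :
    HilbertTensor 𝓗 X →L[ℂ] HilbertTensor 𝓗 X' →L[ℂ] HilbertTensor 𝓗 Y :=
  LinearMap.mkContinuous₂ (LinearMap.mk₂ ℂ (mergeFun h)
    (fun ψ ψ' φ => lp.ext (funext fun j => add_mul _ _ _))
    (fun c ψ φ => lp.ext (funext fun j => mul_assoc _ _ _))
    (fun ψ φ φ' => lp.ext (funext fun j => mul_add _ _ _))
    (fun c ψ φ => lp.ext (funext fun j => mul_left_comm _ _ _))) 1 fun ψ φ => by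
      rw [one_mul]
      exact norm_mergeFun_le h ψ φ

lemma merge_apply {X X' Y : Finset Γ} (h : IsPartition X X' Y) (ψ : HilbertTensor 𝓗 X)
    (φ : HilbertTensor 𝓗 X') (j : Config 𝓗 Y) :
    merge h ψ φ j = ψ (resConfig h.left j) * φ (resConfig h.right j) := rfl

lemma merge_symm {X X' Y : Finset Γ} (h : IsPartition X X' Y) (ψ : HilbertTensor 𝓗 X)
    (φ : HilbertTensor 𝓗 X') : merge h.symm φ ψ = merge h ψ φ := by
  ext j
  rw [merge_apply, merge_apply, mul_comm]

/-- Each slice of `ψ ⊗ φ` is a scalar multiple of `ψ`. -/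
lemma amplify_merge_left {X X' Y : Finset Γ} (h : IsPartition X X' Y) (A : LocalAlgebra 𝓗 X)
    (ψ : HilbertTensor 𝓗 X) (φ : HilbertTensor 𝓗 X') :
    amplify h.left A (merge h ψ φ) = merge h (A ψ) φ := by
  ext j
  have h1 : slice h.left (splitConfig h.left j).2 (merge h ψ φ)
      = φ (resConfig h.right j) • ψ := by
    ext i
    rw [slice_apply, merge_apply, lp.coeFn_smul, Pi.smul_apply, smul_eq_mul, mul_comm]
    refine congrArg₂ (· * ·) (congrArg (fun c => φ c) (funext fun x => ?_))
      (congrArg (fun c => ψ c) (funext fun x => ?_))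
    · have hx : x.1 ∉ X := fun hx => Finset.disjoint_left.1 h.disjoint hx x.2
      rw [resConfig, splitConfig_symm_of_notMem h.left _ _ (y := ⟨x.1, h.right x.2⟩) hx]
      rfl
    · rw [resConfig, splitConfig_symm_of_mem h.left _ _ (y := ⟨x.1, h.left x.2⟩) x.2]
  rw [amplify_apply, h1, map_smul, merge_apply, mul_comm]
  rfl

lemma amplify_merge_right {X X' Y : Finset Γ} (h : IsPartition X X' Y) (B : LocalAlgebra 𝓗 X')
    (ψ : HilbertTensor 𝓗 X) (φ : HilbertTensor 𝓗 X') :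
    amplify h.right B (merge h ψ φ) = merge h ψ (B φ) := by
  rw [← merge_symm, ← merge_symm h]
  exact amplify_merge_left h.symm B φ ψ

lemma IsPartition.prod_eq {X X' Y : Finset Γ} (h : IsPartition X X' Y) {M : Type*}
    [CommMonoid M] (f : Y → M) :
    ∏ y : Y, f y = (∏ x : X, f ⟨x.1, h.left x.2⟩) * ∏ x : X', f ⟨x.1, h.right x.2⟩ := by
  rw [← Fintype.prod_sumElim (fun x : X => f ⟨x.1, h.left x.2⟩)
    (fun x : X' => f ⟨x.1, h.right x.2⟩)]
  symm
  refine Fintype.prod_bijective (Sum.elim (fun x : X => (⟨x.1, h.left x.2⟩ : Y))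
    (fun x : X' => ⟨x.1, h.right x.2⟩)) ⟨?_, ?_⟩ _ _ ?_
  · rintro (x | x) (y | y) hxy
    · exact congrArg _ (Subtype.ext (congrArg Subtype.val hxy :))
    · have : x.1 = y.1 := congrArg Subtype.val hxy
      exact absurd (this ▸ y.2) (Finset.disjoint_left.1 h.disjoint x.2)
    · have : x.1 = y.1 := congrArg Subtype.val hxy
      exact absurd (this ▸ x.2) (Finset.disjoint_left.1 h.disjoint y.2)
    · exact congrArg _ (Subtype.ext (congrArg Subtype.val hxy :))
  · intro y
    rcases h.cover y.1 y.2 with hy | hy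
    · exact ⟨Sum.inl ⟨y.1, hy⟩, rfl⟩
    · exact ⟨Sum.inr ⟨y.1, hy⟩, rfl⟩
  · rintro (x | x) <;> rfl

lemma IsPartition.sum_eq {X X' Y : Finset Γ} (h : IsPartition X X' Y) {M : Type*}
    [AddCommMonoid M] (f : Y → M) :
    ∑ y : Y, f y = (∑ x : X, f ⟨x.1, h.left x.2⟩) + ∑ x : X', f ⟨x.1, h.right x.2⟩ :=
  h.prod_eq (M := Multiplicative M) f

/-- Restriction of a family of vectors to a smaller set. -/
def resFamily {X Y : Finset Γ} (h : X ⊆ Y) (u : (y : Y) → 𝓗 y) : (x : X) → 𝓗 x :=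
  fun x => u ⟨x.1, h x.2⟩

lemma merge_pureTensor {X X' Y : Finset Γ} (h : IsPartition X X' Y) (u : (y : Y) → 𝓗 y) :
    merge h (pureTensor (resFamily h.left u)) (pureTensor (resFamily h.right u)) = pureTensor u := by
  ext j
  exact (h.prod_eq fun y : Y => (onb (𝓗 y)).repr (u y) (j y)).symm

lemma ext_pureTensor {X : Finset Γ} {S T : LocalAlgebra 𝓗 X}
    (h : ∀ u, S (pureTensor u) = T (pureTensor u)) : S = T := by
  refine ContinuousLinearMap.ext_on
    (Submodule.dense_iff_topologicalClosure_eq_top.2 (span_pureTensor_dense X)) ?_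
  rintro _ ⟨u, rfl⟩
  exact h u

lemma ext_merge {X X' Y : Finset Γ} (h : IsPartition X X' Y) {S T : LocalAlgebra 𝓗 Y}
    (hST : ∀ ψ φ, S (merge h ψ φ) = T (merge h ψ φ)) : S = T :=
  ext_pureTensor fun u => by rw [← merge_pureTensor h]; exact hST _ _

lemma IsPartition.amplify_commute {X X' Y : Finset Γ} (h : IsPartition X X' Y)
    (A : LocalAlgebra 𝓗 X) (B : LocalAlgebra 𝓗 X') :
    amplify h.left A * amplify h.right B = amplify h.right B * amplify h.left A := by
  refine ext_merge h fun ψ φ => ?_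
  rw [mul_apply_eq_comp, mul_apply_eq_comp, amplify_merge_left, amplify_merge_right,
    amplify_merge_left, amplify_merge_right]

/-- Observables over disjoint sets commute. -/
lemma amplify_commute_of_disjoint {X Z Y : Finset Γ} (hX : X ⊆ Y) (hZ : Z ⊆ Y)
    (hd : Disjoint X Z) (A : LocalAlgebra 𝓗 X) (B : LocalAlgebra 𝓗 Z) :
    amplify hX A * amplify hZ B = amplify hZ B * amplify hX A := by
  classical
  -- Enlarging `Z` to the full complement of `X` reduces the claim to a partition, where commutation
  -- is visible on product vectors.
  have h1 : Z ⊆ Y \ X := fun z hz =>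
    Finset.mem_sdiff.2 ⟨hZ hz, fun hx => Finset.disjoint_left.1 hd hx hz⟩
  have h := isPartition_sdiff hX
  have := h.amplify_commute A (amplify h1 B)
  rwa [amplify_amplify] at this

/-! ### The product map is multilinear -/

lemma norm_pureTensor {X : Finset Γ} (u : (x : X) → 𝓗 x) : ‖pureTensor u‖ = ∏ x, ‖u x‖ := by
  have h := inner_pureTensor u u
  simp only [inner_self_eq_norm_sq_to_K, Complex.coe_algebraMap] at h
  have h2 : ‖pureTensor u‖ ^ 2 = (∏ x, ‖u x‖) ^ 2 := by
    rw [← Finset.prod_pow]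
    exact_mod_cast h
  exact (sq_eq_sq₀ (norm_nonneg _) (Finset.prod_nonneg fun _ _ => norm_nonneg _)).1 h2

/-- The coordinates of product vectors, as multilinear forms. -/
def pureCoord (X : Finset Γ) (j : Config 𝓗 X) :
    MultilinearMap ℂ (fun x : X => 𝓗 x) ℂ :=
  (MultilinearMap.mkPiAlgebra ℂ X ℂ).compLinearMap fun x =>
    ({ toFun := fun u => (onb (𝓗 x)).repr u (j x)
       map_add' := fun u v => by rw [map_add]; rfl
       map_smul' := fun c u => by rw [map_smul]; rfl } : 𝓗 x →ₗ[ℂ] ℂ)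

lemma pureTensor_apply {X : Finset Γ} (u : (x : X) → 𝓗 x) (j : Config 𝓗 X) :
    pureTensor u j = pureCoord X j u := rfl

variable (𝓗) in
/-- The map `u ↦ ⨂ u_x` as a continuous multilinear map. -/
def pureTensorL (X : Finset Γ) :
    ContinuousMultilinearMap ℂ (fun x : X => 𝓗 x) (HilbertTensor 𝓗 X) :=
  MultilinearMap.mkContinuous
    { toFun := pureTensor
      map_update_add' := fun u x a b => by
        ext j
        rw [lp.coeFn_add, Pi.add_apply]
        simp only [pureTensor_apply]
        exact (pureCoord X j).map_update_add u x a b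
      map_update_smul' := fun u x c a => by
        ext j
        rw [lp.coeFn_smul, Pi.smul_apply]
        simp only [pureTensor_apply]
        exact (pureCoord X j).map_update_smul u x c a } 1 fun u => by
      rw [one_mul]
      exact (norm_pureTensor u).le

lemma pureTensorL_apply {X : Finset Γ} (u : (x : X) → 𝓗 x) : pureTensorL 𝓗 X u = pureTensor u := rfl

lemma continuous_pureTensor (X : Finset Γ) :
    Continuous (pureTensor : ((x : X) → 𝓗 x) → HilbertTensor 𝓗 X) :=
  (pureTensorL 𝓗 X).cont

open Classical in
lemma hasDerivAt_pureTensor {X : Finset Γ} {u : ℝ → (x : X) → 𝓗 x} {u' : (x : X) → 𝓗 x} {t : ℝ}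
    (hu : ∀ x, HasDerivAt (fun t => u t x) (u' x) t) :
    HasDerivAt (fun t => pureTensor (u t))
      (∑ x, pureTensor (Function.update (u t) x (u' x))) t := by
  have h1 : HasDerivAt u u' t := hasDerivAt_pi.2 hu
  have h2 := (((pureTensorL 𝓗 X).hasFDerivAt (u t)).restrictScalars ℝ).comp_hasDerivAt t h1
  convert! h2 using 1
  change _ = (pureTensorL 𝓗 X).linearDeriv (u t) u'
  rw [ContinuousMultilinearMap.linearDeriv_apply]
  refine Finset.sum_congr rfl fun x _ => ?_
  rw [pureTensorL_apply]

/-! ### Operators at a single site -/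

variable (𝓗) in
lemma orthonormal_site (x : Γ) :
    Orthonormal ℂ fun i : Config 𝓗 {x} => onb (𝓗 x) (i ⟨x, Finset.mem_singleton_self x⟩) := by
  refine (onb (𝓗 x)).orthonormal.comp
    (fun i : Config 𝓗 {x} => i ⟨x, Finset.mem_singleton_self x⟩) fun i j hij => ?_
  funext ⟨y, hy⟩
  obtain rfl := Finset.mem_singleton.1 hy
  exact hij

variable (𝓗) in
/-- The orthonormal basis of `𝓗 x` labelled by the configurations over `{x}`. -/
def siteBasis (x : Γ) : HilbertBasis (Config 𝓗 {x}) ℂ (𝓗 x) :=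
  HilbertBasis.mk (orthonormal_site 𝓗 x) (by
    rw [top_le_iff, ← (onb (𝓗 x)).dense_span]
    congr 2
    ext ψ
    constructor
    · rintro ⟨i, rfl⟩
      exact ⟨_, rfl⟩
    · rintro ⟨i, rfl⟩
      refine ⟨(Equiv.piUnique fun y : ({x} : Finset Γ) => onbIndex (𝓗 y)).symm i, ?_⟩
      exact congrArg (onb (𝓗 x)) ((Equiv.piUnique
        fun y : ({x} : Finset Γ) => onbIndex (𝓗 y)).apply_symm_apply i))

lemma siteBasis_repr {x : Γ} (u : (y : ({x} : Finset Γ)) → 𝓗 y) :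
    (siteBasis 𝓗 x).repr (u ⟨x, Finset.mem_singleton_self x⟩) = pureTensor u := by
  ext i
  rw [HilbertBasis.repr_apply_apply, siteBasis, HilbertBasis.coe_mk,
    ← HilbertBasis.repr_apply_apply]
  change _ = ∏ y : ({x} : Finset Γ), (onb (𝓗 y)).repr (u y) (i y)
  rw [Fintype.prod_unique]
  rfl

/-- An operator on `𝓗 x` as an observable over `{x}`. -/
def siteOp (x : Γ) (T : 𝓗 x →L[ℂ] 𝓗 x) : LocalAlgebra 𝓗 {x} :=
  ((siteBasis 𝓗 x).repr : 𝓗 x →L[ℂ] HilbertTensor 𝓗 {x}) ∘L T ∘L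
    ((siteBasis 𝓗 x).repr.symm : HilbertTensor 𝓗 {x} →L[ℂ] 𝓗 x)

lemma siteOp_repr (x : Γ) (T : 𝓗 x →L[ℂ] 𝓗 x) (ψ : 𝓗 x) :
    siteOp x T ((siteBasis 𝓗 x).repr ψ) = (siteBasis 𝓗 x).repr (T ψ) := by
  simp [siteOp]

lemma norm_siteOp_le (x : Γ) (T : 𝓗 x →L[ℂ] 𝓗 x) : ‖siteOp x T‖ ≤ ‖T‖ := by
  refine ContinuousLinearMap.opNorm_le_bound _ (norm_nonneg _) fun ψ => ?_
  obtain ⟨φ, rfl⟩ := (siteBasis 𝓗 x).repr.surjective ψ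
  rw [siteOp_repr, LinearIsometryEquiv.norm_map, LinearIsometryEquiv.norm_map]
  exact T.le_opNorm φ

open Classical in
lemma amplify_siteOp_pureTensor {Λ : Finset Γ} (x : Λ) (T : 𝓗 x →L[ℂ] 𝓗 x)
    (u : (y : Λ) → 𝓗 y) :
    amplify (Finset.singleton_subset_iff.2 x.2) (siteOp x.1 T) (pureTensor u)
      = pureTensor (Function.update u x (T (u x))) := by
  have h := isPartition_sdiff (Finset.singleton_subset_iff.2 x.2)
  have e1 : T (resFamily h.left u ⟨x.1, Finset.mem_singleton_self x.1⟩)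
      = resFamily h.left (Function.update u x (T (u x))) ⟨x.1, Finset.mem_singleton_self x.1⟩ :=
    (Function.update_self (f := u) x (T (u x))).symm
  have e2 : resFamily h.right (Function.update u x (T (u x))) = resFamily h.right u := by
    funext y
    have hy : (⟨y.1, h.right y.2⟩ : Λ) ≠ x := fun hyx =>
      (Finset.mem_sdiff.1 y.2).2 (Finset.mem_singleton.2 (congrArg Subtype.val hyx))
    exact Function.update_of_ne hy _ _
  rw [← merge_pureTensor h, ← merge_pureTensor h (Function.update u x (T (u x))),
    amplify_merge_left, ← siteBasis_repr, siteOp_repr, e1, siteBasis_repr, e2]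

end TensorProducts

/-! ## The free dynamics and decoupled dynamics -/

section FreeDynamics

variable {Γ : Type u} {𝓗 : Γ → Type v} [∀ x, NormedAddCommGroup (𝓗 x)]
  [∀ x, InnerProductSpace ℂ (𝓗 x)] [∀ x, CompleteSpace (𝓗 x)]

open Classical in
/-- The tensor product of contractions. -/
lemma exists_map_pureTensor {Λ : Finset Γ} (T : (x : Λ) → 𝓗 x →L[ℂ] 𝓗 x) (hT : ∀ x, ‖T x‖ ≤ 1) :
    ∃ W : LocalAlgebra 𝓗 Λ, ‖W‖ ≤ 1 ∧
      ∀ u, W (pureTensor u) = pureTensor fun x => T x (u x) := by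
  -- The operator is built one site at a time; `s` records the sites already acted upon.
  have key : ∀ s : Finset Λ, ∃ W : LocalAlgebra 𝓗 Λ, ‖W‖ ≤ 1 ∧
      ∀ u, W (pureTensor u) = pureTensor fun x => if x ∈ s then T x (u x) else u x := by
    intro s
    induction s using Finset.induction_on with
    | empty => exact ⟨1, ContinuousLinearMap.norm_id_le, fun u => by simp⟩
    | insert a s ha ih =>
      obtain ⟨W, hW, hWu⟩ := ih
      refine ⟨amplify (Finset.singleton_subset_iff.2 a.2) (siteOp a.1 (T a)) * W, ?_, fun u => ?_⟩
      · refine (norm_mul_le _ _).trans (mul_le_one₀ ?_ (norm_nonneg _) hW)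
        exact (norm_amplify_le _ _).trans ((norm_siteOp_le _ _).trans (hT a))
      · rw [mul_apply_eq_comp, hWu, amplify_siteOp_pureTensor]
        congr 1
        funext x
        by_cases hx : x = a
        · subst hx
          simp [ha]
        · rw [Function.update_of_ne hx]
          simp [hx]
  obtain ⟨W, hW, hWu⟩ := key Finset.univ
  exact ⟨W, hW, fun u => by simpa using hWu u⟩

/-- A contraction whose inverse is a contraction is isometric, and the vectors with continuous orbit
form a closed subspace, so product vectors suffice. -/
lemma isUnitaryGroup_of_pureTensor {Λ : Finset Γ} {W : ℝ → LocalAlgebra 𝓗 Λ} (h0 : W 0 = 1)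
    (hadd : ∀ s t, W (s + t) = W s * W t) (hn : ∀ t, ‖W t‖ ≤ 1)
    (hc : ∀ u, Continuous fun t => W t (pureTensor u)) : IsUnitaryGroup W := by
  have hle : ∀ t ψ, ‖W t ψ‖ ≤ ‖ψ‖ := fun t ψ =>
    ((W t).le_of_opNorm_le (hn t) ψ).trans (one_mul _).le
  refine ⟨h0, hadd, fun t ψ => le_antisymm (hle t ψ) ?_, fun ψ => ?_⟩
  · have h1 : W (-t) (W t ψ) = ψ := by
      rw [← mul_apply_eq_comp, ← hadd, neg_add_cancel, h0]
      rfl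
    calc ‖ψ‖ = ‖W (-t) (W t ψ)‖ := by rw [h1]
      _ ≤ ‖W t ψ‖ := hle _ _
  · have hd := Submodule.dense_iff_topologicalClosure_eq_top.2 (span_pureTensor_dense (𝓗 := 𝓗) Λ)
    refine ((isClosed_continuous_orbit hn).closure_subset_iff.2 fun x hx => ?_) (hd ψ)
    induction hx using Submodule.span_induction with
    | mem v hv =>
      obtain ⟨u, rfl⟩ := hv
      exact hc u
    | zero => simpa using continuous_const
    | add a b _ _ ha hb =>
      change Continuous fun t => W t (a + b)
      simp only [map_add]
      exact Continuous.add ha hb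
    | smul z a _ ha =>
      change Continuous fun t => W t (z • a)
      simp only [map_smul]
      exact Continuous.const_smul ha z

lemma exists_freeGroup {h : (x : Γ) → 𝓗 x →ₗ.[ℂ] 𝓗 x} (hh : ∀ x, IsSelfAdjoint (h x))
    (Λ : Finset Γ) : ∃ W : ℝ → LocalAlgebra 𝓗 Λ, IsUnitaryGroup W ∧
      ∀ t u, W t (pureTensor u) = pureTensor fun x : Λ => unitaryGroup (h x) t (u x) := by
  have hU : ∀ x, IsUnitaryGroup (unitaryGroup (h x)) := fun x =>
    (isUnitaryGroupOf_iff.1 (isUnitaryGroupOf_unitaryGroup (hh x))).1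
  choose W hn hW using fun t => exists_map_pureTensor
    (fun x : Λ => unitaryGroup (h x) t) fun x => (hU x).norm_le_one t
  refine ⟨W, isUnitaryGroup_of_pureTensor ?_ (fun s t => ?_) hn fun u => ?_, hW⟩
  · refine ext_pureTensor fun u => ?_
    rw [hW]
    simp only [(hU _).apply_zero]
    rfl
  · refine ext_pureTensor fun u => ?_
    rw [mul_apply_eq_comp, hW, hW, hW]
    simp only [(hU _).apply_add]
  · simp only [hW]
    exact (continuous_pureTensor Λ).comp (continuous_pi fun x => (hU x).continuous (u x))

open Classical in
/-- The graph of the free Hamiltonian restricted to product vectors. -/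
def freeCore (h : (x : Γ) → 𝓗 x →ₗ.[ℂ] 𝓗 x) (Λ : Finset Γ) :
    Set (HilbertTensor 𝓗 Λ × HilbertTensor 𝓗 Λ) :=
  {p | ∃ u v : (x : Λ) → 𝓗 x, (∀ x : Λ, (u x, v x) ∈ (h x).graph) ∧
    p = (pureTensor u, ∑ x : Λ, pureTensor (Function.update u x (v x)))}

open Classical in
lemma freeHamiltonian_eq (h : (x : Γ) → 𝓗 x →ₗ.[ℂ] 𝓗 x) (Λ : Finset Γ) :
    freeHamiltonian h Λ
      = (Submodule.span ℂ (freeCore h Λ)).topologicalClosure.toLinearPMap := by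
  have : freeCore h Λ = Set.range fun u : (x : Λ) → (h x).domain =>
      (pureTensor (fun x => (u x : 𝓗 x)),
        ∑ x : Λ, pureTensor (Function.update (fun y : Λ => (u y : 𝓗 y)) x (h x (u x)))) := by
    ext p
    constructor
    · rintro ⟨u, v, huv, rfl⟩
      choose w hw1 hw2 using fun x => (LinearPMap.mem_graph_iff _).1 (huv x)
      refine ⟨w, ?_⟩
      simp only at hw1 hw2
      simp only [hw1, hw2]
    · rintro ⟨u, rfl⟩
      exact ⟨fun x => u x, fun x => h x (u x), fun x => (h x).mem_graph (u x), rfl⟩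
  rw [this]
  rfl

variable {h : (x : Γ) → 𝓗 x →ₗ.[ℂ] 𝓗 x}

lemma dense_span_freeCore (hh : ∀ x, IsSelfAdjoint (h x)) (Λ : Finset Γ) :
    Dense (Submodule.span ℂ (Prod.fst '' freeCore h Λ) : Set (HilbertTensor 𝓗 Λ)) := by
  rw [Submodule.dense_iff_topologicalClosure_eq_top, eq_top_iff, ← span_pureTensor_dense (𝓗 := 𝓗) Λ]
  refine Submodule.topologicalClosure_minimal _ (Submodule.span_le.2 ?_)
    (Submodule.isClosed_topologicalClosure _)
  rintro _ ⟨u, rfl⟩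
  have hd : Dense (Set.univ.pi fun x : Λ => ((h x).domain : Set (𝓗 x))) :=
    dense_pi _ fun x _ => (hh x).dense_domain
  refine map_mem_closure (continuous_pureTensor Λ) (hd u) fun w hw => Submodule.subset_span ?_
  exact ⟨_, ⟨w, fun x => h x ⟨w x, hw x trivial⟩,
    fun x => (h x).mem_graph ⟨w x, hw x trivial⟩, rfl⟩, rfl⟩

lemma freeCore_subset_generator (hh : ∀ x, IsSelfAdjoint (h x)) {Λ : Finset Γ}
    {W : ℝ → LocalAlgebra 𝓗 Λ}
    (hW : ∀ t u, W t (pureTensor u) = pureTensor fun x : Λ => unitaryGroup (h x) t (u x)) :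
    freeCore h Λ ⊆ generator W := by
  classical
  rintro _ ⟨u, v, huv, rfl⟩
  refine mem_generator.2 ?_
  simp only [hW]
  have hU := fun x => isUnitaryGroupOf_iff.1 (isUnitaryGroupOf_unitaryGroup (hh x))
  convert! hasDerivAt_pureTensor (u' := fun x : Λ => Complex.I • v x)
    (fun x : Λ => mem_generator.1 ((hU x).2 (huv x))) using 1
  rw [Finset.smul_sum]
  refine Finset.sum_congr rfl fun x _ => ?_
  simp only [(hU _).1.apply_zero]
  have := (pureTensorL 𝓗 Λ).map_update_smul u x Complex.I (v x)
  simp only [pureTensorL_apply] at this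
  convert this.symm

/-- The product group moves each on-site pair inside its own graph. This invariance is what the core
criterion requires. -/
lemma freeCore_invariant (hh : ∀ x, IsSelfAdjoint (h x)) {Λ : Finset Γ}
    {W : ℝ → LocalAlgebra 𝓗 Λ}
    (hW : ∀ t u, W t (pureTensor u) = pureTensor fun x : Λ => unitaryGroup (h x) t (u x)) :
    ∀ p ∈ freeCore h Λ, ∀ t, (W t p.1, W t p.2) ∈ freeCore h Λ := by
  classical
  rintro _ ⟨u, v, huv, rfl⟩ t
  refine ⟨fun x => unitaryGroup (h x) t (u x), fun x => unitaryGroup (h x) t (v x), fun x => ?_, ?_⟩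
  · have hU := isUnitaryGroupOf_unitaryGroup (hh x)
    have h1 := hU.generator_eq (hh x)
    rw [← h1]
    exact (isUnitaryGroupOf_iff.1 hU).1.map_mem_generator (h1 ▸ huv x) t
  · refine Prod.ext (hW _ _) ?_
    change W t _ = _
    rw [map_sum]
    refine Finset.sum_congr rfl fun x _ => ?_
    rw [hW]
    congr 1
    funext y
    exact Function.apply_update (fun (x : Λ) a => unitaryGroup (h x) t a) u x (v x) y

/-- Product vectors with factors in the on-site domains span a dense subspace invariant under the
product group, hence a core of its generator. The closure is thus that generator, which is
single-valued and self-adjoint. -/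
lemma freeHamiltonian_graph (hh : ∀ x, IsSelfAdjoint (h x)) (Λ : Finset Γ) :
    (freeHamiltonian h Λ).graph = (Submodule.span ℂ (freeCore h Λ)).topologicalClosure ∧
      IsSelfAdjoint (freeHamiltonian h Λ) := by
  obtain ⟨W, hU, hW⟩ := exists_freeGroup hh Λ
  have hd := dense_span_freeCore hh Λ
  have h1 := hU.closure_eq_generator (freeCore_subset_generator hh hW)
    (freeCore_invariant hh hW) hd
  have h2 : (freeHamiltonian h Λ).graph
      = (Submodule.span ℂ (freeCore h Λ)).topologicalClosure := by
    rw [freeHamiltonian_eq]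
    refine Submodule.toLinearPMap_graph_eq _ ?_
    rintro ⟨x, y⟩ hx hx0
    rw [h1] at hx
    simp only at hx0
    subst hx0
    exact eq_zero_of_mem_generator hx
  refine ⟨h2, isSelfAdjoint_of_graph_eq_generator hU ?_ (h2.trans h1)⟩
  refine hd.mono ?_
  rw [SetLike.coe_subset_coe, Submodule.span_le, ← LinearPMap.graph_map_fst_eq_domain, h2]
  rintro _ ⟨p, hp, rfl⟩
  exact ⟨p, Submodule.le_topologicalClosure _ (Submodule.subset_span hp), rfl⟩

lemma isSelfAdjoint_freeHamiltonian (hh : ∀ x, IsSelfAdjoint (h x)) (Λ : Finset Γ) :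
    IsSelfAdjoint (freeHamiltonian h Λ) := (freeHamiltonian_graph hh Λ).2

lemma isSelfAdjoint_potential (Φ : Interaction 𝓗) (Λ : Finset Γ) :
    IsSelfAdjoint (Φ.potential Λ) :=
  isSelfAdjoint_sum _ fun _ _ => isSelfAdjoint_amplify _ (Φ.selfAdjoint _)

lemma isSelfAdjoint_hamiltonian (hh : ∀ x, IsSelfAdjoint (h x)) (Φ : Interaction 𝓗)
    (Λ : Finset Γ) : IsSelfAdjoint (hamiltonian h Φ Λ) :=
  isSelfAdjoint_add_toPMap (isSelfAdjoint_freeHamiltonian hh Λ) (isSelfAdjoint_potential Φ Λ)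

/-- The free Hamiltonian with a bounded perturbation. -/
def perturbed (h : (x : Γ) → 𝓗 x →ₗ.[ℂ] 𝓗 x) {Λ : Finset Γ} (P : LocalAlgebra 𝓗 Λ) :
    HilbertTensor 𝓗 Λ →ₗ.[ℂ] HilbertTensor 𝓗 Λ :=
  freeHamiltonian h Λ + P.toLinearMap.toPMap ⊤

lemma isSelfAdjoint_perturbed (hh : ∀ x, IsSelfAdjoint (h x)) {Λ : Finset Γ}
    {P : LocalAlgebra 𝓗 Λ} (hP : IsSelfAdjoint P) : IsSelfAdjoint (perturbed h P) :=
  isSelfAdjoint_add_toPMap (isSelfAdjoint_freeHamiltonian hh Λ) hP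

lemma mem_generator_perturbed (hh : ∀ x, IsSelfAdjoint (h x)) {Λ : Finset Γ}
    {P : LocalAlgebra 𝓗 Λ} (hP : IsSelfAdjoint P) {p} (hp : p ∈ freeCore h Λ) :
    (p.1, p.2 + P p.1) ∈ generator (unitaryGroup (perturbed h P)) := by
  have hs := isSelfAdjoint_perturbed hh hP
  rw [(isUnitaryGroupOf_unitaryGroup hs).generator_eq hs, perturbed, mem_graph_add_toPMap,
    add_sub_cancel_right, (freeHamiltonian_graph hh Λ).1]
  exact Submodule.le_topologicalClosure _ (Submodule.subset_span hp)

/-- A unitary group whose generator extends the perturbed free Hamiltonian on product vectors is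
the group of the perturbed free Hamiltonian. -/
lemma isUnitaryGroupOf_perturbed (hh : ∀ x, IsSelfAdjoint (h x)) {Λ : Finset Γ}
    {P : LocalAlgebra 𝓗 Λ} {V : ℝ → LocalAlgebra 𝓗 Λ} (hV : IsUnitaryGroup V)
    (hc : ∀ p ∈ freeCore h Λ, (p.1, p.2 + P p.1) ∈ generator V) :
    IsUnitaryGroupOf (perturbed h P) V := by
  refine isUnitaryGroupOf_iff.2 ⟨hV, ?_⟩
  have hd : Dense ((generator V).map (LinearMap.fst ℂ _ _) : Set (HilbertTensor 𝓗 Λ)) := by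
    refine (dense_span_freeCore hh Λ).mono ?_
    rw [SetLike.coe_subset_coe, Submodule.span_le]
    rintro _ ⟨p, hp, rfl⟩
    exact ⟨_, hc p hp, rfl⟩
  -- The shear that adds `P` to a graph is continuous and the generator is closed, so the inclusion
  -- spreads from the core to its closure.
  let L : HilbertTensor 𝓗 Λ × HilbertTensor 𝓗 Λ →L[ℂ] HilbertTensor 𝓗 Λ × HilbertTensor 𝓗 Λ :=
    (ContinuousLinearMap.fst ℂ _ _).prod
      (ContinuousLinearMap.snd ℂ _ _ + P ∘L ContinuousLinearMap.fst ℂ _ _)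
  have hle : (Submodule.span ℂ (freeCore h Λ)).topologicalClosure
      ≤ (generator V).comap (L : _ →ₗ[ℂ] _) := by
    refine Submodule.topologicalClosure_minimal _ (Submodule.span_le.2 fun p hp => hc p hp) ?_
    exact (hV.isClosed_generator hd).preimage L.continuous
  rintro ⟨x, y⟩ hp
  rw [perturbed, mem_graph_add_toPMap, (freeHamiltonian_graph hh Λ).1] at hp
  have h1 : (x, y - P x + P x) ∈ generator V := hle hp
  rwa [sub_add_cancel] at h1

lemma hasDerivAt_clm₂ {E₁ : Type*} {E₂ : Type*} {E₃ : Type*} [NormedAddCommGroup E₁]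
    [NormedSpace ℂ E₁] [NormedAddCommGroup E₂] [NormedSpace ℂ E₂] [NormedAddCommGroup E₃]
    [NormedSpace ℂ E₃] (B : E₁ →L[ℂ] E₂ →L[ℂ] E₃) {f : ℝ → E₁} {g : ℝ → E₂} {f' : E₁} {g' : E₂}
    {t : ℝ} (hf : HasDerivAt f f' t) (hg : HasDerivAt g g' t) :
    HasDerivAt (fun t => B (f t) (g t)) (B f' (g t) + B (f t) g') t := by
  have h1 := (ContinuousLinearMap.bilinearRestrictScalars ℝ B).hasFDerivAt_of_bilinear
    hf.hasFDerivAt hg.hasFDerivAt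
  convert! h1.hasDerivAt using 1
  simp [add_comm]

lemma merge_mem_generator {Z Z' Λ : Finset Γ} (hp : IsPartition Z Z' Λ)
    {U₁ : ℝ → LocalAlgebra 𝓗 Z} {U₂ : ℝ → LocalAlgebra 𝓗 Z'} (h₁ : IsUnitaryGroup U₁)
    (h₂ : IsUnitaryGroup U₂) {p q} (hp₁ : p ∈ generator U₁) (hq : q ∈ generator U₂) :
    (merge hp p.1 q.1, merge hp p.2 q.1 + merge hp p.1 q.2)
      ∈ generator fun t => amplify hp.left (U₁ t) * amplify hp.right (U₂ t) := by
  rw [mem_generator]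
  simp only [mul_apply_eq_comp, amplify_merge_left, amplify_merge_right]
  have := hasDerivAt_clm₂ (merge (𝓗 := 𝓗) hp) (mem_generator.1 hp₁) (mem_generator.1 hq)
  simpa only [h₁.apply_zero, h₂.apply_zero, map_smul, smul_add,
    smul_apply] using this

/-- The sum of on-site operators over `Λ` splits into its sums over `Z` and `Z'`, each acting on one
tensor factor. -/
lemma freeCore_merge {Z Z' Λ : Finset Γ} (hp : IsPartition Z Z' Λ) {p} (hpΛ : p ∈ freeCore h Λ) :
    ∃ q ∈ freeCore h Z, ∃ r ∈ freeCore h Z',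
      p = (merge hp q.1 r.1, merge hp q.2 r.1 + merge hp q.1 r.2) := by
  classical
  obtain ⟨u, v, huv, rfl⟩ := hpΛ
  refine ⟨_, ⟨resFamily hp.left u, resFamily hp.left v, fun x => huv ⟨x.1, hp.left x.2⟩, rfl⟩,
    _, ⟨resFamily hp.right u, resFamily hp.right v, fun x => huv ⟨x.1, hp.right x.2⟩, rfl⟩, ?_⟩
  refine Prod.ext (merge_pureTensor hp u).symm ?_
  have e1 : ∀ {X : Finset Γ} (hX : X ⊆ Λ) (x : X) (a : 𝓗 x),
      resFamily hX (Function.update u ⟨x.1, hX x.2⟩ a) = Function.update (resFamily hX u) x a := by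
    intro X hX x a
    funext y
    by_cases hy : y = x
    · subst hy
      exact (Function.update_self (f := u) _ _).trans
        (Function.update_self (f := resFamily hX u) _ _).symm
    · rw [Function.update_of_ne hy]
      exact Function.update_of_ne (a := (⟨y.1, hX y.2⟩ : Λ))
        (fun e => hy (Subtype.ext (congrArg Subtype.val e :))) _ _
  have e2 : ∀ {X : Finset Γ} (hX : X ⊆ Λ) (y : Λ) (_ : y.1 ∉ X) (a : 𝓗 y),
      resFamily hX (Function.update u y a) = resFamily hX u := by
    intro X hX y hy a
    funext x
    refine Function.update_of_ne (a := (⟨x.1, hX x.2⟩ : Λ)) (fun e => hy ?_) _ _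
    rw [← e]
    exact x.2
  simp only [map_sum, sum_apply]
  rw [hp.sum_eq]
  congr 1
  · refine Finset.sum_congr rfl fun x _ => ?_
    rw [← merge_pureTensor hp, e1, e2 hp.right _ (Finset.disjoint_left.1 hp.disjoint x.2)]
    rfl
  · refine Finset.sum_congr rfl fun x _ => ?_
    rw [← merge_pureTensor hp, e1, e2 hp.left _ (Finset.disjoint_right.1 hp.disjoint x.2)]
    rfl

/-- The dynamics without coupling between `Z` and `Z'` factorizes. -/
lemma unitaryGroup_perturbed_add (hh : ∀ x, IsSelfAdjoint (h x)) {Z Z' Λ : Finset Γ}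
    (hp : IsPartition Z Z' Λ) {P : LocalAlgebra 𝓗 Z} {P' : LocalAlgebra 𝓗 Z'}
    (hP : IsSelfAdjoint P) (hP' : IsSelfAdjoint P') (t : ℝ) :
    unitaryGroup (perturbed h (amplify hp.left P + amplify hp.right P')) t
      = amplify hp.left (unitaryGroup (perturbed h P) t)
        * amplify hp.right (unitaryGroup (perturbed h P') t) := by
  have h₁ := (isUnitaryGroupOf_iff.1
    (isUnitaryGroupOf_unitaryGroup (isSelfAdjoint_perturbed hh hP))).1
  have h₂ := (isUnitaryGroupOf_iff.1
    (isUnitaryGroupOf_unitaryGroup (isSelfAdjoint_perturbed hh hP'))).1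
  have hs := isSelfAdjoint_perturbed hh
    ((isSelfAdjoint_amplify hp.left hP).add (isSelfAdjoint_amplify hp.right hP'))
  have hV : IsUnitaryGroup fun t => amplify hp.left (unitaryGroup (perturbed h P) t)
      * amplify hp.right (unitaryGroup (perturbed h P') t) := by
    refine isUnitaryGroup_of_pureTensor ?_ (fun s t => ?_) (fun t => ?_) fun u => ?_
    · rw [h₁.zero, h₂.zero, amplify_one, amplify_one, one_mul]
    · rw [h₁.add, h₂.add, amplify_mul, amplify_mul, mul_assoc, mul_assoc]
      congr 1
      rw [← mul_assoc, ← mul_assoc, hp.amplify_commute]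
    · refine (norm_mul_le _ _).trans (mul_le_one₀ ?_ (norm_nonneg _) ?_)
      · exact (norm_amplify_le _ _).trans (h₁.norm_le_one t)
      · exact (norm_amplify_le _ _).trans (h₂.norm_le_one t)
    · simp only [← merge_pureTensor hp u, mul_apply_eq_comp, amplify_merge_left,
        amplify_merge_right]
      exact ((merge hp).continuous.comp (h₁.continuous _)).clm_apply (h₂.continuous _)
  -- The product of the two groups is a unitary group, so by uniqueness only the generators on the
  -- core need comparing.
  refine congrFun ((isUnitaryGroupOf_unitaryGroup hs).unique hs
    (isUnitaryGroupOf_perturbed hh hV fun p hpΛ => ?_)) t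
  obtain ⟨q, hq, r, hr, rfl⟩ := freeCore_merge hp hpΛ
  have := merge_mem_generator hp h₁ h₂ (mem_generator_perturbed hh hP hq)
    (mem_generator_perturbed hh hP' hr)
  convert this using 2
  simp only [add_apply, map_add, amplify_merge_left, amplify_merge_right]
  abel

/-- Without coupling between `Z` and its complement, observables over `Z` stay over `Z`. -/
lemma heisenberg_perturbed_amplify (hh : ∀ x, IsSelfAdjoint (h x)) {Z Z' Λ : Finset Γ}
    (hp : IsPartition Z Z' Λ) {P : LocalAlgebra 𝓗 Z} {P' : LocalAlgebra 𝓗 Z'}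
    (hP : IsSelfAdjoint P) (hP' : IsSelfAdjoint P') (t : ℝ) (A : LocalAlgebra 𝓗 Z) :
    heisenberg (perturbed h (amplify hp.left P + amplify hp.right P')) t (amplify hp.left A)
      = amplify hp.left (heisenberg (perturbed h P) t A) := by
  have h₂ := (isUnitaryGroupOf_iff.1
    (isUnitaryGroupOf_unitaryGroup (isSelfAdjoint_perturbed hh hP'))).1
  rw [heisenberg, heisenberg, unitaryGroup_perturbed_add hh hp hP hP',
    unitaryGroup_perturbed_add hh hp hP hP', amplify_mul, amplify_mul,
    hp.amplify_commute _ (unitaryGroup (perturbed h P') (-t)), mul_assoc, mul_assoc, mul_assoc,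
    ← mul_assoc (amplify hp.left A), hp.amplify_commute A, mul_assoc,
    ← mul_assoc (amplify hp.right _) (amplify hp.right _), ← amplify_mul, h₂.mul_neg, amplify_one,
    one_mul]

end FreeDynamics

/-! ## Perturbation of the dynamics -/

section Duhamel

open Filter

variable {E : Type v} [NormedAddCommGroup E] [InnerProductSpace ℂ E]

/-- A product rule for a merely strongly continuous group: the moving difference quotient is
controlled because `U r` is isometric, and `g s` must lie in the domain for the other term. -/
lemma IsUnitaryGroup.hasDerivAt_apply {U : ℝ → E →L[ℂ] E} (hU : IsUnitaryGroup U) {g : ℝ → E}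
    {g' y : E} {s : ℝ} (hg : HasDerivAt g g' s) (hy : (g s, y) ∈ generator U) :
    HasDerivAt (fun r => U r (g r)) (U s g' + Complex.I • U s y) s := by
  have h1 := hasDerivAt_iff_tendsto_slope.1 hg
  have h2 := hasDerivAt_iff_tendsto_slope.1 (hU.hasDerivAt hy s)
  rw [hasDerivAt_iff_tendsto_slope]
  have h3 : Tendsto (fun r => U r (slope g s r)) (𝓝[≠] s) (𝓝 (U s g')) := by
    have h4 : Tendsto (fun r => U r g') (𝓝[≠] s) (𝓝 (U s g')) :=
      ((hU.continuous g').tendsto s).mono_left nhdsWithin_le_nhds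
    have h5 : Tendsto (fun r => U r (slope g s r - g')) (𝓝[≠] s) (𝓝 0) := by
      rw [tendsto_zero_iff_norm_tendsto_zero]
      simp only [hU.norm_map]
      exact tendsto_iff_norm_sub_tendsto_zero.1 h1
    have h6 := h5.add h4
    rw [zero_add] at h6
    refine h6.congr fun r => ?_
    rw [map_sub, sub_add_cancel]
  refine (h3.add h2).congr fun r => ?_
  simp only [slope_def_module, ContinuousLinearMap.map_smul_of_tower, map_sub]
  rw [← smul_add, sub_add_sub_cancel]

lemma norm_sub_le_of_norm_deriv_le {f f' : ℝ → ℂ} {β b : ℝ → ℝ}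
    (hf : ∀ s, HasDerivAt f (f' s) s) (hβ : ∀ s, HasDerivAt β (b s) s)
    (hb : ∀ s, ‖f' s‖ ≤ b |s|) (t : ℝ) : ‖f t - f 0‖ ≤ β |t| - β 0 := by
  have key : ∀ {g g' : ℝ → ℂ}, (∀ s, HasDerivAt g (g' s) s) → (∀ s, 0 ≤ s → ‖g' s‖ ≤ b s) →
      ∀ t, 0 ≤ t → ‖g t - g 0‖ ≤ β t - β 0 := by
    intro g g' hg hg' t ht
    refine image_norm_le_of_norm_deriv_right_le_deriv_boundary
      (f := fun s => g s - g 0) (f' := g') (B := fun s => β s - β 0) (B' := b) (a := 0) (b := t)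
      ?_ (fun s _ => ((hg s).sub_const _).hasDerivWithinAt) ?_ (fun s => (hβ s).sub_const _)
      (fun s hs => hg' s hs.1) ⟨ht, le_rfl⟩
    · exact fun s _ => ((hg s).sub_const _).continuousAt.continuousWithinAt
    · simp
  rcases le_total 0 t with ht | ht
  · rw [abs_of_nonneg ht]
    exact key hf (fun s hs => by simpa [abs_of_nonneg hs] using hb s) t ht
  · rw [abs_of_nonpos ht]
    have h1 : ∀ s, HasDerivAt (fun r => f (-r)) (-f' (-s)) s := fun s => by
      have := HasDerivAt.scomp (h := fun r : ℝ => -r) s (hf (-s)) (hasDerivAt_neg s)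
      rwa [neg_one_smul] at this
    have := key h1 (fun s hs => by
      rw [norm_neg]
      simpa [abs_of_nonneg hs] using hb (-s)) (-t) (neg_nonneg.2 ht)
    simpa using this

lemma norm_le_of_inner_le {T : E →L[ℂ] E} {c : ℝ} (hc : 0 ≤ c) {D : Set E} (hD : Dense D)
    (h : ∀ φ ∈ D, ∀ ψ ∈ D, ‖⟪φ, T ψ⟫_ℂ‖ ≤ c * ‖φ‖ * ‖ψ‖) : ‖T‖ ≤ c := by
  have h1 : ∀ φ ψ : E, ‖⟪φ, T ψ⟫_ℂ‖ ≤ c * ‖φ‖ * ‖ψ‖ := by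
    intro φ ψ
    have h2 : D ×ˢ D ⊆ {p : E × E | ‖⟪p.1, T p.2⟫_ℂ‖ ≤ c * ‖p.1‖ * ‖p.2‖} :=
      fun p hp => h _ hp.1 _ hp.2
    exact closure_minimal h2 (isClosed_le (by fun_prop) (by fun_prop)) ((hD.prod hD) (φ, ψ))
  refine ContinuousLinearMap.opNorm_le_bound _ hc fun ψ => ?_
  have h2 := h1 (T ψ) ψ
  rw [inner_self_eq_norm_sq_to_K, norm_pow] at h2
  simp only [Complex.coe_algebraMap, Complex.norm_real, norm_norm] at h2
  rcases eq_or_lt_of_le (norm_nonneg (T ψ)) with h3 | h3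
  · rw [← h3]
    positivity
  · nlinarith

variable [CompleteSpace E]

/-- Comparison of the Heisenberg evolutions of `K` and of `H = K + Q`. -/
lemma norm_commutator_le_of_perturbation {H K : E →ₗ.[ℂ] E} (hH : IsSelfAdjoint H)
    (hK : IsSelfAdjoint K) {Q : E →L[ℂ] E} (hQ : IsSelfAdjoint Q)
    (hKH : ∀ x y, (x, y) ∈ K.graph ↔ (x, y + Q x) ∈ H.graph) {A B : E →L[ℂ] E} {β b : ℝ → ℝ}
    (hβ : ∀ s, HasDerivAt β (b s) s)
    (hb : ∀ s, ‖heisenberg H s Q * B - B * heisenberg H s Q‖ ≤ b |s|)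
    (t : ℝ) :
    ‖heisenberg H t A * B - B * heisenberg H t A‖
      ≤ ‖heisenberg K t A * B - B * heisenberg K t A‖ + 2 * ‖A‖ * (β |t| - β 0) := by
  have hUH := isUnitaryGroupOf_unitaryGroup hH
  have hVK := isUnitaryGroupOf_unitaryGroup hK
  have gU := hUH.generator_eq hH
  have gV := hVK.generator_eq hK
  have hU := (isUnitaryGroupOf_iff.1 hUH).1
  have hV := (isUnitaryGroupOf_iff.1 hVK).1
  unfold heisenberg at hb ⊢
  set U := unitaryGroup H
  set V := unitaryGroup K
  have hQ' : ∀ x y, ⟪Q x, y⟫_ℂ = ⟪x, Q y⟫_ℂ :=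
    (ContinuousLinearMap.isSelfAdjoint_iff_isSymmetric.1 hQ)
  -- derivative of the interaction picture propagator
  have hW : ∀ p ∈ generator V, ∀ s, HasDerivAt (fun s => U s (V (-s) p.1))
      (Complex.I • (U s * Q * U (-s)) (U s (V (-s) p.1))) s := by
    intro p hp s
    have h1 := hV.hasDerivAt_neg hp s
    have h2 : (V (-s) p.1, V (-s) p.2 + Q (V (-s) p.1)) ∈ generator U := by
      rw [gU, ← hKH, ← gV]
      exact hV.map_mem_generator hp _
    have h3 := hU.hasDerivAt_apply h1 h2
    convert! h3 using 1
    simp only [mul_apply_eq_comp, hU.neg_apply_apply, map_add, map_neg, map_smul, smul_add]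
    abel
  -- The propagator `W_s = U_s V_{-s}` satisfies `W' = i τ_s(Q) W` on the domain of `K`, so
  -- conjugating `B` by it changes at a rate given by the commutator of `τ_s(Q)` with `B`. The
  -- argument is made on matrix elements because of domains and closed by density.
  have hW1 : ‖V t * U (-t) * B * (U t * V (-t)) - B‖ ≤ β |t| - β 0 := by
    have hd : Dense ((generator V).map (LinearMap.fst ℂ E E) : Set E) := by
      rw [gV]
      exact dense_map_fst_graph hK.dense_domain
    have h0 : 0 ≤ β |t| - β 0 := by
      refine le_trans (norm_nonneg _) (norm_sub_le_of_norm_deriv_le (f := fun _ => 0)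
        (f' := fun _ => 0) (fun s => hasDerivAt_const _ _) hβ (fun s => ?_) t)
      rw [norm_zero]
      exact (norm_nonneg _).trans (hb s)
    refine norm_le_of_inner_le h0 hd ?_
    rintro _ ⟨p, hp, rfl⟩ _ ⟨q, hq, rfl⟩
    have hf : ∀ s, HasDerivAt (fun s => ⟪U s (V (-s) p.1), B (U s (V (-s) q.1))⟫_ℂ)
        (-(Complex.I * ⟪U s (V (-s) p.1), ((U s * Q * U (-s)) * B - B * (U s * Q * U (-s)))
          (U s (V (-s) q.1))⟫_ℂ)) s := by
      intro s
      have h1 := (hW p hp s).inner ℂ ((B.restrictScalars ℝ).hasFDerivAt.comp_hasDerivAt s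
        (hW q hq s))
      convert! h1 using 1
      have hT : ∀ x y, ⟪(U s * Q * U (-s)) x, y⟫_ℂ = ⟪x, (U s * Q * U (-s)) y⟫_ℂ := fun x y => by
        simp only [mul_apply_eq_comp]
        rw [hU.inner_map_left, hQ', hU.inner_map_left, neg_neg]
      rw [inner_smul_left, hT, sub_apply, inner_sub_right]
      simp only [ContinuousLinearMap.coe_restrictScalars', Function.comp_apply, map_smul,
        inner_smul_right, Complex.conj_I]
      simp only [mul_apply_eq_comp]
      ring
    have hb' : ∀ s, ‖-(Complex.I * ⟪U s (V (-s) p.1), ((U s * Q * U (-s)) * B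
        - B * (U s * Q * U (-s))) (U s (V (-s) q.1))⟫_ℂ)‖
        ≤ (fun r => ‖p.1‖ * ‖q.1‖ * b r) |s| := by
      intro s
      rw [norm_neg, norm_mul, Complex.norm_I, one_mul]
      refine (norm_inner_le_norm _ _).trans ?_
      rw [hU.norm_map, hV.norm_map]
      have h1 := ContinuousLinearMap.le_of_opNorm_le _ (hb s) (U s (V (-s) q.1))
      rw [hU.norm_map, hV.norm_map] at h1
      calc _ ≤ ‖p.1‖ * (b |s| * ‖q.1‖) := by gcongr
        _ = _ := by ring
    have h1 := norm_sub_le_of_norm_deriv_le hf (fun s => (hβ s).const_mul (‖p.1‖ * ‖q.1‖)) hb' t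
    simp only [neg_zero, hU.apply_zero, hV.apply_zero] at h1
    have h2 : ⟪p.1, (V t * U (-t) * B * (U t * V (-t)) - B) q.1⟫_ℂ
        = ⟪U t (V (-t) p.1), B (U t (V (-t) q.1))⟫_ℂ - ⟪p.1, B q.1⟫_ℂ := by
      rw [sub_apply, inner_sub_right]
      simp only [mul_apply_eq_comp, hU.inner_map_left, hV.inner_map_left, neg_neg]
    change ‖⟪p.1, (V t * U (-t) * B * (U t * V (-t)) - B) q.1⟫_ℂ‖ ≤ _ * ‖p.1‖ * ‖q.1‖
    rw [h2]
    refine h1.trans (le_of_eq ?_)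
    ring
  set D := V t * U (-t) * B * (U t * V (-t)) - B with hD
  set A' := V t * A * V (-t) with hA'
  have hA'n : ‖A'‖ ≤ ‖A‖ := by
    refine ContinuousLinearMap.opNorm_le_bound _ (norm_nonneg _) fun ψ => ?_
    simp only [hA', mul_apply_eq_comp, hV.norm_map]
    exact (A.le_opNorm _).trans (by rw [hV.norm_map])
  -- Since `τ_t(A) = W A' W*`, the commutator with `B` is conjugate to that of `A'` with `W* B W = B
  -- + D`.
  have e1 : U t * A * U (-t) * B - B * (U t * A * U (-t))
      = U t * V (-t) * (A' * B - B * A' + (A' * D - D * A')) * (V t * U (-t)) := by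
    have i1 := hU.mul_neg t
    have i2 := hV.neg_mul t
    have i3 := hV.mul_neg t
    have j1 : ∀ S, U t * (U (-t) * S) = S := fun S => by rw [← mul_assoc, i1, one_mul]
    have j2 : ∀ S, V (-t) * (V t * S) = S := fun S => by rw [← mul_assoc, i2, one_mul]
    simp only [hD, hA', mul_sub, sub_mul, mul_add, add_mul, mul_assoc, j1, j2, i1, mul_one]
    abel
  have hn : ∀ S : E →L[ℂ] E, ‖U t * V (-t) * S * (V t * U (-t))‖ ≤ ‖S‖ := fun S => by
    refine ContinuousLinearMap.opNorm_le_bound _ (norm_nonneg _) fun ψ => ?_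
    simp only [mul_apply_eq_comp, hU.norm_map, hV.norm_map]
    exact (S.le_opNorm _).trans (by rw [hV.norm_map, hU.norm_map])
  rw [e1]
  refine (hn _).trans ((norm_add_le _ _).trans (add_le_add le_rfl ?_))
  have h0 : 0 ≤ ‖D‖ := norm_nonneg _
  calc ‖A' * D - D * A'‖ ≤ ‖A'‖ * ‖D‖ + ‖D‖ * ‖A'‖ :=
        (norm_sub_le _ _).trans (add_le_add (norm_mul_le _ _) (norm_mul_le _ _))
    _ = 2 * ‖A'‖ * ‖D‖ := by ring
    _ ≤ _ := by gcongr

end Duhamel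

/-! ## Lieb-Robinson bounds -/

section LiebRobinson

open Filter

/-! ### Norms of evolved observables and their commutators -/

section Heisenberg

variable {E : Type v} [NormedAddCommGroup E] [InnerProductSpace ℂ E]

lemma heisenberg_sum (H : E →ₗ.[ℂ] E) (t : ℝ) {ι : Type*} (s : Finset ι) (A : ι → E →L[ℂ] E) :
    heisenberg H t (∑ i ∈ s, A i) = ∑ i ∈ s, heisenberg H t (A i) := by
  simp only [heisenberg, Finset.mul_sum, Finset.sum_mul]

lemma norm_commutator_le (A B : E →L[ℂ] E) : ‖A * B - B * A‖ ≤ 2 * ‖A‖ * ‖B‖ := by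
  calc ‖A * B - B * A‖ ≤ ‖A‖ * ‖B‖ + ‖B‖ * ‖A‖ :=
        (norm_sub_le _ _).trans (add_le_add (norm_mul_le _ _) (norm_mul_le _ _))
    _ = _ := by ring

variable [CompleteSpace E]

lemma norm_heisenberg_le {H : E →ₗ.[ℂ] E} (hH : IsSelfAdjoint H) (t : ℝ) (A : E →L[ℂ] E) :
    ‖heisenberg H t A‖ ≤ ‖A‖ := by
  have hU := (isUnitaryGroupOf_iff.1 (isUnitaryGroupOf_unitaryGroup hH)).1
  refine ContinuousLinearMap.opNorm_le_bound _ (norm_nonneg _) fun ψ => ?_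
  simp only [heisenberg, mul_apply_eq_comp, hU.norm_map]
  exact (A.le_opNorm _).trans (by rw [hU.norm_map])

/-- Evolving a commutator by the common time does not increase its norm, so the time can be moved to
the other observable. This later allows the boundary of either set to be used. -/
lemma norm_commutator_heisenberg_symm {H : E →ₗ.[ℂ] E} (hH : IsSelfAdjoint H) (t : ℝ)
    (A B : E →L[ℂ] E) :
    ‖A * heisenberg H t B - heisenberg H t B * A‖
      ≤ ‖heisenberg H (-t) A * B - B * heisenberg H (-t) A‖ := by
  have hU := (isUnitaryGroupOf_iff.1 (isUnitaryGroupOf_unitaryGroup hH)).1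
  have j1 : ∀ S, unitaryGroup H t * (unitaryGroup H (-t) * S) = S := fun S => by
    rw [← mul_assoc, hU.mul_neg, one_mul]
  have h1 : A * heisenberg H t B - heisenberg H t B * A
      = heisenberg H t (heisenberg H (-t) A * B - B * heisenberg H (-t) A) := by
    simp only [heisenberg, mul_sub, sub_mul, mul_assoc, j1, neg_neg, hU.mul_neg, mul_one]
  rw [h1]
  exact norm_heisenberg_le hH t _

end Heisenberg

variable {Γ : Type u} {𝓗 : Γ → Type v} [∀ x, NormedAddCommGroup (𝓗 x)]
  [∀ x, InnerProductSpace ℂ (𝓗 x)] [∀ x, CompleteSpace (𝓗 x)]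

lemma amplify_sub {X Y : Finset Γ} (h : X ⊆ Y) (A B : LocalAlgebra 𝓗 X) :
    amplify h (A - B) = amplify h A - amplify h B := by
  rw [eq_sub_iff_add_eq, ← amplify_add, sub_add_cancel]

open Classical in
/-- The interaction term of `Z` as an observable over `Λ`. -/
def Interaction.termIn (Φ : Interaction 𝓗) (Λ Z : Finset Γ) : LocalAlgebra 𝓗 Λ :=
  if h : Z ⊆ Λ then amplify h (Φ.term Z) else 0

lemma Interaction.termIn_of_subset (Φ : Interaction 𝓗) {Λ Z : Finset Γ} (h : Z ⊆ Λ) :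
    Φ.termIn Λ Z = amplify h (Φ.term Z) := dif_pos h

lemma Interaction.amplify_potential (Φ : Interaction 𝓗) {Λ Z : Finset Γ} (h : Z ⊆ Λ) :
    amplify h (Φ.potential Z) = ∑ X ∈ Z.powerset, Φ.termIn Λ X := by
  rw [Interaction.potential, amplify_sum, ← Finset.sum_coe_sort Z.powerset]
  refine Finset.sum_congr rfl fun X _ => ?_
  rw [amplify_amplify, Φ.termIn_of_subset]

lemma Interaction.potential_eq (Φ : Interaction 𝓗) (Λ : Finset Γ) :
    Φ.potential Λ = ∑ X ∈ Λ.powerset, Φ.termIn Λ X := by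
  rw [Interaction.potential, ← Finset.sum_coe_sort Λ.powerset]
  exact Finset.sum_congr rfl fun X _ => (Φ.termIn_of_subset _).symm

lemma Interaction.isSelfAdjoint_termIn (Φ : Interaction 𝓗) {Λ Z : Finset Γ} (h : Z ⊆ Λ) :
    IsSelfAdjoint (Φ.termIn Λ Z) := by
  rw [Φ.termIn_of_subset h]
  exact isSelfAdjoint_amplify h (Φ.selfAdjoint Z)

open Classical in
/-- The sets in the surface of `Z` that lie in `Λ`. -/
def surfaceIn (Λ Z : Finset Γ) : Finset (Finset Γ) := {X ∈ Λ.powerset | X ∈ surface Z}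

lemma mem_surfaceIn {Λ Z X : Finset Γ} : X ∈ surfaceIn Λ Z ↔ X ⊆ Λ ∧ X ∈ surface Z := by
  classical
  rw [surfaceIn, Finset.mem_filter, Finset.mem_powerset]

open Classical in
/-- The interaction is the sum of its parts inside `Z`, outside `Z` and across the surface. -/
lemma Interaction.potential_decomposition (Φ : Interaction 𝓗) {Λ Z : Finset Γ} (h : Z ⊆ Λ) :
    Φ.potential Λ = (amplify h (Φ.potential Z)
      + amplify Finset.sdiff_subset
        (Φ.potential (Λ \ Z) - amplify (Finset.empty_subset _) (Φ.term ∅)))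
      + ∑ X ∈ surfaceIn Λ Z, Φ.termIn Λ X := by
  rw [amplify_sub, Φ.amplify_potential, Φ.amplify_potential, amplify_amplify,
    ← Φ.termIn_of_subset, Φ.potential_eq,
    ← Finset.sum_erase_eq_sub (Finset.mem_powerset.2 (Finset.empty_subset _))]
  -- The empty set lies both in `Z` and in its complement; its term is counted with `Z` and erased
  -- on the other side.
  have hd1 : Disjoint Z.powerset ((Λ \ Z).powerset.erase ∅) := by
    rw [Finset.disjoint_left]
    intro X hX hX'
    rw [Finset.mem_erase, Finset.mem_powerset] at hX'
    obtain ⟨x, hx⟩ := Finset.nonempty_iff_ne_empty.2 hX'.1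
    exact (Finset.mem_sdiff.1 (hX'.2 hx)).2 (Finset.mem_powerset.1 hX hx)
  have hd2 : Disjoint (Z.powerset ∪ (Λ \ Z).powerset.erase ∅) (surfaceIn Λ Z) := by
    rw [Finset.disjoint_left]
    intro X hX hX'
    obtain ⟨-, ⟨x, hx, hxZ⟩, y, hy, hyZ⟩ := mem_surfaceIn.1 hX'
    rcases Finset.mem_union.1 hX with h1 | h1
    · exact hyZ (Finset.mem_powerset.1 h1 hy)
    · rw [Finset.mem_erase, Finset.mem_powerset] at h1
      exact (Finset.mem_sdiff.1 (h1.2 hx)).2 hxZ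
  rw [← Finset.sum_union hd1, ← Finset.sum_union hd2]
  refine Finset.sum_congr ?_ fun _ _ => rfl
  ext X
  rw [Finset.mem_union, Finset.mem_union, mem_surfaceIn, Finset.mem_erase, Finset.mem_powerset,
    Finset.mem_powerset, Finset.mem_powerset]
  constructor
  · intro hX
    by_cases h1 : X ⊆ Z
    · exact Or.inl (Or.inl h1)
    · obtain ⟨y, hy, hyZ⟩ := Finset.not_subset.1 h1
      by_cases h2 : ∃ z ∈ X, z ∈ Z
      · exact Or.inr ⟨hX, h2, y, hy, hyZ⟩
      · push Not at h2
        refine Or.inl (Or.inr ⟨Finset.nonempty_iff_ne_empty.1 ⟨y, hy⟩, fun x hx => ?_⟩)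
        exact Finset.mem_sdiff.2 ⟨hX hx, h2 x hx⟩
  · rintro ((h1 | ⟨-, h1⟩) | ⟨h1, -⟩)
    · exact h1.trans h
    · exact h1.trans Finset.sdiff_subset
    · exact h1

variable {h : (x : Γ) → 𝓗 x →ₗ.[ℂ] 𝓗 x}

/-- The commutator of observables over disjoint sets is controlled by the interaction across the
surface. -/
lemma norm_commutator_le_surface (hh : ∀ x, IsSelfAdjoint (h x)) (Φ : Interaction 𝓗)
    {Λ Z Y : Finset Γ} (hZ : Z ⊆ Λ) (hY : Y ⊆ Λ) (hd : Disjoint Z Y) (A : LocalAlgebra 𝓗 Z)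
    (B : LocalAlgebra 𝓗 Y) {β b : ℝ → ℝ} (hβ : ∀ s, HasDerivAt β (b s) s)
    (hb : ∀ s, ∑ X ∈ surfaceIn Λ Z, ‖heisenberg (hamiltonian h Φ Λ) s (Φ.termIn Λ X) * amplify hY B
      - amplify hY B * heisenberg (hamiltonian h Φ Λ) s (Φ.termIn Λ X)‖ ≤ b |s|) (t : ℝ) :
    ‖heisenberg (hamiltonian h Φ Λ) t (amplify hZ A) * amplify hY B
      - amplify hY B * heisenberg (hamiltonian h Φ Λ) t (amplify hZ A)‖
      ≤ 2 * ‖A‖ * (β |t| - β 0) := by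
  classical
  have hp := isPartition_sdiff hZ
  set Q := ∑ X ∈ surfaceIn Λ Z, Φ.termIn Λ X with hQdef
  set P' : LocalAlgebra 𝓗 (Λ \ Z) := Φ.potential (Λ \ Z)
    - amplify (Finset.empty_subset _) (Φ.term ∅) with hP'
  have hdec : Φ.potential Λ = (amplify hp.left (Φ.potential Z) + amplify hp.right P') + Q :=
    Φ.potential_decomposition hZ
  have hP's : IsSelfAdjoint P' :=
    (isSelfAdjoint_potential Φ _).sub (isSelfAdjoint_amplify _ (Φ.selfAdjoint ∅))
  have hPs := isSelfAdjoint_potential Φ Z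
  have hQ : IsSelfAdjoint Q := isSelfAdjoint_sum _ fun X hX =>
    Φ.isSelfAdjoint_termIn (mem_surfaceIn.1 hX).1
  have hK := isSelfAdjoint_perturbed hh
    ((isSelfAdjoint_amplify hp.left hPs).add (isSelfAdjoint_amplify hp.right hP's))
  have h1 := norm_commutator_le_of_perturbation (isSelfAdjoint_hamiltonian hh Φ Λ) hK hQ
    (fun x y => ?_) (A := amplify hZ A) (B := amplify hY B) hβ (fun s => ?_) t
  · rw [heisenberg_perturbed_amplify hh hp hPs hP's,
      amplify_commute_of_disjoint hp.left hY hd, sub_self, norm_zero, zero_add] at h1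
    refine h1.trans ?_
    have h0 : 0 ≤ β |t| - β 0 := by
      refine le_trans (norm_nonneg _) (norm_sub_le_of_norm_deriv_le (f := fun _ => 0)
        (f' := fun _ => 0) (fun s => hasDerivAt_const _ _) hβ (fun s => ?_) t)
      rw [norm_zero]
      exact (Finset.sum_nonneg fun _ _ => norm_nonneg _).trans (hb s)
    have := norm_amplify_le hZ A
    gcongr
  · rw [hamiltonian, hdec, perturbed, mem_graph_add_toPMap, mem_graph_add_toPMap, add_apply _ Q,
      add_sub_add_right_eq_sub]
  · refine le_trans ?_ (hb s)
    rw [hQdef, heisenberg_sum, Finset.sum_mul, Finset.mul_sum, ← Finset.sum_sub_distrib]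
    exact norm_sum_le _ _

/-- The sum of `G (x, y)` over `x` in the boundary of `X` and `y` in `Y`. -/
def boundarySum (Φ : Interaction 𝓗) (G : Γ → Γ → ℝ) (X Y : Finset Γ) : ℝ :=
  ∑ x ∈ Φ.boundary X, ∑ y ∈ Y, G x y

/-! ### Summation over surfaces and iteration -/

variable {G : Γ → Γ → ℝ} {p C : ℝ}

lemma boundarySum_nonneg (Φ : Interaction 𝓗) (hG : ∀ x y, 0 ≤ G x y) (X Y : Finset Γ) :
    0 ≤ boundarySum Φ G X Y :=
  Finset.sum_nonneg fun _ _ => Finset.sum_nonneg fun _ _ => hG _ _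

lemma Interaction.mem_boundary (Φ : Interaction 𝓗) {X : Finset Γ} {x : Γ} :
    x ∈ Φ.boundary X ↔ x ∈ X ∧ ∃ Z ∈ surface X, x ∈ Z ∧ Φ.term Z ≠ 0 := by
  classical
  rw [Interaction.boundary, Finset.mem_filter]

/-- Every surface set with nonzero interaction contains a point of the `Φ`-boundary. Summing over
that point first and then over the sets containing it and `z` lets the decay hypothesis be applied
pairwise. -/
lemma sum_surface_le (Φ : Interaction 𝓗) (Λ Z : Finset Γ)
    (h1 : ∀ x y (s : Finset (Finset Γ)), (∀ Z ∈ s, x ∈ Z ∧ y ∈ Z) →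
      ∑ Z ∈ s, ‖Φ.term Z‖ ≤ p * G x y) {g : Γ → ℝ} (hg : ∀ z, 0 ≤ g z) :
    ∑ X ∈ surfaceIn Λ Z, ‖Φ.term X‖ * ∑ z ∈ X, g z
      ≤ ∑ x ∈ Φ.boundary Z, ∑ z ∈ Λ, p * G x z * g z := by
  classical
  have hpt : ∀ X ∈ surfaceIn Λ Z, ‖Φ.term X‖ * ∑ z ∈ X, g z
      ≤ ∑ x ∈ Φ.boundary Z, ∑ z ∈ Λ, if x ∈ X ∧ z ∈ X then ‖Φ.term X‖ * g z else 0 := by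
    intro X hX
    obtain ⟨hXΛ, hXs⟩ := mem_surfaceIn.1 hX
    have hnn : ∀ x z, 0 ≤ if x ∈ X ∧ z ∈ X then ‖Φ.term X‖ * g z else 0 := fun x z => by
      split_ifs
      · exact mul_nonneg (norm_nonneg _) (hg z)
      · exact le_rfl
    by_cases h0 : Φ.term X = 0
    · rw [h0, norm_zero, zero_mul]
      exact Finset.sum_nonneg fun x _ => Finset.sum_nonneg fun z _ => by simp
    · obtain ⟨x, hx, hxZ⟩ := hXs.1
      have hxb : x ∈ Φ.boundary Z := Φ.mem_boundary.2 ⟨hxZ, X, hXs, hx, h0⟩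
      refine le_trans ?_ (Finset.single_le_sum (f := fun x => ∑ z ∈ Λ,
        if x ∈ X ∧ z ∈ X then ‖Φ.term X‖ * g z else 0)
        (fun x _ => Finset.sum_nonneg fun z _ => hnn x z) hxb)
      simp only [hx, true_and]
      rw [Finset.mul_sum, ← Finset.sum_filter, Finset.filter_mem_eq_inter,
        Finset.inter_eq_right.2 hXΛ]
  refine (Finset.sum_le_sum hpt).trans ?_
  rw [Finset.sum_comm]
  refine Finset.sum_le_sum fun x _ => ?_
  rw [Finset.sum_comm]
  refine Finset.sum_le_sum fun z _ => ?_
  rw [← Finset.sum_filter, ← Finset.sum_mul]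
  exact mul_le_mul_of_nonneg_right (h1 x z _ fun X hX => (Finset.mem_filter.1 hX).2) (hg z)

open Classical in
-- The weight `g` is the indicator of `Y`: a set meeting `Y` contains at least one point of it.
lemma sum_surface_meet_le (Φ : Interaction 𝓗) {Λ Z Y : Finset Γ} (hY : Y ⊆ Λ)
    (h1 : ∀ x y (s : Finset (Finset Γ)), (∀ Z ∈ s, x ∈ Z ∧ y ∈ Z) →
      ∑ Z ∈ s, ‖Φ.term Z‖ ≤ p * G x y) :
    ∑ X ∈ surfaceIn Λ Z, ‖Φ.term X‖ * (if Disjoint X Y then 0 else 1)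
      ≤ p * boundarySum Φ G Z Y := by
  refine le_trans (Finset.sum_le_sum fun X _ => ?_) ((sum_surface_le Φ Λ Z h1
    (g := fun z => if z ∈ Y then 1 else 0) fun z => by split_ifs <;> simp).trans (le_of_eq ?_))
  · refine mul_le_mul_of_nonneg_left ?_ (norm_nonneg _)
    have hnn : ∀ z ∈ X, (0 : ℝ) ≤ if z ∈ Y then 1 else 0 := fun z _ => by split_ifs <;> simp
    split_ifs with hXY
    · exact Finset.sum_nonneg hnn
    · obtain ⟨z, hzX, hzY⟩ := Finset.not_disjoint_iff.1 hXY
      refine le_trans ?_ (Finset.single_le_sum hnn hzX)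
      rw [if_pos hzY]
  · rw [boundarySum, Finset.mul_sum]
    refine Finset.sum_congr rfl fun x _ => ?_
    simp only [mul_ite, mul_one, mul_zero]
    rw [← Finset.sum_filter, Finset.filter_mem_eq_inter, Finset.inter_eq_right.2 hY,
      Finset.mul_sum]

/-- The inner boundary is enlarged to the whole set; the sum over the intermediate site is then a
convolution, costing a factor `C`. -/
lemma sum_surface_boundarySum_le (Φ : Interaction 𝓗) (Λ Z Y : Finset Γ) (hp : 0 ≤ p)
    (hG : ∀ x y, 0 ≤ G x y)
    (h1 : ∀ x y (s : Finset (Finset Γ)), (∀ Z ∈ s, x ∈ Z ∧ y ∈ Z) →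
      ∑ Z ∈ s, ‖Φ.term Z‖ ≤ p * G x y)
    (h2 : ∀ x y (s : Finset Γ), ∑ z ∈ s, G x z * G z y ≤ C * G x y) :
    ∑ X ∈ surfaceIn Λ Z, ‖Φ.term X‖ * boundarySum Φ G X Y ≤ p * C * boundarySum Φ G Z Y := by
  have hg : ∀ z, 0 ≤ ∑ y ∈ Y, G z y := fun z => Finset.sum_nonneg fun y _ => hG z y
  refine le_trans (Finset.sum_le_sum fun X _ => ?_) ((sum_surface_le Φ Λ Z h1 hg).trans ?_)
  · refine mul_le_mul_of_nonneg_left ?_ (norm_nonneg _)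
    exact Finset.sum_le_sum_of_subset_of_nonneg (fun x hx => (Φ.mem_boundary.1 hx).1)
      fun z _ _ => hg z
  · rw [boundarySum, Finset.mul_sum]
    refine Finset.sum_le_sum fun x _ => ?_
    simp only [Finset.mul_sum]
    rw [Finset.sum_comm]
    refine Finset.sum_le_sum fun y _ => ?_
    calc ∑ z ∈ Λ, p * G x z * G z y = p * ∑ z ∈ Λ, G x z * G z y := by
          rw [Finset.mul_sum]
          exact Finset.sum_congr rfl fun z _ => mul_assoc _ _ _
      _ ≤ p * (C * G x y) := mul_le_mul_of_nonneg_left (h2 x y Λ) hp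
      _ = _ := by ring

lemma hasDerivAt_pow_succ_div_factorial (L : ℝ) (n : ℕ) (s : ℝ) :
    HasDerivAt (fun s => (L * s) ^ (n + 1) / (n + 1).factorial)
      (L * ((L * s) ^ n / n.factorial)) s := by
  have h1 := ((((hasDerivAt_id s).const_mul L).pow (n + 1)).div_const ((n + 1).factorial : ℝ))
  refine h1.congr_deriv ?_
  have : (n.factorial : ℝ) ≠ 0 := by exact_mod_cast n.factorial_ne_zero
  rw [Nat.factorial_succ]
  push_cast
  simp only [id]
  field_simp

open Classical in
/-- The Lieb-Robinson bound after `n` iterations. -/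
lemma norm_commutator_le_iterate (hh : ∀ x, IsSelfAdjoint (h x)) (Φ : Interaction 𝓗) (hp : 0 ≤ p)
    (hC : 0 < C) (hG : ∀ x y, 0 ≤ G x y)
    (h1 : ∀ x y (s : Finset (Finset Γ)), (∀ Z ∈ s, x ∈ Z ∧ y ∈ Z) →
      ∑ Z ∈ s, ‖Φ.term Z‖ ≤ p * G x y)
    (h2 : ∀ x y (s : Finset Γ), ∑ z ∈ s, G x z * G z y ≤ C * G x y)
    {Λ Y : Finset Γ} (hY : Y ⊆ Λ) (B : LocalAlgebra 𝓗 Y) (n : ℕ) :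
    ∀ {Z : Finset Γ} (hZ : Z ⊆ Λ) (A : LocalAlgebra 𝓗 Z) (t : ℝ),
      ‖heisenberg (hamiltonian h Φ Λ) t (amplify hZ A) * amplify hY B
        - amplify hY B * heisenberg (hamiltonian h Φ Λ) t (amplify hZ A)‖
      ≤ ‖A‖ * (2 * ‖B‖) * ((if Disjoint Z Y then 0 else 1)
        + boundarySum Φ G Z Y / C * (Real.exp (2 * p * C * |t|) - 1)
        + ((2 * ∑ X ∈ Λ.powerset, ‖Φ.term X‖) * |t|) ^ n / n.factorial) := by
  -- This crude total strength depends on `Λ`, but it enters only the remainder of the iteration,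
  -- which tends to zero for fixed `Λ`.
  set L := 2 * ∑ X ∈ Λ.powerset, ‖Φ.term X‖ with hL
  have hL0 : 0 ≤ L := mul_nonneg zero_le_two (Finset.sum_nonneg fun _ _ => norm_nonneg _)
  have hexp : ∀ t : ℝ, 0 ≤ Real.exp (2 * p * C * |t|) - 1 := fun t =>
    sub_nonneg.2 (Real.one_le_exp (by positivity))
  have hS := boundarySum_nonneg Φ hG
  have htriv : ∀ {Z : Finset Γ} (hZ : Z ⊆ Λ) (A : LocalAlgebra 𝓗 Z) (t c : ℝ), 1 ≤ c →
      ‖heisenberg (hamiltonian h Φ Λ) t (amplify hZ A) * amplify hY B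
        - amplify hY B * heisenberg (hamiltonian h Φ Λ) t (amplify hZ A)‖
      ≤ ‖A‖ * (2 * ‖B‖) * c := by
    intro Z hZ A t c hc
    refine (norm_commutator_le _ _).trans ?_
    have e1 := (norm_heisenberg_le (isSelfAdjoint_hamiltonian hh Φ Λ) t (amplify hZ A)).trans
      (norm_amplify_le hZ A)
    have e2 := norm_amplify_le hY B
    calc _ ≤ 2 * ‖A‖ * ‖B‖ := by gcongr
      _ = ‖A‖ * (2 * ‖B‖) * 1 := by ring
      _ ≤ _ := by gcongr
  induction n with
  -- With `n = 0` the remainder is `1`, so the trivial commutator bound suffices.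
  | zero =>
    intro Z hZ A t
    refine htriv hZ A t _ ?_
    have := mul_nonneg (div_nonneg (hS Z Y) hC.le) (hexp t)
    simp only [pow_zero, Nat.factorial_zero, Nat.cast_one, div_one]
    split_ifs <;> linarith
  | succ n ih =>
    intro Z hZ A t
    have hr : 0 ≤ (L * |t|) ^ (n + 1) / (n + 1).factorial := by positivity
    by_cases hd : Disjoint Z Y
    -- If the sets meet, the indicator is already `1` and the trivial bound suffices; the Duhamel
    -- step is needed only for disjoint sets.
    swap
    · refine htriv hZ A t _ ?_
      have := mul_nonneg (div_nonneg (hS Z Y) hC.le) (hexp t)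
      rw [if_neg hd]
      linarith
    rw [if_pos hd, zero_add]
    set S := boundarySum Φ G Z Y with hSdef
    -- An explicit antiderivative of the surface estimate. The exponential reproduces itself: sets
    -- meeting `Y` contribute `pS`, the induction hypothesis contributes `pS(e^{2pCs} - 1)`, and
    -- they add up to `pS e^{2pCs}`.
    have hβ : ∀ s, HasDerivAt (fun s => 2 * ‖B‖ * (S / (2 * C) * Real.exp (2 * p * C * s)
          + 1 / 2 * ((L * s) ^ (n + 1) / (n + 1).factorial)))
        (2 * ‖B‖ * (p * S * Real.exp (2 * p * C * s)
          + 1 / 2 * (L * ((L * s) ^ n / n.factorial)))) s := by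
      intro s
      have e1 := (((hasDerivAt_id s).const_mul (2 * p * C)).exp).const_mul (S / (2 * C))
      have e2 := (hasDerivAt_pow_succ_div_factorial L n s).const_mul (1 / 2 : ℝ)
      refine ((e1.add e2).const_mul (2 * ‖B‖)).congr_deriv ?_
      simp only [id, mul_one]
      field_simp
    have hb : ∀ s, ∑ X ∈ surfaceIn Λ Z,
        ‖heisenberg (hamiltonian h Φ Λ) s (Φ.termIn Λ X) * amplify hY B
          - amplify hY B * heisenberg (hamiltonian h Φ Λ) s (Φ.termIn Λ X)‖
        ≤ 2 * ‖B‖ * (p * S * Real.exp (2 * p * C * |s|)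
          + 1 / 2 * (L * ((L * |s|) ^ n / n.factorial))) := by
      intro s
      set e := Real.exp (2 * p * C * |s|) - 1 with he
      set r := (L * |s|) ^ n / n.factorial with hr
      have hr0 : 0 ≤ r := by positivity
      have f1 := sum_surface_meet_le Φ (Z := Z) hY h1
      have f2 := sum_surface_boundarySum_le Φ Λ Z Y hp hG h1 h2
      have f3 : ∑ X ∈ surfaceIn Λ Z, ‖Φ.term X‖ ≤ 1 / 2 * L := by
        rw [hL]
        have := Finset.sum_le_sum_of_subset_of_nonneg (s := surfaceIn Λ Z) (t := Λ.powerset)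
          (f := fun X => ‖Φ.term X‖)
          (fun X hX => Finset.mem_powerset.2 (mem_surfaceIn.1 hX).1) fun _ _ _ => norm_nonneg _
        linarith
      calc _ ≤ ∑ X ∈ surfaceIn Λ Z, ‖Φ.term X‖ * (2 * ‖B‖) * ((if Disjoint X Y then 0 else 1)
            + boundarySum Φ G X Y / C * e + r) := by
            refine Finset.sum_le_sum fun X hX => ?_
            rw [Φ.termIn_of_subset (mem_surfaceIn.1 hX).1]
            exact ih _ _ _
        _ = 2 * ‖B‖ * (∑ X ∈ surfaceIn Λ Z, ‖Φ.term X‖ * (if Disjoint X Y then 0 else 1)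
            + (∑ X ∈ surfaceIn Λ Z, ‖Φ.term X‖ * boundarySum Φ G X Y) / C * e
            + (∑ X ∈ surfaceIn Λ Z, ‖Φ.term X‖) * r) := by
            rw [Finset.sum_div, Finset.sum_mul, Finset.sum_mul, ← Finset.sum_add_distrib,
              ← Finset.sum_add_distrib, Finset.mul_sum]
            refine Finset.sum_congr rfl fun X _ => ?_
            ring
        _ ≤ 2 * ‖B‖ * (p * S + (p * C * S) / C * e + (1 / 2 * L) * r) := by
            have := hexp s
            gcongr
        _ = _ := by
            rw [he]
            field_simp
            ring
    refine (norm_commutator_le_surface hh Φ hZ hY hd A B hβ hb t).trans (le_of_eq ?_)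
    simp only [mul_zero, Real.exp_zero, mul_one, ne_eq, Nat.add_eq_zero_iff, one_ne_zero, and_false,
      not_false_eq_true, zero_pow, zero_div, add_zero]
    field_simp
    ring

/-- The Lieb-Robinson bound. -/
theorem norm_commutator_heisenberg_le (hh : ∀ x, IsSelfAdjoint (h x)) (Φ : Interaction 𝓗)
    (hp : 0 ≤ p) (hC : 0 < C) (hG : ∀ x y, 0 ≤ G x y)
    (h1 : ∀ x y (s : Finset (Finset Γ)), (∀ Z ∈ s, x ∈ Z ∧ y ∈ Z) →
      ∑ Z ∈ s, ‖Φ.term Z‖ ≤ p * G x y)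
    (h2 : ∀ x y (s : Finset Γ), ∑ z ∈ s, G x z * G z y ≤ C * G x y)
    {Λ X Y : Finset Γ} (hX : X ⊆ Λ) (hY : Y ⊆ Λ) (hd : Disjoint X Y) (A : LocalAlgebra 𝓗 X)
    (B : LocalAlgebra 𝓗 Y) (t : ℝ) :
    ‖heisenberg (hamiltonian h Φ Λ) t (amplify hX A) * amplify hY B
      - amplify hY B * heisenberg (hamiltonian h Φ Λ) t (amplify hX A)‖
      ≤ 2 / C * ‖A‖ * ‖B‖ * boundarySum Φ G X Y * (Real.exp (2 * p * C * |t|) - 1) := by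
  have hlim := (((FloorSemiring.tendsto_pow_div_factorial_atTop
    ((2 * ∑ X ∈ Λ.powerset, ‖Φ.term X‖) * |t|)).const_add
    (boundarySum Φ G X Y / C * (Real.exp (2 * p * C * |t|) - 1))).const_mul
    (‖A‖ * (2 * ‖B‖)))
  refine (ge_of_tendsto' hlim fun n => ?_).trans (le_of_eq ?_)
  · have := norm_commutator_le_iterate hh Φ hp hC hG h1 h2 hY B n hX A t
    rwa [if_pos hd, zero_add] at this
  · ring

end LiebRobinson

/-! ## Exponential clustering -/

section Clustering

/-! ### Choice of the time cutoff -/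

section Correlations

variable {E : Type v} [NormedAddCommGroup E] [InnerProductSpace ℂ E]

lemma norm_correlation_le_two_mul {Ω : E} (hΩ : ‖Ω‖ = 1) (A B : E →L[ℂ] E) :
    ‖correlation Ω A B‖ ≤ 2 * ‖A‖ * ‖B‖ := by
  have h1 : ∀ T : E →L[ℂ] E, ‖⟪Ω, T Ω⟫_ℂ‖ ≤ ‖T‖ := fun T => by
    have := (norm_inner_le_norm (𝕜 := ℂ) Ω (T Ω)).trans
      (mul_le_mul_of_nonneg_left (T.le_opNorm Ω) (norm_nonneg _))
    rwa [hΩ, one_mul, mul_one] at this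
  calc ‖correlation Ω A B‖ ≤ ‖⟪Ω, (A * B) Ω⟫_ℂ‖ + ‖⟪Ω, A Ω⟫_ℂ * ⟪Ω, B Ω⟫_ℂ‖ := norm_sub_le _ _
    _ ≤ ‖A‖ * ‖B‖ + ‖A‖ * ‖B‖ := by
        refine add_le_add ((h1 _).trans (norm_mul_le _ _)) ?_
        rw [norm_mul]
        exact mul_le_mul (h1 A) (h1 B) (norm_nonneg _) (norm_nonneg _)
    _ = _ := by ring

variable [CompleteSpace E]

/-- Commuting evolutions have vanishing truncated correlations in a gapped ground state. -/
lemma correlation_eq_zero {H : E →ₗ.[ℂ] E} (hH : IsSelfAdjoint H) {γ : ℝ} (hγ : 0 < γ) {Ω : E}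
    (hΩ : IsGappedGroundState H γ Ω) {A B : E →L[ℂ] E} (hAB : A * B = B * A)
    (hc : ∀ t, ‖A * heisenberg H t B - heisenberg H t B * A‖ ≤ 0) : correlation Ω A B = 0 := by
  have h1 : ∀ T : ℝ, 1 / γ ≤ T →
      ‖correlation Ω A B‖ ≤ ‖A‖ * ‖B‖ * 2 * Real.exp (-(γ * T / 2)) := by
    intro T hT
    have hT0 : 0 < T := lt_of_lt_of_le (by positivity) hT
    have h2 := norm_correlation_le hH hγ hΩ hAB (D := 0) (κ := 0) le_rfl
      (fun t => by simpa using hc t) hT0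
    rw [zero_mul, add_zero] at h2
    refine h2.trans ?_
    have h3 : 1 / (γ * T) ≤ 1 := by
      rw [div_le_one (by positivity)]
      rw [div_le_iff₀ hγ] at hT
      linarith
    have : 1 + 1 / (γ * T) ≤ 2 := by linarith
    gcongr
  have h2 : Filter.Tendsto (fun T : ℝ => ‖A‖ * ‖B‖ * 2 * Real.exp (-(γ * T / 2))) Filter.atTop
      (𝓝 (‖A‖ * ‖B‖ * 2 * 0)) := by
    refine Filter.Tendsto.const_mul _ (Real.tendsto_exp_neg_atTop_nhds_zero.comp ?_)
    exact (Filter.tendsto_id.const_mul_atTop hγ).atTop_div_const two_pos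
  rw [mul_zero] at h2
  have h3 := ge_of_tendsto h2 (Filter.eventually_atTop.2 ⟨1 / γ, h1⟩)
  exact norm_le_zero_iff.1 h3

/-- Exponential clustering from a Lieb-Robinson bound. -/
lemma norm_correlation_le_of_commutator_le {H : E →ₗ.[ℂ] E} (hH : IsSelfAdjoint H) {γ : ℝ}
    (hγ : 0 < γ) {Ω : E} (hΩ : IsGappedGroundState H γ Ω) {A B : E →L[ℂ] E} (hAB : A * B = B * A)
    {α β c a κ d : ℝ} {m : ℕ} (hα : ‖A‖ ≤ α) (hβ : ‖B‖ ≤ β) (hc : 0 ≤ c)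
    (hκ : 0 ≤ κ)
    (hcomm : ∀ t, ‖A * heisenberg H t B - heisenberg H t B * A‖
      ≤ c * α * β * m * Real.exp (-a * d) * (Real.exp (κ * |t|) - 1)) :
    ‖correlation Ω A B‖ ≤ (4 + c) * α * β * m * Real.exp (-(a * γ / (γ + 2 * κ)) * d) := by
  have hα0 := (norm_nonneg _).trans hα
  have hβ0 := (norm_nonneg _).trans hβ
  rcases Nat.eq_zero_or_pos m with rfl | hm
  · rw [correlation_eq_zero hH hγ hΩ hAB fun t => by simpa using hcomm t]
    simp
  have hm1 : (1 : ℝ) ≤ m := by exact_mod_cast hm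
  have hg : 0 < γ + 2 * κ := by linarith
  -- The solution of `a d - κT = γT/2`, at which both terms of the clustering estimate have the same
  -- exponential.
  set T := 2 * a * d / (γ + 2 * κ) with hT
  have e1 : -(a * γ / (γ + 2 * κ)) * d = -(γ * T / 2) := by
    rw [hT]
    field_simp
  rw [e1]
  -- For small `γT` the prefactor `1/(γT)` is useless, but the exponential is then at least `1/2`
  -- and the trivial bound fits under the constant `4`.
  rcases le_total (γ * T) 1 with h1 | h1
  · have h2 : 1 / 2 ≤ Real.exp (-(γ * T / 2)) := by
      have := Real.add_one_le_exp (-(γ * T / 2))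
      linarith
    calc ‖correlation Ω A B‖ ≤ 2 * ‖A‖ * ‖B‖ := norm_correlation_le_two_mul hΩ.1 A B
      _ ≤ 2 * α * β := by gcongr
      _ = 4 * α * β * 1 * (1 / 2) := by ring
      _ ≤ (4 + c) * α * β * m * Real.exp (-(γ * T / 2)) := by
        have : 4 ≤ 4 + c := by linarith
        gcongr
  · have hT0 : 0 < T := by
      by_contra hT0
      have := mul_nonpos_of_nonneg_of_nonpos hγ.le (not_lt.1 hT0)
      linarith
    have h2 := norm_correlation_le hH hγ hΩ hAB
      (D := c * α * β * m * Real.exp (-a * d)) (by positivity) hcomm hT0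
    have h3 : 1 / (γ * T) ≤ 1 := (div_le_one (by positivity)).2 h1
    have e2 : Real.exp (-a * d) * Real.exp (κ * T) = Real.exp (-(γ * T / 2)) := by
      rw [← Real.exp_add]
      congr 1
      rw [hT]
      field_simp
      ring
    have h4 : ‖A‖ * ‖B‖ * (1 + 1 / (γ * T)) ≤ 4 * α * β * m := by
      have : 1 + 1 / (γ * T) ≤ 4 := by linarith
      calc ‖A‖ * ‖B‖ * (1 + 1 / (γ * T)) ≤ α * β * 4 := by gcongr
        _ = 4 * α * β * 1 := by ring
        _ ≤ _ := by gcongr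
    calc ‖correlation Ω A B‖ ≤ _ := h2
      _ ≤ 4 * α * β * m * Real.exp (-(γ * T / 2))
          + c * α * β * m * Real.exp (-a * d) * Real.exp (κ * T) := by gcongr
      _ = (4 + c) * α * β * m * Real.exp (-(γ * T / 2)) := by
        rw [mul_assoc (c * α * β * m), e2]
        ring

end Correlations

/-! ### Decay constants and distances -/

section Constants

variable {Γ : Type u} [MetricSpace Γ] {F : ℝ → ℝ} {a : ℝ}

lemma expWeight_pos (hF : IsDecayFunction F) {r : ℝ} (hr : 0 ≤ r) : 0 < expWeight a F r :=
  mul_pos (Real.exp_pos _) (hF.2 r hr)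

/-- By the triangle inequality the exponential weights contribute a factor at most one. -/
lemma convConst_expWeight_le (hF : IsDecayFunction F) (ha : 0 ≤ a) :
    convConst Γ (expWeight a F) ≤ convConst Γ F := by
  refine iSup_mono fun x => iSup_mono fun y => ENNReal.tsum_le_tsum fun z =>
    ENNReal.ofReal_le_ofReal ?_
  have h1 := hF.2 _ (dist_nonneg (x := x) (y := z))
  have h2 := hF.2 _ (dist_nonneg (x := z) (y := y))
  have h3 := hF.2 _ (dist_nonneg (x := x) (y := y))
  have h4 : expWeight a F (dist x z) * expWeight a F (dist z y) / expWeight a F (dist x y)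
      = Real.exp (-(a * (dist x z + dist z y - dist x y)))
        * (F (dist x z) * F (dist z y) / F (dist x y)) := by
    have e : Real.exp (-(a * (dist x z + dist z y - dist x y))) * Real.exp (-a * dist x y)
        = Real.exp (-a * dist x z) * Real.exp (-a * dist z y) := by
      rw [← Real.exp_add, ← Real.exp_add]
      congr 1
      ring
    have he := (Real.exp_pos (-a * dist x y)).ne'
    unfold expWeight
    rw [mul_div_assoc', div_eq_div_iff (mul_ne_zero he h3.ne') h3.ne']
    linear_combination (-(F (dist x z) * F (dist z y) * F (dist x y))) * e
  rw [h4]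
  refine mul_le_of_le_one_left (by positivity) (Real.exp_le_one_iff.2 ?_)
  have := dist_triangle x z y
  exact neg_nonpos.2 (mul_nonneg ha (by linarith))

lemma sum_mul_le_of_convConst (hF : IsDecayFunction F) (h : convConst Γ (expWeight a F) ≠ ∞)
    (x y : Γ) (s : Finset Γ) :
    ∑ z ∈ s, expWeight a F (dist x z) * expWeight a F (dist z y)
      ≤ (convConst Γ (expWeight a F)).toReal * expWeight a F (dist x y) := by
  have hpos : ∀ x y : Γ, 0 < expWeight a F (dist x y) := fun x y => expWeight_pos hF dist_nonneg
  rw [← div_le_iff₀ (hpos x y), Finset.sum_div]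
  refine (ENNReal.ofReal_le_iff_le_toReal h).1 ?_
  rw [ENNReal.ofReal_sum_of_nonneg fun z _ =>
    (div_pos (mul_pos (hpos x z) (hpos z y)) (hpos x y)).le]
  exact (ENNReal.sum_le_tsum s).trans (le_iSup₂_of_le x y le_rfl)

/-- Take `z = x = y`. This lower bound replaces the factor `2/C` of the Lieb-Robinson estimate by
`2/F 0`, so that the final constant involves neither `a` nor the lattice. -/
lemma le_convConst_toReal [Nonempty Γ] (hF : IsDecayFunction F)
    (h : convConst Γ (expWeight a F) ≠ ∞) : F 0 ≤ (convConst Γ (expWeight a F)).toReal := by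
  obtain ⟨x⟩ := ‹Nonempty Γ›
  have h1 := sum_mul_le_of_convConst hF h x x {x}
  rw [Finset.sum_singleton, dist_self] at h1
  have h2 := le_of_mul_le_mul_right h1 (expWeight_pos hF le_rfl)
  simpa [expWeight] using h2

lemma sum_le_of_unifNorm (hF : IsDecayFunction F) {M : ℝ≥0} (h : unifNorm Γ F ≤ M) (x : Γ)
    (s : Finset Γ) : ∑ y ∈ s, F (dist x y) ≤ M := by
  have h1 : ENNReal.ofReal (∑ y ∈ s, F (dist x y)) ≤ M := by
    rw [ENNReal.ofReal_sum_of_nonneg fun y _ => (hF.2 _ dist_nonneg).le]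
    exact (ENNReal.sum_le_tsum s).trans ((le_iSup_of_le x le_rfl).trans h)
  simpa using (ENNReal.ofReal_le_iff_le_toReal ENNReal.coe_ne_top).1 h1

lemma setDist_comm (X Y : Finset Γ) : setDist X Y = setDist Y X := by
  unfold setDist
  congr 1
  ext r
  constructor
  · rintro ⟨x, hx, y, hy, rfl⟩
    exact ⟨y, hy, x, hx, dist_comm _ _⟩
  · rintro ⟨x, hx, y, hy, rfl⟩
    exact ⟨y, hy, x, hx, dist_comm _ _⟩

lemma setDist_le {X Y : Finset Γ} {x y : Γ} (hx : x ∈ X) (hy : y ∈ Y) :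
    setDist X Y ≤ dist x y := by
  refine csInf_le ⟨0, ?_⟩ ⟨x, hx, y, hy, rfl⟩
  rintro _ ⟨x, -, y, -, rfl⟩
  exact dist_nonneg

end Constants

/-! ### Representations of the local algebra -/

section Representations

variable {Γ : Type u} {𝓗 : Γ → Type v} [∀ x, NormedAddCommGroup (𝓗 x)]
  [∀ x, InnerProductSpace ℂ (𝓗 x)] [∀ x, CompleteSpace (𝓗 x)] {K : Type w}
  [NormedAddCommGroup K] [InnerProductSpace ℂ K] [CompleteSpace K]

/-- Star homomorphisms between C*-algebras are contractive. -/
lemma LocalRepresentation.norm_le (ρ : LocalRepresentation 𝓗 K) (X : Finset Γ)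
    (A : LocalAlgebra 𝓗 X) : ‖ρ.π X A‖ ≤ ‖A‖ :=
  NonUnitalStarAlgHom.norm_apply_le (ρ.π X) A

lemma LocalRepresentation.commute (ρ : LocalRepresentation 𝓗 K) {X Y : Finset Γ}
    (hd : Disjoint X Y) (A : LocalAlgebra 𝓗 X) (B : LocalAlgebra 𝓗 Y) :
    ρ.π X A * ρ.π Y B = ρ.π Y B * ρ.π X A := by
  classical
  have hX : X ⊆ X ∪ Y := Finset.subset_union_left
  have hY : Y ⊆ X ∪ Y := Finset.subset_union_right
  rw [← ρ.compatible hX, ← ρ.compatible hY, ← map_mul, ← map_mul,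
    amplify_commute_of_disjoint hX hY hd]

end Representations

variable {Γ : Type u} [MetricSpace Γ] {𝓗 : Γ → Type v} [∀ x, NormedAddCommGroup (𝓗 x)]
  [∀ x, InnerProductSpace ℂ (𝓗 x)] [∀ x, CompleteSpace (𝓗 x)] {F : ℝ → ℝ} {a : ℝ}

lemma Interaction.sum_norm_le (Φ : Interaction 𝓗) (hF : IsDecayFunction F)
    (h : Φ.norm (expWeight a F) ≠ ∞) (x y : Γ) (s : Finset (Finset Γ))
    (hs : ∀ Z ∈ s, x ∈ Z ∧ y ∈ Z) :
    ∑ Z ∈ s, ‖Φ.term Z‖ ≤ (Φ.norm (expWeight a F)).toReal * expWeight a F (dist x y) := by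
  classical
  have hpos : 0 < expWeight a F (dist x y) := expWeight_pos hF dist_nonneg
  rw [← div_le_iff₀ hpos, Finset.sum_div]
  refine (ENNReal.ofReal_le_iff_le_toReal h).1 ?_
  rw [ENNReal.ofReal_sum_of_nonneg fun Z _ => by positivity,
    ← Finset.sum_subtype_of_mem (fun Z => ENNReal.ofReal (‖Φ.term Z‖ / expWeight a F (dist x y))) hs]
  exact (ENNReal.sum_le_tsum _).trans (le_iSup₂_of_le x y le_rfl)

/-- The exponential part of the weight is bounded by its value at the distance of the sets, which
leaves `F` to sum over `Y` at each boundary point. -/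
lemma boundarySum_expWeight_le (Φ : Interaction 𝓗) (hF : IsDecayFunction F) (ha : 0 ≤ a)
    {M : ℝ≥0} (hM : unifNorm Γ F ≤ M) (X Y : Finset Γ) :
    boundarySum Φ (fun x y => expWeight a F (dist x y)) X Y
      ≤ (Φ.boundary X).card * (M * Real.exp (-a * setDist X Y)) := by
  rw [← nsmul_eq_mul]
  refine Finset.sum_le_card_nsmul _ _ _ fun x hx => ?_
  calc ∑ y ∈ Y, expWeight a F (dist x y)
      ≤ ∑ y ∈ Y, F (dist x y) * Real.exp (-a * setDist X Y) := by
        refine Finset.sum_le_sum fun y hy => ?_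
        rw [expWeight, mul_comm]
        have h1 := setDist_le (Φ.mem_boundary.1 hx).1 hy
        refine mul_le_mul_of_nonneg_left (Real.exp_le_exp.2 ?_) (hF.2 _ dist_nonneg).le
        nlinarith
    _ ≤ M * Real.exp (-a * setDist X Y) := by
        rw [← Finset.sum_mul]
        exact mul_le_mul_of_nonneg_right (sum_le_of_unifNorm hF hM x Y) (Real.exp_pos _).le

variable {h : (x : Γ) → 𝓗 x →ₗ.[ℂ] 𝓗 x}

/-- The Lieb-Robinson bound for exponentially decaying interactions. -/
lemma norm_commutator_le_boundary (hh : ∀ x, IsSelfAdjoint (h x)) (Φ : Interaction 𝓗)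
    (hF : IsDecayFunction F) (ha : 0 ≤ a) {M : ℝ≥0} (hM : unifNorm Γ F ≤ M)
    (hC : convConst Γ F < ∞) (hΦ : Φ.norm (expWeight a F) < ∞) {Λ X Y : Finset Γ} (hX : X ⊆ Λ)
    (hY : Y ⊆ Λ) (hd : Disjoint X Y) (A : LocalAlgebra 𝓗 X) (B : LocalAlgebra 𝓗 Y) (t : ℝ) :
    ‖heisenberg (hamiltonian h Φ Λ) t (amplify hX A) * amplify hY B
      - amplify hY B * heisenberg (hamiltonian h Φ Λ) t (amplify hX A)‖
      ≤ 2 * M / F 0 * ‖A‖ * ‖B‖ * (Φ.boundary X).card * Real.exp (-a * setDist X Y)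
        * (Real.exp (2 * (Φ.norm (expWeight a F)).toReal
          * (convConst Γ (expWeight a F)).toReal * |t|) - 1) := by
  have hF0 := hF.2 0 le_rfl
  have hG : ∀ x y : Γ, 0 ≤ expWeight a F (dist x y) := fun x y =>
    (expWeight_pos hF dist_nonneg).le
  have hexp : 0 ≤ Real.exp (2 * (Φ.norm (expWeight a F)).toReal
      * (convConst Γ (expWeight a F)).toReal * |t|) - 1 :=
    sub_nonneg.2 (Real.one_le_exp (by positivity))
  -- On the empty lattice the convolution constant is zero, while the Lieb-Robinson bound divides by
  -- a positive one; there any positive constant can be used.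
  rcases isEmpty_or_nonempty Γ with hΓ | hΓ
  · have h1 := norm_commutator_heisenberg_le (p := 0) (C := 1)
      (G := fun x y : Γ => expWeight a F (dist x y)) hh Φ le_rfl one_pos hG
      (fun x => hΓ.elim x) (fun x => hΓ.elim x) hX hY hd A B t
    refine h1.trans ?_
    simp only [mul_zero, zero_mul, Real.exp_zero, sub_self]
    positivity
  have hC' : convConst Γ (expWeight a F) ≠ ∞ := ((convConst_expWeight_le hF ha).trans_lt hC).ne
  have hCF := le_convConst_toReal hF hC'
  have h1 := norm_commutator_heisenberg_le (G := fun x y : Γ => expWeight a F (dist x y)) hh Φ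
    ENNReal.toReal_nonneg (hF0.trans_le hCF) hG (Φ.sum_norm_le hF hΦ.ne)
    (sum_mul_le_of_convConst hF hC') hX hY hd A B t
  refine h1.trans (mul_le_mul_of_nonneg_right ?_ hexp)
  calc _ ≤ 2 / F 0 * ‖A‖ * ‖B‖ * ((Φ.boundary X).card * (M * Real.exp (-a * setDist X Y))) := by
        have h2 := boundarySum_expWeight_le Φ hF ha hM X Y
        have h3 := boundarySum_nonneg Φ hG X Y
        gcongr
    _ = _ := by ring

/-- The Lieb-Robinson bound, with the smaller of the two boundaries. -/
lemma norm_commutator_le_min (hh : ∀ x, IsSelfAdjoint (h x)) (Φ : Interaction 𝓗)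
    (hF : IsDecayFunction F) (ha : 0 ≤ a) {M : ℝ≥0} (hM : unifNorm Γ F ≤ M)
    (hC : convConst Γ F < ∞) (hΦ : Φ.norm (expWeight a F) < ∞) {Λ X Y : Finset Γ} (hX : X ⊆ Λ)
    (hY : Y ⊆ Λ) (hd : Disjoint X Y) (A : LocalAlgebra 𝓗 X) (B : LocalAlgebra 𝓗 Y) (t : ℝ) :
    ‖amplify hX A * heisenberg (hamiltonian h Φ Λ) t (amplify hY B)
      - heisenberg (hamiltonian h Φ Λ) t (amplify hY B) * amplify hX A‖
      ≤ 2 * M / F 0 * ‖A‖ * ‖B‖ * (min (Φ.boundary X).card (Φ.boundary Y).card : ℕ)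
        * Real.exp (-a * setDist X Y)
        * (Real.exp (2 * (Φ.norm (expWeight a F)).toReal
          * (convConst Γ (expWeight a F)).toReal * |t|) - 1) := by
  -- The iteration starts from the evolved observable, so its boundary is the one that appears. To
  -- use that of `X`, the time is moved from `B` to `A`.
  rcases le_total (Φ.boundary X).card (Φ.boundary Y).card with hle | hle
  · rw [min_eq_left hle]
    refine (norm_commutator_heisenberg_symm (isSelfAdjoint_hamiltonian hh Φ Λ) t _ _).trans ?_
    have := norm_commutator_le_boundary hh Φ hF ha hM hC hΦ hX hY hd A B (-t)
    rwa [abs_neg] at this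
  · rw [min_eq_right hle, norm_sub_rev]
    refine (norm_commutator_le_boundary hh Φ hF ha hM hC hΦ hY hX hd.symm B A t).trans
      (le_of_eq ?_)
    rw [setDist_comm]
    ring

variable {K : Type w} [NormedAddCommGroup K] [InnerProductSpace ℂ K] [CompleteSpace K]

/-- The Lieb-Robinson bound passes to the infinite volume dynamics. -/
lemma norm_commutator_le_of_generatesDynamics (hh : ∀ x, IsSelfAdjoint (h x))
    (Φ : Interaction 𝓗) (hF : IsDecayFunction F) (ha : 0 ≤ a) {M : ℝ≥0} (hM : unifNorm Γ F ≤ M)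
    (hC : convConst Γ F < ∞) (hΦ : Φ.norm (expWeight a F) < ∞) (ρ : LocalRepresentation 𝓗 K)
    {H : K →ₗ.[ℂ] K} (hH : GeneratesDynamics h Φ ρ H) {X Y : Finset Γ} (hd : Disjoint X Y)
    (A : LocalAlgebra 𝓗 X) (B : LocalAlgebra 𝓗 Y) (t : ℝ) :
    ‖ρ.π X A * heisenberg H t (ρ.π Y B) - heisenberg H t (ρ.π Y B) * ρ.π X A‖
      ≤ 2 * M / F 0 * ‖A‖ * ‖B‖ * (min (Φ.boundary X).card (Φ.boundary Y).card : ℕ)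
        * Real.exp (-a * setDist X Y)
        * (Real.exp (2 * (Φ.norm (expWeight a F)).toReal
          * (convConst Γ (expWeight a F)).toReal * |t|) - 1) := by
  classical
  refine le_of_forall_pos_le_add fun ε hε => ?_
  have hA := norm_nonneg A
  obtain ⟨Λ₀, hΛ₀⟩ := hH t Y B (ε / (2 * ‖A‖ + 1)) (by positivity)
  have hX : X ⊆ Λ₀ ∪ (X ∪ Y) := Finset.subset_union_left.trans Finset.subset_union_right
  have hY : Y ⊆ Λ₀ ∪ (X ∪ Y) := Finset.subset_union_right.trans Finset.subset_union_right
  set Λ := Λ₀ ∪ (X ∪ Y) with hΛ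
  have h1 := hΛ₀ Λ hY Finset.subset_union_left
  set S := heisenberg (hamiltonian h Φ Λ) t (amplify hY B) with hS
  set R := heisenberg H t (ρ.π Y B) with hR
  -- The commutator in the representation is the image of a finite-volume one plus the commutator
  -- with the approximation error. The finite-volume bound does not depend on `Λ`.
  have e1 : ρ.π X A * R - R * ρ.π X A = ρ.π Λ (amplify hX A * S - S * amplify hX A)
      - (ρ.π X A * (ρ.π Λ S - R) - (ρ.π Λ S - R) * ρ.π X A) := by
    rw [map_sub, map_mul, map_mul, ρ.compatible hX]
    noncomm_ring
  rw [e1]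
  refine (norm_sub_le _ _).trans (add_le_add ((ρ.norm_le _ _).trans ?_) ?_)
  · exact norm_commutator_le_min hh Φ hF ha hM hC hΦ hX hY hd A B t
  · calc _ ≤ 2 * ‖ρ.π X A‖ * ‖ρ.π Λ S - R‖ := norm_commutator_le _ _
      _ ≤ 2 * ‖A‖ * (ε / (2 * ‖A‖ + 1)) := by
        have := ρ.norm_le X A
        gcongr
      _ = ε * (2 * ‖A‖ / (2 * ‖A‖ + 1)) := by ring
      _ ≤ ε * 1 := by
        refine mul_le_mul_of_nonneg_left ((div_le_one (by positivity)).2 ?_) hε.le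
        linarith
      _ = ε := mul_one ε

end Clustering

end QuantumLattice

end

/-! ### The clustering theorem -/

theorem theorem4p1 (F : ℝ → ℝ) (hF : QuantumLattice.IsDecayFunction F) (M : ℝ≥0) (γ : ℝ)
    (hγ : 0 < γ) :
    ∃ c : ℝ, ∀ (Γ : Type u) [MetricSpace Γ] (𝓗 : Γ → Type v) [∀ x, NormedAddCommGroup (𝓗 x)]
      [∀ x, InnerProductSpace ℂ (𝓗 x)] [∀ x, CompleteSpace (𝓗 x)]
      (h : (x : Γ) → 𝓗 x →ₗ.[ℂ] 𝓗 x) (Φ : QuantumLattice.Interaction 𝓗) (a μ : ℝ),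
      QuantumLattice.unifNorm Γ F ≤ M →
      QuantumLattice.convConst Γ F < ∞ →
      (∀ x, IsSelfAdjoint (h x)) →
      0 < a →
      Φ.norm (QuantumLattice.expWeight a F) < ∞ →
      μ = a * γ / (γ + 4 * (Φ.norm (QuantumLattice.expWeight a F)).toReal *
        (QuantumLattice.convConst Γ (QuantumLattice.expWeight a F)).toReal) →
      0 < μ ∧
      -- finite volumes
      (∀ (Λ : Finset Γ) (Ω : QuantumLattice.HilbertTensor 𝓗 Λ),
        QuantumLattice.IsGappedGroundState (QuantumLattice.hamiltonian h Φ Λ) γ Ω →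
        ∀ (X Y : Finset Γ) (hX : X ⊆ Λ) (hY : Y ⊆ Λ), Disjoint X Y →
        ∀ (A : QuantumLattice.LocalAlgebra 𝓗 X) (B : QuantumLattice.LocalAlgebra 𝓗 Y),
          ‖QuantumLattice.correlation Ω (QuantumLattice.amplify hX A)
              (QuantumLattice.amplify hY B)‖ ≤
            c * ‖A‖ * ‖B‖ * min ((Φ.boundary X).card : ℝ) (Φ.boundary Y).card *
              Real.exp (-μ * QuantumLattice.setDist X Y)) ∧
      -- infinite volume
      (∀ (K : Type w) [NormedAddCommGroup K] [InnerProductSpace ℂ K] [CompleteSpace K]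
        (ρ : QuantumLattice.LocalRepresentation 𝓗 K) (H : K →ₗ.[ℂ] K),
        IsSelfAdjoint H →
        QuantumLattice.GeneratesDynamics h Φ ρ H →
        ∀ Ω : K, QuantumLattice.IsGappedGroundState H γ Ω →
        ∀ X Y : Finset Γ, Disjoint X Y →
        ∀ (A : QuantumLattice.LocalAlgebra 𝓗 X) (B : QuantumLattice.LocalAlgebra 𝓗 Y),
          ‖QuantumLattice.correlation Ω (ρ.π X A) (ρ.π Y B)‖ ≤
            c * ‖A‖ * ‖B‖ * min ((Φ.boundary X).card : ℝ) (Φ.boundary Y).card *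
              Real.exp (-μ * QuantumLattice.setDist X Y)) := by
  have hF0 := hF.2 0 le_rfl
  -- The `4` comes from the trivial and Gaussian estimates, `2M/F 0` from the Lieb-Robinson
  -- prefactor; `γ` affects only the rate.
  refine ⟨4 + 2 * M / F 0, ?_⟩
  intro Γ _ 𝓗 _ _ _ h Φ a μ hM hC hh ha hΦ hμ
  have hp : 0 ≤ (Φ.norm (QuantumLattice.expWeight a F)).toReal := ENNReal.toReal_nonneg
  have hCa : 0 ≤ (QuantumLattice.convConst Γ (QuantumLattice.expWeight a F)).toReal :=
    ENNReal.toReal_nonneg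
  -- The Lieb-Robinson growth rate is `κ = 2‖Φ‖_a C_a`, so `γ + 2κ` is the denominator of `μ`.
  have hμ' : μ = a * γ / (γ + 2 * (2 * (Φ.norm (QuantumLattice.expWeight a F)).toReal *
      (QuantumLattice.convConst Γ (QuantumLattice.expWeight a F)).toReal)) := by
    rw [hμ]
    congr 2
    ring
  have hc : 0 ≤ 2 * (M : ℝ) / F 0 := by positivity
  refine ⟨by rw [hμ]; positivity, ?_, ?_⟩
  · intro Λ Ω hΩ X Y hX hY hd A B
    rw [hμ', ← Nat.cast_min]
    exact QuantumLattice.norm_correlation_le_of_commutator_le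
      (QuantumLattice.isSelfAdjoint_hamiltonian hh Φ Λ) hγ hΩ
      (QuantumLattice.amplify_commute_of_disjoint hX hY hd A B)
      (QuantumLattice.norm_amplify_le hX A) (QuantumLattice.norm_amplify_le hY B) hc
      (by positivity)
      (QuantumLattice.norm_commutator_le_min hh Φ hF ha.le hM hC hΦ hX hY hd A B)
  · intro K _ _ _ ρ H hH hdyn Ω hΩ X Y hd A B
    rw [hμ', ← Nat.cast_min]
    exact QuantumLattice.norm_correlation_le_of_commutator_le hH hγ hΩ (ρ.commute hd A B)
      (ρ.norm_le X A) (ρ.norm_le Y B) hc (by positivity)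
      (QuantumLattice.norm_commutator_le_of_generatesDynamics hh Φ hF ha.le hM hC hΦ ρ hdyn hd A B)
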